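/- **Setting.** Let $n\ge 3$, $0<r<1$, $\ell=\frac{1-r}{2}$, $\theta_n=\frac{2\pi}{n}$, $\alpha_n=\pi-\theta_n$, and identify $\mathbb R^2=\mathbb C$. Let $\phi_L(z)=\ell z$, $\phi_R(z)=\ell z+\ell+r$, $\psi_1(z)=\ell+re^{i\alpha_n}z$, $\psi_k(z)=\psi_{k-1}(1)+re^{i(\alpha_n-(k-1)\theta_n)}z$ for $1<k\le n-1$, and let $C_{n,r}$ be the nonempty compact set with $C_{n,r}=\phi_L(C_{n,r})\cup\phi_R(C_{n,r})\cup\bigcup_{k=1}^{n-1}\psi_k(C_{n,r})$. Let $K_{n,r}$ be (a congruent copy of) the union of the $n$ copies of $C_{n,r}$ placed, pointing outwards, on the edges of a regular $n$-gon of side one. Assume that $K_{n,r}$ is a simple closed curve (the closed curve that runs once through the $n$ copies of $C_{n,r}$, each run through in the order $\phi_L,\psi_1,\dots,\psi_{n-1},\phi_R$ at every level, does not meet itself), and let $\Omega$ be the bounded component of $\mathbb C\setminus K_{n,r}$. For $\varepsilon>0$ let $V(\varepsilon)$ be the area of the set of points of $\Omega$ at distance less than $\varepsilon$ from $K_{n,r}$,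 let $D$ be the upper Minkowski dimension of $(K_{n,r},\Omega)$, i.e. the infimum of the $d$ with $\limsup_{t\to0^+}V(t)/t^{2-d}=0$, put $V_K=V/n$ and $R(\varepsilon)=V_K(\varepsilon)-2\ell^2V_K(\varepsilon/\ell)-(n-1)r^2V_K(\varepsilon/r)$. For $\delta>0$ let $$\tilde\zeta(s)=\tilde\zeta_{K_{n,r},\Omega}(s;\delta)=\int_0^\delta t^{s-3}V(t)\,dt\quad(\operatorname{Re}s>D),\qquad \tilde\zeta_R(s)=\tilde\zeta_R(s;\delta)=n\int_0^\delta t^{s-3}R(t)\,dt\quad(\operatorname{Re}s>0),$$ extended meromorphically as far as needed, and let $\mathcal D_L=\{\omega\in\mathbb C:1=2\ell^\omega+(n-1)r^\omega\}$. **Languidity.** A screen is a Lipschitz function $S:\mathbb R\to\mathbb R$. Let $f$ be holomorphic in $\operatorname{Re}s>D_f$, with a meromorphic continuation to a neighbourhood of $\{\operatorname{Re}s\ge S(\operatorname{Im}s)\}$. It satisfies **L1** with exponent $\kappa$ with respect to $S$ if there are $C>0$, $\beta>D_f$ and a sequence $(\tau_m)_{m\in\mathbb Z}$ with $\tau_m\to\pm\infty$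 as $m\to\pm\infty$ and $\tau_{-m}<0<\tau_m$ for $m\ge1$, such that for all $m$ and all $\sigma\in[S(\tau_m),\beta]$ the point $\sigma+i\tau_m$ is not a pole of $f$ and $|f(\sigma+i\tau_m)|\le C(|\tau_m|+1)^\kappa$. It satisfies **L2** if there is $C>0$ such that for all $|\tau|\ge1$ the point $S(\tau)+i\tau$ is not a pole and $|f(S(\tau)+i\tau)|\le C|\tau|^\kappa$. It is languid with exponent $\kappa$ with respect to $S$ if both hold. A function $f$, holomorphic in $\operatorname{Re}s>D_f$ and meromorphic in $\mathbb C$, is strongly languid with exponent $\kappa$ if there are screens $S_m$ ($m\in\mathbb N$), with a common Lipschitz constant, bounded above and with $\sup S_m\to-\infty$, such that $f$ satisfies L1 with exponent $\kappa$ with respect to each $S_m$ (the constants and the sequence may depend on $m$) and there are $C,B>0$ such that for all $m$ and all $\tau\in\mathbb R$ the point $S_m(\tau)+i\tau$ is not a pole and $|f(S_m(\tau)+i\tau)|\le CB^{|S_m(\tau)|}(|\tau|+1)^\kappa$. Take $D_f=D$ for $f=\tilde\zeta$ and $D_f=0$ for $f=\tilde\zeta_R$. The relative fractal drum $(K_{n,r},\Omega)$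 is strongly languid with exponent $\kappa$ if $\tilde\zeta(\cdot\,;\delta)$ is, for some $\delta>0$. **Theorem.** In this setting, for every $\delta>0$: 1. For every $\alpha>0$, $\tilde\zeta$ satisfies L1 with exponent $\kappa=0$ with respect to the constant screen $S\equiv\alpha$. 2. $\tilde\zeta$ is languid with exponent $\kappa=0$ with respect to every constant screen $S\equiv\alpha>0$ whose line $\operatorname{Re}s=\alpha$ has positive distance from $\mathcal D_L$. 3. For all $0<a<b$ there is a screen $S$ with $a\le S\le b$ with respect to which $\tilde\zeta$ is languid with exponent $\kappa=0$. 4. For every $\kappa\ge0$ (in particular $\kappa=0$): if $\tilde\zeta_R$ is strongly languid with exponent $\kappa$, then so are $\tilde\zeta$ and the relative fractal drum $(K_{n,r},\Omega)$. -/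

import Mathlib

open Set Filter Topology MeasureTheory

noncomputable section

namespace GKF

/-! ### Generalized von Koch curves and snowflakes (the plane is `ℂ`) -/

/-- The conjugate scaling ratio `ℓ = (1 - r) / 2`. -/
def ell (r : ℝ) : ℝ := (1 - r) / 2

/-- The central angle `θ_n = 2π / n`. -/
def theta (n : ℕ) : ℝ := 2 * Real.pi / n

/-- The interior angle `α_n = π - 2π / n`. -/
def alpha (n : ℕ) : ℝ := Real.pi - 2 * Real.pi / n

/-- `psi n r j` is the similitude `ψ_{j+1}` of ratio `r`: it carries the segment `[0, 1]` to the
`(j+1)`-st of the `n - 1` new edges of the regular `n`-gon of side `r` that is erected on the middle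
portion of `[0, 1]`. -/
def psi (n : ℕ) (r : ℝ) : ℕ → ℂ → ℂ
  | 0, z => (ell r : ℂ) + r * Complex.exp (Complex.I * (alpha n : ℝ)) * z
  | j + 1, z => psi n r j 1
      + r * Complex.exp (Complex.I * ((alpha n - (j + 1) * theta n : ℝ) : ℂ)) * z

/-- The `n + 1` similitudes `φ_L, ψ_1, …, ψ_{n-1}, φ_R` of the `(n, r)`-von Koch system, listed in
the order (`k = 0, …, n`) in which the curve runs through its pieces. -/
def vkMap (n : ℕ) (r : ℝ) : ℕ → ℂ → ℂ
  | 0, z => (ell r : ℂ) * z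
  | j + 1, z => if j + 1 = n then (ell r : ℂ) * z + ((ell r + r : ℝ) : ℂ) else psi n r j z

/-- `C` is the nonempty compact fixed set (attractor) of the `(n, r)`-von Koch system. -/
def IsVonKochCurve (n : ℕ) (r : ℝ) (C : Set ℂ) : Prop :=
  C.Nonempty ∧ IsCompact C ∧ C = ⋃ k ∈ Finset.range (n + 1), vkMap n r k '' C

/-- The rigid motions that carry `[0, 1]` to the successive edges of a regular `n`-gon of side one,
run through clockwise, so that the von Koch curves placed on the edges point outwards. -/
def edge (n : ℕ) : ℕ → ℂ → ℂ
  | 0, z => z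
  | k + 1, z => edge n k 1 + Complex.exp (-Complex.I * ((((k + 1 : ℕ) : ℝ) * theta n : ℝ) : ℂ)) * z

/-- `K` is an `(n, r)`-von Koch snowflake: a set congruent to the union of the `n` von Koch curves
placed on the edges of a regular `n`-gon. -/
def IsVonKochSnowflake (n : ℕ) (r : ℝ) (K : Set ℂ) : Prop :=
  ∃ C : Set ℂ, IsVonKochCurve n r C ∧ ∃ F : ℂ ≃ᵢ ℂ,
    K = F '' (⋃ k ∈ Finset.range n, edge n k '' C)

/-- `γ : [0, 1] → ℂ` is the parametrization of the `(n, r)`-von Koch curve that runs through the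
`n + 1` pieces `φ_L(C), ψ_1(C), …, φ_R(C)` one after the other. -/
def IsVonKochParam (n : ℕ) (r : ℝ) (γ : ℝ → ℂ) : Prop :=
  ContinuousOn γ (Icc 0 1) ∧
    ∀ k ∈ Finset.range (n + 1), ∀ t ∈ Icc (0 : ℝ) 1,
      γ ((k + t) / (n + 1)) = vkMap n r k (γ t)

/-- The `(n, r)`-von Koch snowflake is a simple closed curve: the closed curve
`k + t ↦ edge n k (γ t)` (`0 ≤ k < n`, `0 ≤ t < 1`), which runs once through the `n` von Koch curves,
does not meet itself. -/
def IsSimpleClosed (n : ℕ) (r : ℝ) : Prop :=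
  ∃ γ : ℝ → ℂ, IsVonKochParam n r γ ∧
    InjOn (fun p : ℕ × ℝ => edge n p.1 (γ p.2)) ((Finset.range n : Set ℕ) ×ˢ Ico (0 : ℝ) 1)

/-- `Ω` is a bounded connected component of the complement of `K`. -/
def IsBoundedComponent (Ω K : Set ℂ) : Prop :=
  (∃ x ∈ Kᶜ, Ω = connectedComponentIn Kᶜ x) ∧ Bornology.IsBounded Ω

/-! ### Tube functions and tube zeta functions -/

/-- The relative tube function `V_{X,Ω}(ε)`: the area of the part of the open
`ε`-neighbourhood of `X` that lies in `Ω`. -/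
def tubeFun (X Ω : Set ℂ) (ε : ℝ) : ℝ := (volume (Metric.thickening ε X ∩ Ω)).toReal

/-- The integral `∫_0^δ t^{s-3} V_{X,Ω}(t) dt` that defines the relative tube zeta function in the
plane (for `s` of sufficiently large real part). -/
def tubeZeta (X Ω : Set ℂ) (δ : ℝ) (s : ℂ) : ℂ :=
  ∫ t in Ioc (0 : ℝ) δ, (t : ℂ) ^ (s - 3) * (tubeFun X Ω t : ℂ)

/-- The relative upper Minkowski dimension: the infimum of the `d` for which the `d`-dimensional
upper Minkowski content `limsup_{t → 0+} V_{X,Ω}(t) / t^{2-d}` vanishes. -/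
def upperMinkowskiDim (X Ω : Set ℂ) : ℝ :=
  sInf {d : ℝ | Tendsto (fun t : ℝ => tubeFun X Ω t / t ^ (2 - d)) (𝓝[>] 0) (𝓝 0)}

/-- `V_K = V_{K,Ω} / n`, the share of one of the `n` congruent sectors in the tube function. -/
def sectorTubeFun (n : ℕ) (K Ω : Set ℂ) (ε : ℝ) : ℝ := tubeFun K Ω ε / n

/-- The remainder `R(ε) = V_K(ε) - 2 ℓ² V_K(ε/ℓ) - (n-1) r² V_K(ε/r)` of the scaling functional
equation. -/
def remainder (n : ℕ) (r : ℝ) (K Ω : Set ℂ) (ε : ℝ) : ℝ :=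
  sectorTubeFun n K Ω ε - 2 * ell r ^ 2 * sectorTubeFun n K Ω (ε / ell r)
    - ((n : ℝ) - 1) * r ^ 2 * sectorTubeFun n K Ω (ε / r)

/-- `ζ_R(s; δ) = n ∫_0^δ t^{s-3} R(t) dt`. -/
def remainderZeta (n : ℕ) (r : ℝ) (K Ω : Set ℂ) (δ : ℝ) (s : ℂ) : ℂ :=
  n * ∫ t in Ioc (0 : ℝ) δ, (t : ℂ) ^ (s - 3) * (remainder n r K Ω t : ℂ)

/-- The poles of `ζ_L(s) = 1 / (1 - 2 ℓ^s - (n-1) r^s)`. -/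
def scalingPoles (n : ℕ) (r : ℝ) : Set ℂ :=
  {ω : ℂ | 1 - 2 * (ell r : ℂ) ^ ω - ((n : ℂ) - 1) * (r : ℂ) ^ ω = 0}

/-! ### Languidity -/

/-- The point `σ + iτ`. -/
def pt (σ τ : ℝ) : ℂ := (σ : ℂ) + τ * Complex.I

/-- `f` is holomorphic in the half plane `Re s > D` and `g` is a meromorphic continuation of `f` to
a neighbourhood of the window `{s | Re s ≥ S (Im s)}` of the screen `S`. -/
def IsContinuation (f : ℂ → ℂ) (D : ℝ) (S : ℝ → ℝ) (g : ℂ → ℂ) : Prop :=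
  DifferentiableOn ℂ f {s | D < s.re} ∧
    ∃ U : Set ℂ, IsOpen U ∧ {s : ℂ | S s.im ≤ s.re} ⊆ U ∧ MeromorphicOn g U ∧
      ∀ s ∈ U, D < s.re → g s = f s

/-- Languidity hypothesis **L1**: `f`, holomorphic in `Re s > D`, continues meromorphically to the
window of the screen `S`, and the continuation has no pole and grows at most like a power on
a doubly infinite sequence of horizontal segments. -/
def SatisfiesL1 (f : ℂ → ℂ) (D κ : ℝ) (S : ℝ → ℝ) : Prop :=
  (∃ L : NNReal, LipschitzWith L S) ∧
  ∃ g : ℂ → ℂ, IsContinuation f D S g ∧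
    ∃ C > (0 : ℝ), ∃ β > D, ∃ τ : ℤ → ℝ,
      Tendsto τ atTop atTop ∧ Tendsto τ atBot atBot ∧
      (∀ m : ℤ, 1 ≤ m → τ (-m) < 0 ∧ 0 < τ m) ∧
      ∀ m : ℤ, ∀ σ ∈ Icc (S (τ m)) β,
        AnalyticAt ℂ g (pt σ (τ m)) ∧ ‖g (pt σ (τ m))‖ ≤ C * (|τ m| + 1) ^ κ

/-- Languidity hypothesis **L2**: the continuation has no pole and grows at most like a power along
the screen. -/
def SatisfiesL2 (f : ℂ → ℂ) (D κ : ℝ) (S : ℝ → ℝ) : Prop :=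
  (∃ L : NNReal, LipschitzWith L S) ∧
  ∃ g : ℂ → ℂ, IsContinuation f D S g ∧
    ∃ C > (0 : ℝ), ∀ τ : ℝ, 1 ≤ |τ| →
      AnalyticAt ℂ g (pt (S τ) τ) ∧ ‖g (pt (S τ) τ)‖ ≤ C * |τ| ^ κ

/-- `f` is languid with exponent `κ` with respect to the screen `S`. -/
def Languid (f : ℂ → ℂ) (D κ : ℝ) (S : ℝ → ℝ) : Prop :=
  SatisfiesL1 f D κ S ∧ SatisfiesL2 f D κ S

/-- `f`, holomorphic in `Re s > D`, is strongly languid with exponent `κ`. -/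
def StronglyLanguid (f : ℂ → ℂ) (D κ : ℝ) : Prop :=
  DifferentiableOn ℂ f {s | D < s.re} ∧
  ∃ g : ℂ → ℂ, MeromorphicOn g univ ∧ (∀ s : ℂ, D < s.re → g s = f s) ∧
  ∃ S : ℕ → ℝ → ℝ,
    (∃ L : NNReal, ∀ m, LipschitzWith L (S m)) ∧
    (∀ m, BddAbove (range (S m))) ∧
    Tendsto (fun m => ⨆ τ : ℝ, S m τ) atTop atBot ∧
    (∀ m, SatisfiesL1 f D κ (S m)) ∧
    ∃ C > (0 : ℝ), ∃ B > (0 : ℝ), ∀ (m : ℕ) (τ : ℝ),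
      AnalyticAt ℂ g (pt (S m τ) τ) ∧
        ‖g (pt (S m τ) τ)‖ ≤ C * B ^ |S m τ| * (|τ| + 1) ^ κ

/-- The relative fractal drum `(X, Ω)` is strongly languid: its tube zeta function is, for some
cutoff `δ > 0`. -/
def StronglyLanguidRFD (X Ω : Set ℂ) (κ : ℝ) : Prop :=
  ∃ δ > (0 : ℝ), StronglyLanguid (tubeZeta X Ω δ) (upperMinkowskiDim X Ω) κ

end GKF

end

/-! Everything follows from writing the tube zeta function as `G / E`, where `E(s) = (1 - ℓ^s)(1 -
2ℓ^s - (n-1)r^s)` and `G` is entire with `‖G s‖ ≤ A * B ^ |Re s|` (`isDenQuotient_tubeZeta`). The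
factor `1 - ℓ^s` comes from an exact self-similarity of the remainder: `R(ℓt) = ℓ² R(t)` for all
small `t` (`snowflake_remainder`). Hence `R(t) - ℓ² R(t/ℓ)` vanishes near `0`, and after truncation
at `δ` its Mellin transform is entire and bounded on vertical lines (`exists_entire_numerator`).

Geometry. Cut the snowflake into similar copies of one arc and subtract from its inner tube the
corresponding copies of the tube of that arc. For small `ε` the difference lives near the finitely
many corners. At a corner, curve and inside are invariant under the homothety of ratio `ℓ`, so the
area `F(ε)` of the difference satisfies `F(ℓε) = ℓ² F(ε)` (`integral_scale_of_corners`,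
`IsLoopOfArcs.tube_decomposition`). Using the cut into `n` arcs and the cut into `n(n+1)` arcs, one
eliminates the tube of the single arc and is left with `R`.

The delicate point is that these similitudes respect the inside and not only the curve. This is a
winding number argument. The index is one nonzero constant on `Ω` and `0` at the other points off
the curve, and both sides accumulate at every point of the curve. If a map preserves the curve
locally and changes the index by a function continuous across it, the change is locally constant; as
the index takes only two values, the change is `0` (`IsSimpleLoop.preserves_inside`). Continuity
holds because the index is a sum over the pieces, in which the singular terms cancel.

Analysis. It remains to bound `E` from below. Vertical translates of `E` belong to a continuous
family over the compact torus, so nonvanishing on suitable compact sets becomes a bound uniform in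
the height (`exists_uniform_lower_bound`). Horizontal segments give L1, circles together with the
maximum principle give L2 on lines, and alternating vertical and horizontal good segments give the
screen inside a prescribed strip. Far to the left the smaller base dominates and `‖E‖ ≥ 1`, so the
bound on `G` passes to the quotient; this is what strong languidity needs. -/

noncomputable section

namespace GKF

/-! ### Mellin transforms of truncated functions -/

/-- A bounded measurable function supported in `(0, δ]`. -/
structure IsTruncated (v : ℝ → ℂ) (δ : ℝ) : Prop where
  measurable : Measurable v
  bounded : ∃ M : ℝ, ∀ t, ‖v t‖ ≤ M
  support : ∀ t, t ∉ Ioc 0 δ → v t = 0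

theorem IsTruncated.integrable {v : ℝ → ℂ} {δ : ℝ} (h : IsTruncated v δ) : Integrable v := by
  obtain ⟨M, hM⟩ := h.bounded
  have : v = (Ioc 0 δ).indicator v := by
    ext t
    by_cases ht : t ∈ Ioc 0 δ
    · simp [ht]
    · rw [h.support t ht, indicator_of_notMem ht]
  rw [this, integrable_indicator_iff measurableSet_Ioc]
  exact Measure.integrableOn_of_bounded (M := M) (by simp) h.measurable.aestronglyMeasurable
    (Eventually.of_forall hM)

theorem IsTruncated.isBigO_atTop {v : ℝ → ℂ} {δ : ℝ} (h : IsTruncated v δ) (a : ℝ) :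
    v =O[atTop] (fun t : ℝ => t ^ (-a)) := by
  have : v =ᶠ[atTop] fun _ => (0 : ℂ) := by
    filter_upwards [eventually_gt_atTop δ] with t ht
    exact h.support t (fun h' => absurd h'.2 (not_le.2 ht))
  exact this.trans_isBigO (Asymptotics.isBigO_zero _ _)

theorem IsTruncated.mellinConvergent {v : ℝ → ℂ} {δ : ℝ} (h : IsTruncated v δ) {b : ℝ} {s : ℂ}
    (hb : v =O[𝓝[>] 0] (fun t : ℝ => t ^ (-b))) (hs : b < s.re) : MellinConvergent v s :=
  mellinConvergent_of_isBigO_rpow (h.integrable.locallyIntegrable.locallyIntegrableOn _)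
    (h.isBigO_atTop (s.re + 1)) (by linarith) hb hs

theorem IsTruncated.differentiableAt_mellin {v : ℝ → ℂ} {δ : ℝ} (h : IsTruncated v δ) {b : ℝ}
    {s : ℂ} (hb : v =O[𝓝[>] 0] (fun t : ℝ => t ^ (-b))) (hs : b < s.re) :
    DifferentiableAt ℂ (mellin v) s :=
  mellin_differentiableAt_of_isBigO_rpow (h.integrable.locallyIntegrable.locallyIntegrableOn _)
    (h.isBigO_atTop (s.re + 1)) (by linarith) hb hs

theorem IsTruncated.comp_mul {v : ℝ → ℂ} {δ l : ℝ} (h : IsTruncated v δ) (hl : 0 < l) (hl1 : l < 1) :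
    IsTruncated (fun t => v (l⁻¹ * t)) δ where
  measurable := h.measurable.comp (measurable_const_mul _)
  bounded := ⟨h.bounded.choose, fun t => h.bounded.choose_spec _⟩
  support t ht := by
    refine h.support _ fun h' => ht ⟨?_, ?_⟩
    · exact (mul_pos_iff_of_pos_left (inv_pos.2 hl)).1 h'.1
    · have h1 : 0 < t := (mul_pos_iff_of_pos_left (inv_pos.2 hl)).1 h'.1
      refine le_trans ?_ h'.2
      have : 1 ≤ l⁻¹ := (one_le_inv₀ hl).2 hl1.le
      nlinarith

theorem IsTruncated.sub {v w : ℝ → ℂ} {δ : ℝ} (h : IsTruncated v δ) (h' : IsTruncated w δ) :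
    IsTruncated (fun t => v t - w t) δ where
  measurable := h.measurable.sub h'.measurable
  bounded := by
    obtain ⟨M, hM⟩ := h.bounded
    obtain ⟨M', hM'⟩ := h'.bounded
    exact ⟨M + M', fun t => (norm_sub_le _ _).trans (add_le_add (hM t) (hM' t))⟩
  support t ht := by simp [h.support t ht, h'.support t ht]

theorem IsTruncated.const_mul {v : ℝ → ℂ} {δ : ℝ} (h : IsTruncated v δ) (c : ℂ) :
    IsTruncated (fun t => c * v t) δ where
  measurable := h.measurable.const_mul c
  bounded := by
    obtain ⟨M, hM⟩ := h.bounded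
    exact ⟨‖c‖ * M, fun t => by rw [norm_mul]; gcongr; exact hM t⟩
  support t ht := by simp [h.support t ht]

/-- Substitution yields the factor `l^(s-2)`, and the weight `l²` absorbs the shift by `2`. Each
rescaled term of the functional equation thus becomes multiplication by `c * l^s`. -/
theorem hasMellin_comp_scale {v : ℝ → ℂ} {l : ℝ} (hl : 0 < l) {s : ℂ} (c : ℂ)
    (hv : MellinConvergent v (s - 2)) :
    HasMellin (fun t => c * (l : ℂ) ^ 2 * v (l⁻¹ * t)) (s - 2)
      (c * (l : ℂ) ^ s * mellin v (s - 2)) := by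
  have h1 := (MellinConvergent.comp_mul_left (inv_pos.2 hl)).2 hv
  have h2 := hasMellin_const_smul h1 (c * (l : ℂ) ^ 2)
  refine ⟨h2.1, h2.2.trans ?_⟩
  rw [mellin_comp_mul_left _ _ (inv_pos.2 hl), smul_eq_mul, smul_eq_mul]
  have hl' : (l : ℂ) ≠ 0 := by exact_mod_cast hl.ne'
  have : ((l⁻¹ : ℝ) : ℂ) ^ (-(s - 2)) = (l : ℂ) ^ s / (l : ℂ) ^ 2 := by
    rw [Complex.ofReal_inv, Complex.inv_cpow _ _ (by rw [Complex.arg_ofReal_of_nonneg hl.le]; exact Real.pi_pos.ne),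
      Complex.cpow_neg, inv_inv, Complex.cpow_sub _ _ hl']
    norm_cast
  rw [this]
  field_simp

/-- The holomorphic function `(1 - u ℓ^s) (1 - 2 u ℓ^s - c v r^s)`. -/
def twistedDen (l r c : ℝ) (u v s : ℂ) : ℂ :=
  (1 - u * (l : ℂ) ^ s) * (1 - 2 * (u * (l : ℂ) ^ s) - c * (v * (r : ℂ) ^ s))

/-- On the support `c < t ≤ δ` both `t` and `t⁻¹` are at most `B = max 1 (max δ c⁻¹)`, so `t^(Re s)
≤ B^|Re s|` whatever the sign of `Re s`; the height of `s` plays no role. -/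
theorem norm_mellin_le {q : ℝ → ℂ} {δ c : ℝ} (hq : IsTruncated q δ) (hc : 0 < c)
    (hqc : ∀ t ≤ c, q t = 0) :
    ∃ A > (0 : ℝ), ∃ B ≥ (1 : ℝ), ∀ s : ℂ, ‖mellin q (s - 2)‖ ≤ A * B ^ |s.re| := by
  set A := ∫ t in Ioi (0 : ℝ), t ^ (-3 : ℝ) * ‖q t‖
  have hmeas : Measurable q := hq.measurable
  set B := max 1 (max δ c⁻¹)
  have hB : 1 ≤ B := le_max_left _ _
  have hint : Integrable (fun t : ℝ => t ^ (-3 : ℝ) * ‖q t‖) (volume.restrict (Ioi 0)) := by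
    refine Integrable.mono' (g := fun t => c ^ (-3 : ℝ) * ‖q t‖)
      ((hq.integrable.norm.const_mul _).integrableOn) ?_ ?_
    · exact ((measurable_id.pow_const _).mul hmeas.norm).aestronglyMeasurable
    · refine (ae_restrict_iff' measurableSet_Ioi).2 (Eventually.of_forall fun t ht => ?_)
      by_cases h : t ≤ c
      · simp [hqc t h]
      · push Not at h
        rw [norm_mul, norm_norm, Real.norm_of_nonneg (Real.rpow_nonneg (le_of_lt ht) _)]
        exact mul_le_mul_of_nonneg_right
          (Real.rpow_le_rpow_of_nonpos hc h.le (by norm_num)) (norm_nonneg _)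
  have hA : 0 ≤ A := by
    refine setIntegral_nonneg measurableSet_Ioi fun t ht => ?_
    exact mul_nonneg (Real.rpow_nonneg (le_of_lt ht) _) (norm_nonneg _)
  refine ⟨A + 1, by positivity, B, hB, fun s => ?_⟩
  have key : ‖mellin q (s - 2)‖ ≤ ∫ t in Ioi (0 : ℝ), B ^ |s.re| * (t ^ (-3 : ℝ) * ‖q t‖) := by
    refine norm_integral_le_of_norm_le (hint.const_mul _) ?_
    refine (ae_restrict_iff' measurableSet_Ioi).2 (Eventually.of_forall fun t ht => ?_)
    have ht : 0 < t := ht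
    by_cases h : t ∈ Ioc c δ
    · rw [norm_smul, Complex.norm_cpow_eq_rpow_re_of_pos ht]
      have : (s - 2 - 1).re = s.re + (-3) := by simp; ring
      rw [this, Real.rpow_add ht, ← mul_assoc]
      gcongr
      have hδB : t ≤ B := h.2.trans ((le_max_left _ _).trans (le_max_right _ _))
      have hcB : t⁻¹ ≤ B := (inv_anti₀ hc h.1.le).trans ((le_max_right _ _).trans (le_max_right _ _))
      rcases le_total 0 s.re with h0 | h0
      · rw [abs_of_nonneg h0]
        exact Real.rpow_le_rpow ht.le hδB h0
      · rw [abs_of_nonpos h0]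
        have : t ^ s.re = t⁻¹ ^ (-s.re) := by
          rw [Real.inv_rpow ht.le, Real.rpow_neg ht.le, inv_inv]
        rw [this]
        exact Real.rpow_le_rpow (by positivity) hcB (by linarith)
    · have : q t = 0 := by
        by_cases h' : t ≤ c
        · exact hqc t h'
        · exact hq.support t fun h2 => h ⟨not_le.1 h', h2.2⟩
      simp [this]
  rw [integral_const_mul] at key
  refine key.trans ?_
  have : 0 ≤ B ^ |s.re| := by positivity
  nlinarith

/-- If the remainder `ρ` of the scaling functional equation of `V` satisfies
`ρ (ℓ t) = ℓ² ρ (t)` for small `t`, then the tube zeta function is the quotient of an entire function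
by an exponential polynomial. -/
theorem exists_entire_numerator {V : ℝ → ℝ} (hV : Monotone V) (hV0 : ∀ t, 0 ≤ V t) {M : ℝ}
    (hM : ∀ t, V t ≤ M) {l r c δ : ℝ} (hl : 0 < l) (hl1 : l < 1) (hr : 0 < r) (hr1 : r < 1)
    (hδ : 0 < δ) {ε₀ : ℝ} (hε₀ : 0 < ε₀)
    (hom : ∀ t, 0 < t → t < ε₀ →
      V (l * t) - 2 * l ^ 2 * V (l * t / l) - c * r ^ 2 * V (l * t / r)
        = l ^ 2 * (V t - 2 * l ^ 2 * V (t / l) - c * r ^ 2 * V (t / r))) :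
    ∃ G : ℂ → ℂ, Differentiable ℂ G ∧
      (∃ A > (0 : ℝ), ∃ B ≥ (1 : ℝ), ∀ s : ℂ, ‖G s‖ ≤ A * B ^ |s.re|) ∧
      ∀ (d : ℝ) (s : ℂ), (fun t => V t / t ^ (2 - d)) =O[𝓝[>] 0] (fun _ => (1 : ℝ)) → d < s.re →
        DifferentiableAt ℂ
          (fun s : ℂ => ∫ t in Ioc (0 : ℝ) δ, (t : ℂ) ^ (s - 3) * (V t : ℂ)) s ∧
        (∫ t in Ioc (0 : ℝ) δ, (t : ℂ) ^ (s - 3) * (V t : ℂ)) * twistedDen l r c 1 1 s = G s := by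
  classical
  set v : ℝ → ℂ := (Ioc 0 δ).indicator fun t => (V t : ℂ) with hv
  have hvT : IsTruncated v δ := by
    refine ⟨(Complex.measurable_ofReal.comp hV.measurable).indicator measurableSet_Ioc,
      ⟨M, fun t => ?_⟩, fun t ht => indicator_of_notMem ht _⟩
    by_cases ht : t ∈ Ioc 0 δ
    · rw [hv, indicator_of_mem ht, Complex.norm_real, Real.norm_of_nonneg (hV0 t)]
      exact hM t
    · rw [hv, indicator_of_notMem ht, norm_zero]
      exact (hV0 0).trans (hM 0)
  have hzeta : ∀ s : ℂ, (∫ t in Ioc (0 : ℝ) δ, (t : ℂ) ^ (s - 3) * (V t : ℂ))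
      = mellin v (s - 2) := by
    intro s
    rw [mellin, ← integral_indicator measurableSet_Ioc, ← integral_indicator measurableSet_Ioi]
    congr 1
    ext t
    by_cases ht : t ∈ Ioc 0 δ
    · have ht0 : t ∈ Ioi (0 : ℝ) := ht.1
      rw [indicator_of_mem ht, indicator_of_mem ht0, hv, indicator_of_mem ht, smul_eq_mul]
      congr 2
      ring
    · rw [indicator_of_notMem ht]
      by_cases ht0 : t ∈ Ioi (0 : ℝ)
      · rw [indicator_of_mem ht0, hv, indicator_of_notMem ht, smul_zero]
      · rw [indicator_of_notMem ht0]
  -- `ρ` is the remainder formed from the truncated tube function. The second difference `q` kills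
  -- it near `0` by `hom`, and its transform carries both factors of `twistedDen`.
  set ρ : ℝ → ℂ := fun t => v t - 2 * (l : ℂ) ^ 2 * v (l⁻¹ * t) - c * (r : ℂ) ^ 2 * v (r⁻¹ * t)
  set q : ℝ → ℂ := fun t => ρ t - 1 * (l : ℂ) ^ 2 * ρ (l⁻¹ * t)
  have hρT : IsTruncated ρ δ :=
    (hvT.sub ((hvT.comp_mul hl hl1).const_mul _)).sub ((hvT.comp_mul hr hr1).const_mul _)
  have hqT : IsTruncated q δ := hρT.sub ((hρT.comp_mul hl hl1).const_mul _)
  -- For `t = l * u ≤ c₀` one has `u < ε₀`, so `hom` applies, and all arguments `u`, `u / l`, `u /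
  -- r`, `l * u`, `l * u / r` stay below `δ`, where `v` agrees with `V`.
  set c₀ : ℝ := min (l * ε₀ / 2) (min (l * (l * δ)) (l * (r * δ)))
  have hc₀ : 0 < c₀ := by positivity
  have hqc : ∀ t ≤ c₀, q t = 0 := by
    intro t ht
    rcases le_or_gt t 0 with h0 | h0
    · exact hqT.support t fun h => absurd h.1 (not_lt.2 h0)
    have h1 : t ≤ l * ε₀ / 2 := ht.trans (min_le_left _ _)
    have h2 : t ≤ l * (l * δ) := ht.trans ((min_le_right _ _).trans (min_le_left _ _))
    have h3 : t ≤ l * (r * δ) := ht.trans ((min_le_right _ _).trans (min_le_right _ _))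
    obtain ⟨u, rfl⟩ : ∃ u, t = l * u := ⟨t / l, by field_simp⟩
    have hu : 0 < u := (mul_pos_iff_of_pos_left hl).1 h0
    have hul : u ≤ l * δ := le_of_mul_le_mul_left h2 hl
    have hur : u ≤ r * δ := le_of_mul_le_mul_left h3 hl
    have hvV : ∀ t, 0 < t → t ≤ δ → v t = V t := fun t h h' =>
      indicator_of_mem (show t ∈ Ioc 0 δ from ⟨h, h'⟩) _
    have hlu : l * u ≤ u := by nlinarith
    have e1 : v u = V u := hvV _ hu (hul.trans (by nlinarith))
    have e2 : v (l⁻¹ * u) = V (u / l) := by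
      rw [inv_mul_eq_div]; exact hvV _ (by positivity) ((div_le_iff₀ hl).2 (by linarith))
    have e3 : v (r⁻¹ * u) = V (u / r) := by
      rw [inv_mul_eq_div]; exact hvV _ (by positivity) ((div_le_iff₀ hr).2 (by linarith))
    have e4 : v (l * u) = V (l * u) := hvV _ h0 (hlu.trans (hul.trans (by nlinarith)))
    have e5 : l⁻¹ * (l * u) = u := by field_simp
    have e6 : v (r⁻¹ * (l * u)) = V (l * u / r) := by
      rw [inv_mul_eq_div]; exact hvV _ (by positivity) ((div_le_iff₀ hr).2 (by linarith))
    have hh := hom u hu (by nlinarith)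
    have e7 : l * u / l = u := by field_simp
    rw [e7] at hh
    simp only [q, ρ, e5, e1, e2, e3, e4, e6]
    rw [one_mul, sub_eq_zero]
    exact_mod_cast hh
  have hqO : ∀ b : ℝ, q =O[𝓝[>] 0] (fun t : ℝ => t ^ (-b)) := by
    intro b
    have : q =ᶠ[𝓝[>] 0] fun _ => (0 : ℂ) := by
      filter_upwards [nhdsWithin_le_nhds (Iio_mem_nhds hc₀)] with t ht using hqc t (le_of_lt ht)
    exact this.trans_isBigO (Asymptotics.isBigO_zero _ _)
  refine ⟨fun s => mellin q (s - 2), fun s => ?_, norm_mellin_le hqT hc₀ hqc, fun d s hd hs => ?_⟩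
  · exact DifferentiableAt.comp (g := mellin q) s
      (hqT.differentiableAt_mellin (hqO _) (sub_one_lt (s - 2).re))
      ((differentiableAt_id (𝕜 := ℂ)).sub_const (2 : ℂ))
  -- The bound on `V t / t ^ (2 - d)` makes the transform of `v` converge at `s - 2` once `Re s >
  -- d`.
  have hvO : v =O[𝓝[>] 0] (fun t : ℝ => t ^ (-(d - 2))) := by
    have h1 : (fun t => ((V t / t ^ (2 - d)) * t ^ (2 - d))) =O[𝓝[>] 0]
        (fun t : ℝ => 1 * t ^ (2 - d)) := hd.mul (Asymptotics.isBigO_refl _ _)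
    have h2 : v =O[𝓝[>] 0] (fun t => ((V t / t ^ (2 - d)) * t ^ (2 - d))) := by
      refine Asymptotics.IsBigO.of_bound 1 ?_
      filter_upwards [self_mem_nhdsWithin] with t ht
      have ht : 0 < t := ht
      rw [div_mul_cancel₀ _ (Real.rpow_pos_of_pos ht _).ne', one_mul]
      by_cases h : t ∈ Ioc 0 δ
      · rw [hv, indicator_of_mem h, Complex.norm_real]
      · rw [hv, indicator_of_notMem h, norm_zero]
        exact norm_nonneg _
    refine (h2.trans h1).congr_right fun t => ?_
    rw [one_mul, neg_sub]
  have hre : d - 2 < (s - 2).re := by simpa using hs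
  have hconv := hvT.mellinConvergent hvO hre
  constructor
  · simp_rw [hzeta]
    exact DifferentiableAt.comp (g := mellin v) s (hvT.differentiableAt_mellin hvO hre)
      ((differentiableAt_id (𝕜 := ℂ)).sub_const (2 : ℂ))
  · rw [hzeta]
    have m1 := hasMellin_comp_scale hl 2 hconv
    have m2 := hasMellin_comp_scale hr (c : ℂ) hconv
    have m3 := hasMellin_sub hconv m1.1
    have m4 := hasMellin_sub m3.1 m2.1
    have hρc : MellinConvergent ρ (s - 2) := m4.1
    have m5 := hasMellin_comp_scale hl 1 hρc
    have m6 := hasMellin_sub hρc m5.1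
    have hρe : mellin ρ (s - 2) = mellin v (s - 2) - 2 * (l : ℂ) ^ s * mellin v (s - 2)
        - c * (r : ℂ) ^ s * mellin v (s - 2) := by
      rw [← m1.2, ← m2.2, ← m3.2, ← m4.2]
    have hqe : mellin q (s - 2) = mellin ρ (s - 2) - 1 * (l : ℂ) ^ s * mellin ρ (s - 2) := by
      rw [← m5.2, ← m6.2]
    change _ = mellin q (s - 2)
    rw [hqe, hρe, twistedDen]
    ring

/-! ### Lower bounds for almost periodic families -/

/-- If `E t` has no zero on the compact set `S i`, then with the same `i` it stays bounded below for
parameters near `t`; finitely many such neighbourhoods cover `T`. The set `S i` may vary with `t`,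
the constant does not. -/
theorem exists_uniform_lower_bound {T ι : Type*} [TopologicalSpace T] [CompactSpace T]
    {E : T → ℂ → ℂ} (hE : Continuous (Function.uncurry E)) {S : ι → Set ℂ}
    (hS : ∀ i, IsCompact (S i)) (hne : ∀ t, ∃ i, ∀ s ∈ S i, E t s ≠ 0) :
    ∃ c > (0 : ℝ), ∀ t, ∃ i, ∀ s ∈ S i, c ≤ ‖E t s‖ := by
  have key : ∃ c > (0 : ℝ), ∀ t ∈ (univ : Set T), ∃ i, ∀ s ∈ S i, c ≤ ‖E t s‖ := by
    refine isCompact_univ.induction_on (p := fun A => ∃ c > (0 : ℝ), ∀ t ∈ A, ∃ i, ∀ s ∈ S i,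
      c ≤ ‖E t s‖) ⟨1, one_pos, by simp⟩ ?_ ?_ ?_
    · rintro A B hAB ⟨c, hc, h⟩
      exact ⟨c, hc, fun t ht => h t (hAB ht)⟩
    · rintro A B ⟨c, hc, h⟩ ⟨c', hc', h'⟩
      refine ⟨min c c', lt_min hc hc', fun t ht => ?_⟩
      rcases ht with ht | ht
      · obtain ⟨i, hi⟩ := h t ht
        exact ⟨i, fun s hs => (min_le_left _ _).trans (hi s hs)⟩
      · obtain ⟨i, hi⟩ := h' t ht
        exact ⟨i, fun s hs => (min_le_right _ _).trans (hi s hs)⟩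
    · intro t _
      obtain ⟨i, hi⟩ := hne t
      obtain ⟨c, hc, hci⟩ : ∃ c > (0 : ℝ), ∀ s ∈ S i, c < ‖E t s‖ := by
        have hcont : ContinuousOn (fun s => ‖E t s‖) (S i) :=
          (hE.comp (Continuous.prodMk_right t)).norm.continuousOn
        rcases (S i).eq_empty_or_nonempty with h0 | h0
        · exact ⟨1, one_pos, by simp [h0]⟩
        · obtain ⟨s₀, hs₀, hmin⟩ := (hS i).exists_isMinOn h0 hcont
          have : 0 < ‖E t s₀‖ := norm_pos_iff.2 (hi s₀ hs₀)
          exact ⟨‖E t s₀‖ / 2, by positivity, fun s hs =>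
            (half_lt_self this).trans_le (hmin hs)⟩
      have hev : ∀ᶠ t' in 𝓝 t, ∀ s ∈ S i, c < ‖E t' s‖ :=
        (hS i).eventually_forall_of_forall_eventually fun s hs =>
          (hE.norm.tendsto (t, s)).eventually (lt_mem_nhds (hci s hs))
      exact ⟨_, mem_nhdsWithin_of_mem_nhds hev, c, hc, fun t' ht' => ⟨i, fun s hs => (ht' s hs).le⟩⟩
  obtain ⟨c, hc, h⟩ := key
  exact ⟨c, hc, fun t => h t (mem_univ t)⟩

/-- The identity theorem isolates the zeros, and a set of isolated points in the plane is countable.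
-/
theorem countable_zeros {h : ℂ → ℂ} (hd : Differentiable ℂ h) {s₁ : ℂ} (hs₁ : h s₁ ≠ 0) :
    {s | h s = 0}.Countable := by
  have han : AnalyticOnNhd ℂ h univ := fun s _ => hd.analyticAt s
  have hev : ∀ s, ∀ᶠ z in 𝓝[≠] s, h z ≠ 0 := by
    intro s
    rcases (hd.analyticAt s).eventually_eq_zero_or_eventually_ne_zero with h0 | h0
    · exact absurd (han.eqOn_zero_of_preconnected_of_eventuallyEq_zero isPreconnected_univ
        (mem_univ s) h0 (mem_univ s₁)) hs₁
    · exact h0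
  obtain ⟨t, _, ht, hsub⟩ := TopologicalSpace.countable_cover_nhdsWithin
    (f := fun x : ℂ => ({x} : Set ℂ)) (s := {s | h s = 0}) (fun x _ => by
      have := eventually_nhdsWithin_iff.1 (hev x)
      refine mem_nhdsWithin_iff_eventually.2 ?_
      filter_upwards [this] with z hz hz'
      by_contra hne
      exact hz hne hz')
  exact ht.mono (by simpa using hsub)

/-- The image of a countable set is null and cannot cover an interval. This selects heights,
abscissae and radii free of zeros. -/
theorem exists_mem_Icc_avoiding {A : Set ℂ} (hA : A.Countable) (π : ℂ → ℝ) {p q : ℝ} (hpq : p < q) :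
    ∃ y ∈ Icc p q, ∀ s ∈ A, π s ≠ y := by
  by_contra! hcon
  have hsub : Icc p q ⊆ π '' A := fun y hy => by
    obtain ⟨s, hs, h⟩ := hcon y hy
    exact ⟨s, hs, h⟩
  have h1 : (Icc p q).Countable := (hA.image π).mono hsub
  have h2 := h1.measure_zero volume
  rw [Real.volume_Icc, ENNReal.ofReal_eq_zero] at h2
  linarith

/-! ### The exponential polynomial -/

/-- The vertical translates of the exponential polynomial, parametrized by the torus. -/
def torusDen (l r c : ℝ) (t : Circle × Circle) (s : ℂ) : ℂ := twistedDen l r c t.1 t.2 s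

section
variable {l r c : ℝ}

theorem continuous_torusDen (hl : 0 < l) (hr : 0 < r) :
    Continuous (Function.uncurry (torusDen l r c)) := by
  have h1 : Continuous fun s : ℂ => (l : ℂ) ^ s :=
    Continuous.const_cpow continuous_id (Or.inl (by exact_mod_cast hl.ne'))
  have h2 : Continuous fun s : ℂ => (r : ℂ) ^ s :=
    Continuous.const_cpow continuous_id (Or.inl (by exact_mod_cast hr.ne'))
  have h3 : Continuous fun x : (Circle × Circle) × ℂ => (l : ℂ) ^ x.2 := h1.comp continuous_snd
  have h4 : Continuous fun x : (Circle × Circle) × ℂ => (r : ℂ) ^ x.2 := h2.comp continuous_snd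
  unfold Function.uncurry torusDen twistedDen
  fun_prop

theorem differentiable_torusDen (hl : 0 < l) (hr : 0 < r) (t : Circle × Circle) :
    Differentiable ℂ (torusDen l r c t) := by
  have h1 : Differentiable ℂ fun s : ℂ => (l : ℂ) ^ s := fun s =>
    differentiableAt_id.const_cpow (Or.inl (by exact_mod_cast hl.ne'))
  have h2 : Differentiable ℂ fun s : ℂ => (r : ℂ) ^ s := fun s =>
    differentiableAt_id.const_cpow (Or.inl (by exact_mod_cast hr.ne'))
  unfold torusDen twistedDen
  fun_prop

theorem tendsto_cpow_ofReal_atTop {b : ℝ} (hb : 0 < b) (hb1 : b < 1) :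
    Tendsto (fun x : ℝ => (b : ℂ) ^ (x : ℂ)) atTop (𝓝 0) := by
  have := (tendsto_rpow_atTop_of_base_lt_one b (by linarith) hb1)
  have h2 := (Complex.continuous_ofReal.tendsto 0).comp this
  refine (h2.congr fun x => ?_)
  simp [Complex.ofReal_cpow hb.le]

/-- Both powers tend to `0` as `Re s → ∞`, so every twisted product tends to `1`. -/
theorem exists_torusDen_ne_zero (hl : 0 < l) (hl1 : l < 1) (hr : 0 < r) (hr1 : r < 1)
    (t : Circle × Circle) : ∃ s, torusDen l r c t s ≠ 0 := by
  have h1 := tendsto_cpow_ofReal_atTop hl hl1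
  have h2 := tendsto_cpow_ofReal_atTop hr hr1
  have : Tendsto (fun x : ℝ => torusDen l r c t x) atTop (𝓝 1) := by
    have h3 := h1.const_mul (t.1 : ℂ)
    have h4 := h2.const_mul (t.2 : ℂ)
    have h5 := (tendsto_const_nhds (x := (1 : ℂ))).sub h3
    have h6 := ((tendsto_const_nhds (x := (1 : ℂ))).sub (h3.const_mul 2)).sub (h4.const_mul (c : ℂ))
    simpa [torusDen, twistedDen] using h5.mul h6
  obtain ⟨x, hx⟩ := (this.eventually_ne one_ne_zero).exists
  exact ⟨x, hx⟩

/-- The point of the torus that belongs to the translation by `iτ`. -/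
def torusFlow (l r τ : ℝ) : Circle × Circle :=
  (Circle.exp (τ * Real.log l), Circle.exp (τ * Real.log r))

theorem cpow_add_mul_I {b : ℝ} (hb : 0 < b) (s : ℂ) (τ : ℝ) :
    (b : ℂ) ^ (s + τ * Complex.I) = (Circle.exp (τ * Real.log b) : ℂ) * (b : ℂ) ^ s := by
  have hb' : (b : ℂ) ≠ 0 := by exact_mod_cast hb.ne'
  rw [Complex.cpow_add _ _ hb', mul_comm, Circle.coe_exp, Complex.cpow_def_of_ne_zero hb',
    ← Complex.ofReal_log hb.le]
  congr 2
  push_cast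
  ring

/-- A translation by `iτ` multiplies `l^s` and `r^s` by unimodular numbers; so all vertical
translates sit in a family over a compact torus. -/
theorem twistedDen_add_mul_I (hl : 0 < l) (hr : 0 < r) (s : ℂ) (τ : ℝ) :
    twistedDen l r c 1 1 (s + τ * Complex.I) = torusDen l r c (torusFlow l r τ) s := by
  simp only [torusDen, torusFlow, twistedDen, cpow_add_mul_I hl, cpow_add_mul_I hr, one_mul]

theorem pt_add (σ y τ : ℝ) : pt σ (y + τ) = pt σ y + τ * Complex.I := by
  simp only [pt]; push_cast; ring

@[simp] theorem pt_re (σ τ : ℝ) : (pt σ τ).re = σ := by simp [pt]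
@[simp] theorem pt_im (σ τ : ℝ) : (pt σ τ).im = τ := by simp [pt]

theorem continuous_pt : Continuous fun p : ℝ × ℝ => pt p.1 p.2 := by
  unfold pt; fun_prop

/-- For each torus point some height in `[p, q]` carries no zero; compactness makes the resulting
bound independent of `τ`. -/
theorem exists_good_height (hl : 0 < l) (hl1 : l < 1) (hr : 0 < r) (hr1 : r < 1) (a b : ℝ)
    {p q : ℝ} (hpq : p < q) :
    ∃ c₀ > (0 : ℝ), ∀ τ : ℝ, ∃ y ∈ Icc p q, ∀ σ ∈ Icc a b,
      c₀ ≤ ‖twistedDen l r c 1 1 (pt σ (y + τ))‖ := by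
  obtain ⟨c₀, hc₀, h⟩ := exists_uniform_lower_bound (continuous_torusDen (c := c) hl hr)
    (S := fun y : Icc p q => (fun σ => pt σ y) '' Icc a b)
    (fun y => isCompact_Icc.image (continuous_pt.comp (Continuous.prodMk_left _))) (by
      intro t
      obtain ⟨s, hs⟩ := exists_torusDen_ne_zero (c := c) hl hl1 hr hr1 t
      obtain ⟨y, hy, hne⟩ := exists_mem_Icc_avoiding
        (countable_zeros (differentiable_torusDen hl hr t) hs) Complex.im hpq
      refine ⟨⟨y, hy⟩, ?_⟩
      rintro _ ⟨σ, _, rfl⟩ h0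
      exact hne _ h0 (pt_im _ _))
  refine ⟨c₀, hc₀, fun τ => ?_⟩
  obtain ⟨y, hy⟩ := h (torusFlow l r τ)
  refine ⟨y, y.2, fun σ hσ => ?_⟩
  rw [pt_add, twistedDen_add_mul_I hl hr]
  exact hy _ ⟨σ, hσ, rfl⟩

theorem exists_good_abscissa (hl : 0 < l) (hl1 : l < 1) (hr : 0 < r) (hr1 : r < 1)
    {a b : ℝ} (hab : a < b) (p q : ℝ) :
    ∃ c₀ > (0 : ℝ), ∀ τ : ℝ, ∃ σ ∈ Icc a b, ∀ y ∈ Icc p q,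
      c₀ ≤ ‖twistedDen l r c 1 1 (pt σ (y + τ))‖ := by
  obtain ⟨c₀, hc₀, h⟩ := exists_uniform_lower_bound (continuous_torusDen (c := c) hl hr)
    (S := fun σ : Icc a b => (fun y => pt σ y) '' Icc p q)
    (fun σ => isCompact_Icc.image (continuous_pt.comp (Continuous.prodMk_right _))) (by
      intro t
      obtain ⟨s, hs⟩ := exists_torusDen_ne_zero (c := c) hl hl1 hr hr1 t
      obtain ⟨σ, hσ, hne⟩ := exists_mem_Icc_avoiding
        (countable_zeros (differentiable_torusDen hl hr t) hs) Complex.re hab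
      refine ⟨⟨σ, hσ⟩, ?_⟩
      rintro _ ⟨y, _, rfl⟩ h0
      exact hne _ h0 (pt_re _ _))
  refine ⟨c₀, hc₀, fun τ => ?_⟩
  obtain ⟨σ, hσ⟩ := h (torusFlow l r τ)
  refine ⟨σ, σ.2, fun y hy => ?_⟩
  rw [pt_add, twistedDen_add_mul_I hl hr]
  exact hσ _ ⟨y, hy, rfl⟩

/-- Uniform continuity on the torus times `K` gives one modulus valid at every height. -/
theorem exists_uniform_modulus (hl : 0 < l) (hr : 0 < r) {K : Set ℂ} (hK : IsCompact K)
    {ε : ℝ} (hε : 0 < ε) :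
    ∃ h > (0 : ℝ), ∀ s ∈ K, ∀ s' ∈ K, dist s s' < h → ∀ τ : ℝ,
      dist (twistedDen l r c 1 1 (s + τ * Complex.I)) (twistedDen l r c 1 1 (s' + τ * Complex.I))
        < ε := by
  have hu := (isCompact_univ (X := Circle × Circle)).prod hK |>.uniformContinuousOn_of_continuous
    (continuous_torusDen (c := c) hl hr).continuousOn
  obtain ⟨h, hh, H⟩ := Metric.uniformContinuousOn_iff.1 hu ε hε
  refine ⟨h, hh, fun s hs s' hs' hd τ => ?_⟩
  rw [twistedDen_add_mul_I hl hr, twistedDen_add_mul_I hl hr]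
  refine H (torusFlow l r τ, s) ⟨mem_univ _, hs⟩ (torusFlow l r τ, s') ⟨mem_univ _, hs'⟩ ?_
  simpa [Prod.dist_eq, hh] using hd

/-- Maximum principle for `1 / h` on the disc. -/
theorem norm_ge_of_ne_zero {h : ℂ → ℂ} (hd : Differentiable ℂ h) {s₀ : ℂ} {ρ c₀ : ℝ} (hρ : 0 < ρ)
    (hc₀ : 0 < c₀) (hne : ∀ s ∈ Metric.closedBall s₀ ρ, h s ≠ 0)
    (hb : ∀ s ∈ Metric.sphere s₀ ρ, c₀ ≤ ‖h s‖) : c₀ ≤ ‖h s₀‖ := by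
  have hdiff : DiffContOnCl ℂ (fun s => (h s)⁻¹) (Metric.ball s₀ ρ) := by
    refine DifferentiableOn.diffContOnCl fun s hs => ?_
    rw [closure_ball _ hρ.ne'] at hs
    exact (hd s).inv (hne s hs) |>.differentiableWithinAt
  have := Complex.norm_le_of_forall_mem_frontier_norm_le Metric.isBounded_ball hdiff (C := c₀⁻¹)
    (fun z hz => by
      rw [frontier_ball _ hρ.ne'] at hz
      rw [norm_inv]
      exact inv_anti₀ hc₀ (hb z hz)) (z := s₀) (subset_closure (Metric.mem_ball_self hρ))
  rw [norm_inv] at this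
  have h0 : 0 < ‖h s₀‖ := norm_pos_iff.2 (hne s₀ (Metric.mem_closedBall_self hρ.le))
  exact (inv_le_inv₀ h0 hc₀).1 this

/-- Circles about a point of the line with radius in `[η/4, η/2]` enclose no zero. Compactness gives
a bound on such a circle uniform in the height, with the radius depending on the height, and the
maximum principle carries it to the centre. -/
theorem exists_lower_bound_on_line (hl : 0 < l) (hl1 : l < 1) (hr : 0 < r) (hr1 : r < 1)
    {α η : ℝ} (hη : 0 < η) (hzero : ∀ s, twistedDen l r c 1 1 s = 0 → η ≤ |s.re - α|) :
    ∃ c₀ > (0 : ℝ), ∀ τ : ℝ, c₀ ≤ ‖twistedDen l r c 1 1 (pt α τ)‖ := by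
  obtain ⟨c₀, hc₀, h⟩ := exists_uniform_lower_bound (continuous_torusDen (c := c) hl hr)
    (S := fun ρ : Icc (η / 4) (η / 2) => Metric.sphere (α : ℂ) ρ)
    (fun ρ => isCompact_sphere _ _) (by
      intro t
      obtain ⟨s, hs⟩ := exists_torusDen_ne_zero (c := c) hl hl1 hr hr1 t
      -- The distance hypothesis concerns only the translates of `E`, not every point of the torus;
      -- hence a radius must be chosen to avoid the zeros of a general twist.
      obtain ⟨ρ, hρ, hne⟩ := exists_mem_Icc_avoiding
        (countable_zeros (differentiable_torusDen hl hr t) hs) (fun s => dist s (α : ℂ))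
        (show η / 4 < η / 2 by linarith)
      exact ⟨⟨ρ, hρ⟩, fun s hs h0 => hne _ h0 hs⟩)
  refine ⟨c₀, hc₀, fun τ => ?_⟩
  obtain ⟨ρ, hρ⟩ := h (torusFlow l r τ)
  have hρ1 := ρ.2.1
  have hρ2 := ρ.2.2
  have key := norm_ge_of_ne_zero (h := torusDen l r c (torusFlow l r τ)) (s₀ := α) (ρ := ρ)
    (differentiable_torusDen hl hr _) (by linarith) hc₀ (fun s hs h0 => by
      rw [← twistedDen_add_mul_I hl hr] at h0
      have h1 := hzero _ h0
      have h2 : |s.re - α| ≤ ρ := by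
        have := (Complex.abs_re_le_norm (s - α)).trans (by simpa [dist_eq_norm] using hs)
        simpa using this
      simp at h1
      linarith) hρ
  rw [← twistedDen_add_mul_I hl hr] at key
  simpa [pt] using key

theorem twistedDen_one_eq_zero (hl : 0 < l) (hl1 : l < 1) {s : ℂ} (h : twistedDen l r c 1 1 s = 0) :
    s.re = 0 ∨ 1 - 2 * (l : ℂ) ^ s - c * (r : ℂ) ^ s = 0 := by
  rcases mul_eq_zero.1 h with h | h
  · left
    have h1 : (l : ℂ) ^ s = 1 := by linear_combination -h
    have h2 := congrArg norm h1
    rw [Complex.norm_cpow_eq_rpow_re_of_pos hl, norm_one] at h2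
    by_contra hne
    exact absurd h2 (by
      rcases lt_or_gt_of_ne hne with h3 | h3
      · exact (Real.one_lt_rpow_of_pos_of_lt_one_of_neg hl hl1 h3).ne'
      · exact (Real.rpow_lt_one hl.le hl1 h3).ne)
  · right
    simpa using h

/-- As `Re s → -∞` the power with the smaller base dominates the second factor; for equal bases the
two powers merge with coefficient `2 + c`, so they cannot cancel. The first factor is at least
`l^(Re s) - 1`. -/
theorem exists_one_le_norm_twistedDen (hl : 0 < l) (hl1 : l < 1) (hr : 0 < r) (hr1 : r < 1)
    (hc : 0 < c) : ∃ σ₀ : ℝ, ∀ s : ℂ, s.re ≤ σ₀ → 1 ≤ ‖twistedDen l r c 1 1 s‖ := by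
  have htop : ∀ b : ℝ, 0 < b → b < 1 → Tendsto (fun x : ℝ => b ^ x) atBot atTop := fun b hb hb1 =>
    tendsto_rpow_atBot_of_base_lt_one b hb hb1
  have key : ∀ᶠ x : ℝ in atBot, ∀ s : ℂ, s.re = x →
      1 ≤ ‖1 - 2 * (l : ℂ) ^ s - c * (r : ℂ) ^ s‖ := by
    rcases lt_trichotomy l r with hlr | hlr | hlr
    · have h1 : Tendsto (fun x : ℝ => (l / r) ^ x) atBot atTop :=
        htop _ (by positivity) ((div_lt_one hr).2 hlr)
      filter_upwards [h1.eventually_ge_atTop c, (htop l hl hl1).eventually_ge_atTop 2] with x hx hx2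
        s hs
      rw [Real.div_rpow hl.le hr.le, le_div_iff₀ (by positivity)] at hx
      have n1 : ‖2 * (l : ℂ) ^ s‖ = 2 * l ^ x := by
        simp [Complex.norm_cpow_eq_rpow_re_of_pos hl, hs]
      have n2 : ‖(c : ℂ) * (r : ℂ) ^ s‖ = c * r ^ x := by
        simp [Complex.norm_cpow_eq_rpow_re_of_pos hr, hs, abs_of_pos hc]
      have n3 := norm_sub_norm_le (2 * (l : ℂ) ^ s) (1 - c * (r : ℂ) ^ s)
      have n4 := norm_sub_le (1 : ℂ) (c * (r : ℂ) ^ s)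
      rw [norm_one] at n4
      rw [norm_sub_rev (2 * (l : ℂ) ^ s) (1 - c * (r : ℂ) ^ s),
        show 1 - (c : ℂ) * (r : ℂ) ^ s - 2 * (l : ℂ) ^ s
        = 1 - 2 * (l : ℂ) ^ s - c * (r : ℂ) ^ s by ring] at n3
      linarith
    · subst hlr
      filter_upwards [(htop l hl hl1).eventually_ge_atTop 1] with x hx s hs
      have n1 : ‖(2 + c : ℂ) * (l : ℂ) ^ s‖ = (2 + c) * l ^ x := by
        have : ‖(2 + c : ℂ)‖ = 2 + c := by
          have h2 : (2 + c : ℂ) = ((2 + c : ℝ) : ℂ) := by push_cast; ring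
          rw [h2, Complex.norm_real, Real.norm_of_nonneg (by linarith)]
        rw [norm_mul, this, Complex.norm_cpow_eq_rpow_re_of_pos hl, hs]
      have n3 := norm_sub_norm_le ((2 + c : ℂ) * (l : ℂ) ^ s) 1
      rw [norm_sub_rev, norm_one, show 1 - (2 + c : ℂ) * (l : ℂ) ^ s
        = 1 - 2 * (l : ℂ) ^ s - c * (l : ℂ) ^ s by ring] at n3
      nlinarith
    · have h1 : Tendsto (fun x : ℝ => (r / l) ^ x) atBot atTop :=
        htop _ (by positivity) ((div_lt_one hl).2 hlr)
      -- This makes `c * r^x ≥ 4 * l^x`; subtracting at most `1 + 2 * l^x` leaves `2 * l^x - 1 ≥ 1`.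
      filter_upwards [h1.eventually_ge_atTop (4 / c), (htop l hl hl1).eventually_ge_atTop 1]
        with x hx hx2 s hs
      rw [Real.div_rpow hr.le hl.le, div_le_div_iff₀ hc (by positivity)] at hx
      have n1 : ‖2 * (l : ℂ) ^ s‖ = 2 * l ^ x := by
        simp [Complex.norm_cpow_eq_rpow_re_of_pos hl, hs]
      have n2 : ‖(c : ℂ) * (r : ℂ) ^ s‖ = c * r ^ x := by
        simp [Complex.norm_cpow_eq_rpow_re_of_pos hr, hs, abs_of_pos hc]
      have n3 := norm_sub_norm_le (c * (r : ℂ) ^ s) (1 - 2 * (l : ℂ) ^ s)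
      have n4 := norm_sub_le (1 : ℂ) (2 * (l : ℂ) ^ s)
      rw [norm_one] at n4
      rw [norm_sub_rev ((c : ℂ) * (r : ℂ) ^ s) (1 - 2 * (l : ℂ) ^ s)] at n3
      linarith
  obtain ⟨σ₀, hσ₀⟩ := eventually_atBot.1 (key.and ((htop l hl hl1).eventually_ge_atTop 2))
  refine ⟨σ₀, fun s hs => ?_⟩
  obtain ⟨h1, h2⟩ := hσ₀ _ hs
  have h3 := h1 s rfl
  have n3 := norm_sub_norm_le ((l : ℂ) ^ s) 1
  rw [norm_sub_rev, norm_one, Complex.norm_cpow_eq_rpow_re_of_pos hl] at n3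
  have h4 : 1 ≤ ‖1 - (l : ℂ) ^ s‖ := by linarith
  simp only [twistedDen, one_mul, norm_mul]
  nlinarith

end

/-! ### Languidity of quotients of an entire function by the exponential polynomial -/

/-- `f`, holomorphic in `Re s > D`, is the quotient of an entire function of exponential growth in
`Re s` by the exponential polynomial `twistedDen l r c 1 1`. -/
structure IsDenQuotient (f : ℂ → ℂ) (D l r c : ℝ) : Prop where
  l_pos : 0 < l
  l_lt_one : l < 1
  r_pos : 0 < r
  r_lt_one : r < 1
  c_pos : 0 < c
  differentiableOn : DifferentiableOn ℂ f {s | D < s.re}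
  numerator : ∃ G : ℂ → ℂ, Differentiable ℂ G ∧
    (∃ A > (0 : ℝ), ∃ B ≥ (1 : ℝ), ∀ s : ℂ, ‖G s‖ ≤ A * B ^ |s.re|) ∧
    ∀ s : ℂ, D < s.re → f s * twistedDen l r c 1 1 s = G s

theorem IsDenQuotient.exists_continuation {f : ℂ → ℂ} {D l r c : ℝ} (h : IsDenQuotient f D l r c) :
    ∃ g : ℂ → ℂ, MeromorphicOn g univ ∧ (∀ s, D < s.re → g s = f s) ∧
      (∀ s, twistedDen l r c 1 1 s ≠ 0 → AnalyticAt ℂ g s) ∧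
      ∃ A > (0 : ℝ), ∃ B ≥ (1 : ℝ), ∀ s, ‖g s‖ * ‖twistedDen l r c 1 1 s‖ ≤ A * B ^ |s.re| := by
  classical
  obtain ⟨G, hG, ⟨A, hA, B, hB, hAB⟩, hfG⟩ := h.numerator
  set E := twistedDen l r c 1 1
  have hEd : Differentiable ℂ E := by
    simpa [torusDen, funext_iff, Differentiable] using!
      differentiable_torusDen (c := c) h.l_pos h.r_pos (1, 1)
  obtain ⟨s₁, hs₁⟩ : ∃ s, E s ≠ 0 := by
    simpa [torusDen] using
      exists_torusDen_ne_zero (c := c) h.l_pos h.l_lt_one h.r_pos h.r_lt_one (1, 1)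
  -- The two branches agree off the zeros of the denominator. The case split keeps `g = f` at zeros
  -- with `Re s > D` as well, where the quotient would take the value `0` of a division by zero.
  set g : ℂ → ℂ := fun s => if D < s.re then f s else G s / E s
  have hgE : ∀ s, E s ≠ 0 → g s = G s / E s := by
    intro s hs
    by_cases hD : D < s.re
    · simp only [g, if_pos hD, ← hfG s hD]
      field_simp
    · simp only [g, if_neg hD]
  have hev : ∀ s, ∀ᶠ z in 𝓝[≠] s, E z ≠ 0 := by
    intro s
    rcases (hEd.analyticAt s).eventually_eq_zero_or_eventually_ne_zero with h0 | h0
    · have han : AnalyticOnNhd ℂ E univ := fun s _ => hEd.analyticAt s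
      exact absurd (han.eqOn_zero_of_preconnected_of_eventuallyEq_zero isPreconnected_univ
        (mem_univ s) h0 (mem_univ s₁)) hs₁
    · exact h0
  refine ⟨g, fun s _ => ?_, fun s hs => if_pos hs, fun s hs => ?_, A, hA, B, hB, fun s => ?_⟩
  · refine ((hG.analyticAt s).meromorphicAt.div (hEd.analyticAt s).meromorphicAt).congr ?_
    filter_upwards [hev s] with z hz using (hgE z hz).symm
  · refine ((hG.analyticAt s).div (hEd.analyticAt s) hs).congr ?_
    filter_upwards [hEd.continuous.continuousAt.eventually_ne hs] with z hz using (hgE z hz).symm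
  · by_cases hs : E s = 0
    · rw [hs, norm_zero, mul_zero]; positivity
    · rw [hgE s hs, ← norm_mul, div_mul_cancel₀ _ hs]
      exact hAB s

theorem rpow_abs_le {B M x : ℝ} (hB : 1 ≤ B) (hx : |x| ≤ M) : B ^ |x| ≤ B ^ M :=
  Real.rpow_le_rpow_of_exponent_le hB hx

theorem IsDenQuotient.satisfiesL1 {f : ℂ → ℂ} {D l r c : ℝ} (h : IsDenQuotient f D l r c)
    {κ : ℝ} (hκ : 0 ≤ κ) {S : ℝ → ℝ} (hS : ∃ L : NNReal, LipschitzWith L S) {a : ℝ}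
    (ha : ∀ τ, a ≤ S τ) : SatisfiesL1 f D κ S := by
  obtain ⟨g, hgm, hgf, hga, A, hA, B, hB, hgb⟩ := h.exists_continuation
  refine ⟨hS, g, ⟨h.differentiableOn, univ, isOpen_univ, subset_univ _, hgm, fun s _ => hgf s⟩, ?_⟩
  set β := D + 1
  obtain ⟨c₀, hc₀, H⟩ := exists_good_height (c := c) h.l_pos h.l_lt_one h.r_pos h.r_lt_one a β
    (show (1 / 4 : ℝ) < 1 / 2 by norm_num)
  choose y hy hyE using H
  set M := max |a| |β|
  -- The heights are `m + y m` with `y m ∈ [1/4, 1/2]`, so their signs are right for `m ≥ 1` and for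
  -- `-m`, and they tend to infinity in both directions.
  refine ⟨A * B ^ M / c₀, by positivity, β, by simp [β], fun m => y m + m, ?_, ?_, ?_, ?_⟩
  · refine tendsto_atTop_mono (fun m => ?_) (tendsto_intCast_atTop_atTop (R := ℝ))
    have := (hy m).1
    linarith
  · refine tendsto_atBot_mono (fun m => ?_)
      (tendsto_atBot_add_const_left _ 1 ((tendsto_intCast_atBot_iff (R := ℝ)).2 tendsto_id))
    have := (hy m).2
    simp only [id]
    linarith
  · intro m hm
    have hm' : (1 : ℝ) ≤ m := by exact_mod_cast hm
    have h1 := (hy (-m : ℤ)).2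
    have h2 := (hy m).1
    push_cast at h1 ⊢
    constructor <;> linarith
  · intro m σ hσ
    have hσa : a ≤ σ := (ha _).trans hσ.1
    have hE := hyE m σ ⟨hσa, hσ.2⟩
    have hE0 : twistedDen l r c 1 1 (pt σ (y m + m)) ≠ 0 := norm_pos_iff.1 (hc₀.trans_le hE)
    refine ⟨hga _ hE0, ?_⟩
    have h1 := hgb (pt σ (y m + m))
    rw [pt_re] at h1
    have h2 : |σ| ≤ M := abs_le_max_abs_abs hσa hσ.2
    have h3 := rpow_abs_le hB h2
    have h4 : ‖g (pt σ (y m + m))‖ ≤ A * B ^ M / c₀ := by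
      rw [le_div_iff₀ hc₀]
      calc _ ≤ ‖g (pt σ (y m + m))‖ * ‖twistedDen l r c 1 1 (pt σ (y m + m))‖ := by gcongr
        _ ≤ A * B ^ |σ| := h1
        _ ≤ _ := by gcongr
    refine h4.trans (le_mul_of_one_le_right (by positivity) ?_)
    exact Real.one_le_rpow (by linarith [abs_nonneg (y m + m)]) hκ

theorem IsDenQuotient.satisfiesL2 {f : ℂ → ℂ} {D l r c : ℝ} (h : IsDenQuotient f D l r c)
    {S : ℝ → ℝ} (hS : ∃ L : NNReal, LipschitzWith L S) {M : ℝ} (hM : ∀ τ, |S τ| ≤ M)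
    {c₀ : ℝ} (hc₀ : 0 < c₀) (hE : ∀ τ, c₀ ≤ ‖twistedDen l r c 1 1 (pt (S τ) τ)‖) :
    SatisfiesL2 f D 0 S := by
  obtain ⟨g, hgm, hgf, hga, A, hA, B, hB, hgb⟩ := h.exists_continuation
  refine ⟨hS, g, ⟨h.differentiableOn, univ, isOpen_univ, subset_univ _, hgm, fun s _ => hgf s⟩,
    A * B ^ M / c₀, by positivity, fun τ _ => ⟨hga _ (norm_pos_iff.1 (hc₀.trans_le (hE τ))), ?_⟩⟩
  rw [Real.rpow_zero, mul_one, le_div_iff₀ hc₀]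
  have h1 := hgb (pt (S τ) τ)
  rw [pt_re] at h1
  have h2 := rpow_abs_le hB (hM τ)
  calc _ ≤ ‖g (pt (S τ) τ)‖ * ‖twistedDen l r c 1 1 (pt (S τ) τ)‖ := by gcongr; exact hE τ
    _ ≤ A * B ^ |S τ| := h1
    _ ≤ _ := by gcongr

theorem IsDenQuotient.languid_line {f : ℂ → ℂ} {D l r c : ℝ} (h : IsDenQuotient f D l r c)
    {α : ℝ} (hα : 0 < α) {η : ℝ} (hη : 0 < η)
    (hzero : ∀ s : ℂ, 1 - 2 * (l : ℂ) ^ s - c * (r : ℂ) ^ s = 0 → η ≤ |s.re - α|) :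
    Languid f D 0 (fun _ => α) := by
  have hS : ∃ L : NNReal, LipschitzWith L (fun _ : ℝ => α) := ⟨0, LipschitzWith.const α⟩
  -- The auxiliary factor `1 - l^s` vanishes only on `Re s = 0`, at distance `α` from the line;
  -- hence `min η α`.
  obtain ⟨c₀, hc₀, hE⟩ := exists_lower_bound_on_line (c := c) h.l_pos h.l_lt_one h.r_pos h.r_lt_one
    (α := α) (η := min η α) (lt_min hη hα) (fun s hs => by
      rcases twistedDen_one_eq_zero h.l_pos h.l_lt_one hs with h0 | h0
      · rw [h0, zero_sub, abs_neg, abs_of_pos hα]; exact min_le_right _ _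
      · exact (min_le_left _ _).trans (hzero s h0))
  exact ⟨h.satisfiesL1 le_rfl hS (fun _ => le_rfl), h.satisfiesL2 hS (fun _ => le_rfl) hc₀ hE⟩

/-- To the left of `σ₀` the denominator has modulus at least `1`. The lines `Re s = σ₀ - m` then
carry no pole and inherit the bound on the numerator with constants independent of `m`. -/
theorem IsDenQuotient.stronglyLanguid {f : ℂ → ℂ} {D l r c : ℝ} (h : IsDenQuotient f D l r c)
    {κ : ℝ} (hκ : 0 ≤ κ) : StronglyLanguid f D κ := by
  obtain ⟨g, hgm, hgf, hga, A, hA, B, hB, hgb⟩ := h.exists_continuation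
  obtain ⟨σ₀, hσ₀⟩ := exists_one_le_norm_twistedDen h.l_pos h.l_lt_one h.r_pos h.r_lt_one h.c_pos
  have hlip : ∀ m : ℕ, LipschitzWith 0 (fun _ : ℝ => σ₀ - m) := fun m => LipschitzWith.const _
  refine ⟨h.differentiableOn, g, hgm, hgf, fun m _ => σ₀ - m, ⟨0, hlip⟩,
    fun m => ⟨σ₀ - m, by rintro _ ⟨τ, rfl⟩; exact le_rfl⟩, ?_,
    fun m => h.satisfiesL1 hκ ⟨0, hlip m⟩ (fun _ => le_rfl), A, hA, B, by linarith, fun m τ => ?_⟩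
  · simp only [ciSup_const]
    exact tendsto_atBot_add_const_left _ σ₀ (tendsto_neg_atTop_atBot.comp tendsto_natCast_atTop_atTop)
  · have hE := hσ₀ (pt (σ₀ - m) τ) (by simp)
    refine ⟨hga _ (norm_pos_iff.1 (by linarith)), ?_⟩
    have h1 := hgb (pt (σ₀ - m) τ)
    rw [pt_re] at h1
    have h2 : 1 ≤ (|τ| + 1) ^ κ := Real.one_le_rpow (by linarith [abs_nonneg τ]) hκ
    calc _ ≤ ‖g (pt (σ₀ - m) τ)‖ * ‖twistedDen l r c 1 1 (pt (σ₀ - m) τ)‖ :=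
          le_mul_of_one_le_right (norm_nonneg _) hE
      _ ≤ A * B ^ |σ₀ - m| := h1
      _ ≤ _ := le_mul_of_one_le_right (by positivity) h2

/-! ### Screens that avoid the zeros -/

/-- The function that rises linearly from `0` to `1` between `y - h` and `y + h`. -/
def ramp (h y τ : ℝ) : ℝ := max 0 (min 1 ((τ - y + h) / (2 * h)))

theorem ramp_mem (h y τ : ℝ) : ramp h y τ ∈ Icc (0 : ℝ) 1 :=
  ⟨le_max_left _ _, max_le zero_le_one (min_le_left _ _)⟩

theorem ramp_eq_zero {h y τ : ℝ} (hh : 0 < h) (hτ : τ ≤ y - h) : ramp h y τ = 0 := by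
  have : (τ - y + h) / (2 * h) ≤ 0 := div_nonpos_of_nonpos_of_nonneg (by linarith) (by linarith)
  exact max_eq_left ((min_le_right _ _).trans this)

theorem ramp_eq_one {h y τ : ℝ} (hh : 0 < h) (hτ : y + h ≤ τ) : ramp h y τ = 1 := by
  have : 1 ≤ (τ - y + h) / (2 * h) := by rw [le_div_iff₀ (by linarith)]; linarith
  rw [ramp, min_eq_left this, max_eq_right zero_le_one]

theorem abs_ramp_sub_le {h : ℝ} (hh : 0 < h) (y τ τ' : ℝ) :
    |ramp h y τ - ramp h y τ'| ≤ |τ - τ'| / (2 * h) := by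
  have h1 := abs_max_sub_max_le_abs (min 1 ((τ - y + h) / (2 * h)))
    (min 1 ((τ' - y + h) / (2 * h))) 0
  have h2 := abs_min_sub_min_le_max 1 ((τ - y + h) / (2 * h)) 1 ((τ' - y + h) / (2 * h))
  rw [sub_self, abs_zero, max_eq_right (abs_nonneg _)] at h2
  rw [max_comm _ 0, max_comm _ 0] at h1
  refine h1.trans (h2.trans (le_of_eq ?_))
  rw [← sub_div, abs_div, abs_of_pos (show 0 < 2 * h by linarith)]
  congr 2
  ring

/-- The screen that passes from the abscissa `σ k` to `σ (k + 1)` at the height `y k`. -/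
def stepScreen (h : ℝ) (y σ : ℤ → ℝ) (τ : ℝ) : ℝ :=
  σ ⌊τ⌋ + (σ (⌊τ⌋ + 1) - σ ⌊τ⌋) * ramp h (y ⌊τ⌋) τ

theorem stepScreen_mem {h a b : ℝ} {y σ : ℤ → ℝ} (hσ : ∀ k, σ k ∈ Icc a b) (τ : ℝ) :
    stepScreen h y σ τ ∈ Icc a b := by
  have h1 := ramp_mem h (y ⌊τ⌋) τ
  have h2 := hσ ⌊τ⌋
  have h3 := hσ (⌊τ⌋ + 1)
  have : stepScreen h y σ τ = (1 - ramp h (y ⌊τ⌋) τ) * σ ⌊τ⌋ + ramp h (y ⌊τ⌋) τ * σ (⌊τ⌋ + 1) := by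
    unfold stepScreen; ring
  rw [this]
  exact convex_Icc a b h2 h3 (by linarith [h1.2]) h1.1 (by ring)

/-- The closed cell is allowed: at its right end the floor jumps, but the old ramp is already `1`
and the new one still `0`, so both formulas give `σ (k + 1)`. -/
theorem stepScreen_eq {h : ℝ} {y σ : ℤ → ℝ} (hh : 0 < h) (hy : ∀ k : ℤ, y k + h ≤ k + 1)
    (hy' : ∀ k : ℤ, k ≤ y k - h) (k : ℤ) {τ : ℝ} (hτ : τ ∈ Icc (k : ℝ) (k + 1)) :
    stepScreen h y σ τ = σ k + (σ (k + 1) - σ k) * ramp h (y k) τ := by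
  rcases hτ.2.lt_or_eq with h1 | h1
  · have : ⌊τ⌋ = k := Int.floor_eq_iff.2 ⟨hτ.1, h1⟩
    rw [stepScreen, this]
  · have : ⌊τ⌋ = k + 1 := Int.floor_eq_iff.2 ⟨by push_cast; linarith, by push_cast; linarith⟩
    rw [stepScreen, this, ramp_eq_one (y := y k) hh (by linarith [hy k]),
      ramp_eq_zero (y := y (k + 1)) hh (by have := hy' (k + 1); push_cast at this; linarith)]
    ring

/-- Inside a cell the slope is at most `(b - a) / (2h)`. Points of neighbouring cells at distance
below `1` are joined through the integer between them; at distance at least `1` the total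
oscillation `b - a` is enough, since `2h ≤ 1`. -/
theorem lipschitzWith_stepScreen {h a b : ℝ} {y σ : ℤ → ℝ} (hh : 0 < h) (hh1 : h ≤ 1 / 4)
    (hσ : ∀ k, σ k ∈ Icc a b) (hy : ∀ k : ℤ, y k + h ≤ k + 1) (hy' : ∀ k : ℤ, k ≤ y k - h) :
    ∃ L : NNReal, LipschitzWith L (stepScreen h y σ) := by
  have hab : a ≤ b := (hσ 0).1.trans (hσ 0).2
  set L := (b - a) / (2 * h)
  have hL : 0 ≤ L := div_nonneg (by linarith) (by linarith)
  have hLb : b - a ≤ L := by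
    rw [le_div_iff₀ (by linarith)]
    nlinarith
  have cell : ∀ (k : ℤ) (x x' : ℝ), x ∈ Icc (k : ℝ) (k + 1) → x' ∈ Icc (k : ℝ) (k + 1) →
      |stepScreen h y σ x - stepScreen h y σ x'| ≤ L * |x - x'| := by
    intro k x x' hx hx'
    rw [stepScreen_eq hh hy hy' k hx, stepScreen_eq hh hy hy' k hx', add_sub_add_left_eq_sub,
      ← mul_sub, abs_mul]
    have h1 : |σ (k + 1) - σ k| ≤ b - a := by
      have := hσ k; have := hσ (k + 1)
      simp only [mem_Icc] at *
      rw [abs_le]; constructor <;> linarith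
    calc _ ≤ (b - a) * (|x - x'| / (2 * h)) :=
          mul_le_mul h1 (abs_ramp_sub_le hh _ _ _) (abs_nonneg _) (by linarith)
      _ = L * |x - x'| := by simp only [L]; ring
  have main : ∀ x x' : ℝ, x ≤ x' → |stepScreen h y σ x - stepScreen h y σ x'| ≤ L * (x' - x) := by
    intro x x' hxx
    rcases le_or_gt (x + 1) x' with h1 | h1
    · have h2 := stepScreen_mem (h := h) (y := y) hσ x
      have h3 := stepScreen_mem (h := h) (y := y) hσ x'
      have : |stepScreen h y σ x - stepScreen h y σ x'| ≤ b - a := by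
        simp only [mem_Icc] at *
        rw [abs_le]; constructor <;> linarith
      nlinarith
    · have hx := Int.floor_le x
      have hx1 := Int.lt_floor_add_one x
      have hxc : x ∈ Icc (⌊x⌋ : ℝ) (⌊x⌋ + 1) := ⟨hx, hx1.le⟩
      rcases le_or_gt x' (⌊x⌋ + 1) with h2 | h2
      · have := cell ⌊x⌋ x x' hxc ⟨by linarith, h2⟩
        rwa [abs_sub_comm x x', abs_of_nonneg (show 0 ≤ x' - x by linarith)] at this
      · have c1 := cell ⌊x⌋ x (⌊x⌋ + 1) hxc ⟨by linarith, le_rfl⟩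
        have c2 := cell (⌊x⌋ + 1) (⌊x⌋ + 1) x' ⟨by push_cast; linarith, by push_cast; linarith⟩
          ⟨by push_cast; linarith, by push_cast; linarith⟩
        rw [abs_sub_comm x, abs_of_nonneg (show (0 : ℝ) ≤ ⌊x⌋ + 1 - x by linarith)] at c1
        rw [abs_sub_comm _ x', abs_of_nonneg (show (0 : ℝ) ≤ x' - (⌊x⌋ + 1) by linarith)] at c2
        have := abs_sub_le (stepScreen h y σ x) (stepScreen h y σ (⌊x⌋ + 1)) (stepScreen h y σ x')
        nlinarith
  refine ⟨L.toNNReal, LipschitzWith.of_dist_le_mul fun x x' => ?_⟩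
  rw [Real.coe_toNNReal _ hL, Real.dist_eq, Real.dist_eq]
  rcases le_total x x' with hx | hx
  · have := main x x' hx
    rwa [abs_sub_comm x x', abs_of_nonneg (show 0 ≤ x' - x by linarith)]
  · have := main x' x hx
    rwa [abs_of_nonneg (show 0 ≤ x - x' by linarith), abs_sub_comm]

/-- The screen runs along good abscissae and changes abscissa only in a thin band around a good
height. At that height the denominator is at least `c₁` across the whole strip, and the uniform
modulus keeps it above `c₁ / 2` in the band. -/
theorem IsDenQuotient.exists_languid_screen {f : ℂ → ℂ} {D l r c : ℝ} (h : IsDenQuotient f D l r c)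
    {a b : ℝ} (hab : a < b) :
    ∃ S : ℝ → ℝ, (∀ τ, S τ ∈ Icc a b) ∧ Languid f D 0 S := by
  -- Heights in `[1/4, 3/4]` leave room for a band of half-width at most `1/4` inside the cell.
  -- Abscissae are good on `[k - 1, k + 1]`, because `σ k` serves both the top of cell `k - 1` and
  -- the bottom of cell `k`.
  obtain ⟨c₁, hc₁, H₁⟩ := exists_good_height (c := c) h.l_pos h.l_lt_one h.r_pos h.r_lt_one a b
    (show (1 / 4 : ℝ) < 3 / 4 by norm_num)
  obtain ⟨c₂, hc₂, H₂⟩ := exists_good_abscissa (c := c) h.l_pos h.l_lt_one h.r_pos h.r_lt_one hab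
    (-1) 1
  choose y₀ hy₀ hyE using H₁
  choose σ₀ hσ₀ hσE using H₂
  have hK : IsCompact ((fun p : ℝ × ℝ => pt p.1 p.2) '' (Icc a b ×ˢ Icc (0 : ℝ) 1)) :=
    (isCompact_Icc.prod isCompact_Icc).image continuous_pt
  obtain ⟨h₀, hh₀, hmod⟩ := exists_uniform_modulus (c := c) h.l_pos h.r_pos hK
    (show 0 < c₁ / 2 by linarith)
  set η := min (h₀ / 2) (1 / 4)
  have hη : 0 < η := by positivity
  have hη1 : η ≤ 1 / 4 := min_le_right _ _
  have hη2 : η < h₀ := (min_le_left _ _).trans_lt (by linarith)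
  set y : ℤ → ℝ := fun k => y₀ k + k
  set σ : ℤ → ℝ := fun k => σ₀ k
  have hy : ∀ k : ℤ, y k + η ≤ k + 1 := fun k => by
    have := (hy₀ k).2; simp only [y]; linarith
  have hy' : ∀ k : ℤ, (k : ℝ) ≤ y k - η := fun k => by
    have := (hy₀ k).1; simp only [y]; linarith
  have hσ : ∀ k, σ k ∈ Icc a b := fun k => hσ₀ k
  have hLip := lipschitzWith_stepScreen hη hη1 hσ hy hy'
  have hmem := stepScreen_mem (h := η) (y := y) hσ
  set S := stepScreen η y σ
  have hE : ∀ τ, min (c₁ / 2) c₂ ≤ ‖twistedDen l r c 1 1 (pt (S τ) τ)‖ := by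
    intro τ
    set k := ⌊τ⌋
    have hk1 : (k : ℝ) ≤ τ := Int.floor_le τ
    have hk2 : τ < k + 1 := Int.lt_floor_add_one τ
    have hS : S τ = σ k + (σ (k + 1) - σ k) * ramp η (y k) τ := rfl
    rcases le_or_gt τ (y k - η) with h1 | h1
    · rw [hS, ramp_eq_zero hη h1, mul_zero, add_zero]
      refine (min_le_right _ _).trans ?_
      have := hσE k (τ - k) ⟨by linarith, by linarith⟩
      rwa [sub_add_cancel] at this
    rcases le_or_gt (y k + η) τ with h2 | h2
    · rw [hS, ramp_eq_one hη h2, mul_one, add_sub_cancel]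
      refine (min_le_right _ _).trans ?_
      have := hσE (k + 1 : ℤ) (τ - (k + 1 : ℤ)) ⟨by push_cast; linarith, by push_cast; linarith⟩
      rwa [sub_add_cancel] at this
    · refine (min_le_left _ _).trans ?_
      have e1 := hyE k (S τ) (hmem τ)
      have e2 := hmod (pt (S τ) (τ - k)) ⟨(S τ, τ - k), ⟨hmem τ, by
          constructor <;> simp only <;> linarith⟩, rfl⟩
        (pt (S τ) (y₀ k)) ⟨(S τ, y₀ k), ⟨hmem τ, by
          have := hy₀ k
          constructor <;> simp only <;> linarith [this.1, this.2]⟩, rfl⟩ (by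
          have : dist (pt (S τ) (τ - k)) (pt (S τ) (y₀ k)) = |τ - y k| := by
            rw [dist_eq_norm, show pt (S τ) (τ - k) - pt (S τ) (y₀ k)
              = ((τ - y k : ℝ) : ℂ) * Complex.I by simp only [pt, y]; push_cast; ring]
            rw [norm_mul, Complex.norm_I, mul_one, Complex.norm_real, Real.norm_eq_abs]
          rw [this, abs_lt]
          constructor <;> linarith) k
      rw [← pt_add, ← pt_add, sub_add_cancel, dist_eq_norm, norm_sub_rev] at e2
      have e3 := norm_sub_norm_le (twistedDen l r c 1 1 (pt (S τ) (y₀ k + k)))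
        (twistedDen l r c 1 1 (pt (S τ) τ))
      linarith
  exact ⟨S, hmem, h.satisfiesL1 le_rfl hLip (fun τ => (hmem τ).1),
    h.satisfiesL2 hLip (fun τ => abs_le_max_abs_abs (hmem τ).1 (hmem τ).2)
      (lt_min (by linarith) hc₂) hE⟩

/-! ### Logarithmic variation of plane curves -/

/-- The values lie in the discrete set `2πiℤ`, so continuity on a preconnected set forces constancy.
-/
theorem eq_of_exp_eq_one {X : Type*} [TopologicalSpace X] {S : Set X} (hS : IsPreconnected S)
    {d : X → ℂ} (hd : ContinuousOn d S) (h : ∀ x ∈ S, Complex.exp (d x) = 1) {x y : X} (hx : x ∈ S)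
    (hy : y ∈ S) : d x = d y := by
  have hT : DiscreteTopology (range ((↑) : ℤ → ℝ)) :=
    (Int.isClosedEmbedding_coe_real.isEmbedding.toHomeomorph.symm.isEmbedding).discreteTopology
  have hne : (2 * Real.pi * Complex.I : ℂ) ≠ 0 := Complex.two_pi_I_ne_zero
  have hval : ∀ x ∈ S, ∃ n : ℤ, d x = n * (2 * Real.pi * Complex.I) := fun x hx =>
    Complex.exp_eq_one_iff.1 (h x hx)
  have hre : ∀ x ∈ S, ∀ n : ℤ, d x = n * (2 * Real.pi * Complex.I) →
      (d x / (2 * Real.pi * Complex.I)).re = n := by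
    intro x _ n hn
    rw [hn, mul_div_cancel_right₀ _ hne]
    simp
  have hc : ContinuousOn (fun x => (d x / (2 * Real.pi * Complex.I)).re) S :=
    Complex.continuous_re.comp_continuousOn (hd.div_const _)
  have hmaps : MapsTo (fun x => (d x / (2 * Real.pi * Complex.I)).re) S
      (range ((↑) : ℤ → ℝ)) := fun x hx => by
    obtain ⟨n, hn⟩ := hval x hx
    exact ⟨n, (hre x hx n hn).symm⟩
  have := hS.constant_of_mapsTo ⟨hT⟩ hc hmaps hx hy
  obtain ⟨n, hn⟩ := hval x hx
  obtain ⟨m, hm⟩ := hval y hy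
  simp only [hre x hx n hn, hre y hy m hm] at this
  rw [hn, hm, show n = m by exact_mod_cast this]

/-- `θ` is a continuous logarithm of `f` on `[a, b]`. -/
def IsLogOn (f θ : ℝ → ℂ) (a b : ℝ) : Prop :=
  ContinuousOn θ (Icc a b) ∧ ∀ t ∈ Icc a b, Complex.exp (θ t) = f t

/-- Lifting through the covering `exp`. -/
theorem exists_global_log {X : Type*} [TopologicalSpace X] [LocallyPathConnectedSpace X]
    [SimplyConnectedSpace X] {f : X → ℂ} (hf : Continuous f) (h0 : ∀ x, f x ≠ 0) :
    ∃ θ : X → ℂ, Continuous θ ∧ ∀ x, Complex.exp (θ x) = f x := by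
  obtain ⟨x₀⟩ : Nonempty X := inferInstance
  obtain ⟨F, ⟨_, hF⟩, _⟩ := Complex.isCoveringMapOn_exp.existsUnique_continuousMap_lifts
    ⟨f, hf⟩ (Complex.exp_log (h0 x₀)) (fun x => h0 x)
  exact ⟨F, F.continuous, fun x => congrFun hF x⟩

theorem exists_isLogOn {f : ℝ → ℂ} {a b : ℝ} (hab : a ≤ b) (hf : ContinuousOn f (Icc a b))
    (h0 : ∀ t ∈ Icc a b, f t ≠ 0) : ∃ θ, IsLogOn f θ a b := by
  obtain ⟨θ, hθ, he⟩ := exists_global_log (f := IccExtend hab ((Icc a b).domRestrict f))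
    (continuous_IccExtend_iff.2 (continuousOn_iff_continuous_domRestrict.1 hf))
    (fun x => h0 _ (projIcc a b hab x).2)
  refine ⟨θ, hθ.continuousOn, fun t ht => ?_⟩
  rw [he, IccExtend_of_mem _ _ ht]
  rfl

open Classical in
/-- The variation over `[a, b]` of a continuous logarithm of `f`. -/
def logVar (f : ℝ → ℂ) (a b : ℝ) : ℂ :=
  if h : ∃ θ, IsLogOn f θ a b then h.choose b - h.choose a else 0

theorem IsLogOn.logVar_eq {f θ : ℝ → ℂ} {a b : ℝ} (h : IsLogOn f θ a b) (hab : a ≤ b) :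
    logVar f a b = θ b - θ a := by
  have hex : ∃ θ, IsLogOn f θ a b := ⟨θ, h⟩
  rw [logVar, dif_pos hex]
  have h' := hex.choose_spec
  set θ' := hex.choose
  have := eq_of_exp_eq_one isPreconnected_Icc (h.1.sub h'.1) (fun t ht => by
    simp only [Pi.sub_apply]
    rw [Complex.exp_sub, h.2 t ht, h'.2 t ht, div_self]
    rw [← h.2 t ht]; exact Complex.exp_ne_zero _) (left_mem_Icc.2 hab) (right_mem_Icc.2 hab)
  simp only [Pi.sub_apply] at this
  linear_combination this

theorem IsLogOn.mono {f θ : ℝ → ℂ} {a b a' b' : ℝ} (h : IsLogOn f θ a b) (ha : a ≤ a')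
    (hb : b' ≤ b) : IsLogOn f θ a' b' :=
  ⟨h.1.mono (Icc_subset_Icc ha hb), fun t ht => h.2 t (Icc_subset_Icc ha hb ht)⟩

theorem logVar_congr {f g : ℝ → ℂ} {a b : ℝ} (h : EqOn f g (Icc a b)) :
    logVar f a b = logVar g a b := by
  have : ∀ θ, IsLogOn f θ a b ↔ IsLogOn g θ a b := fun θ =>
    and_congr Iff.rfl (forall₂_congr fun t ht => by rw [h ht])
  have h2 : (fun θ => IsLogOn f θ a b) = fun θ => IsLogOn g θ a b := funext fun θ => propext (this θ)
  classical
  exact congrArg (fun P : (ℝ → ℂ) → Prop =>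
    if h : ∃ θ, P θ then h.choose b - h.choose a else (0 : ℂ)) h2

theorem exp_logVar {f : ℝ → ℂ} {a b : ℝ} (hab : a ≤ b) (hf : ContinuousOn f (Icc a b))
    (h0 : ∀ t ∈ Icc a b, f t ≠ 0) : Complex.exp (logVar f a b) = f b / f a := by
  obtain ⟨θ, hθ⟩ := exists_isLogOn hab hf h0
  rw [hθ.logVar_eq hab, Complex.exp_sub, hθ.2 _ (left_mem_Icc.2 hab), hθ.2 _ (right_mem_Icc.2 hab)]

theorem logVar_const_mul {f : ℝ → ℂ} {a b : ℝ} (hab : a ≤ b) (hf : ContinuousOn f (Icc a b))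
    (h0 : ∀ t ∈ Icc a b, f t ≠ 0) {c : ℂ} (hc : c ≠ 0) :
    logVar (fun t => c * f t) a b = logVar f a b := by
  obtain ⟨θ, hθ⟩ := exists_isLogOn hab hf h0
  have h' : IsLogOn (fun t => c * f t) (fun t => Complex.log c + θ t) a b :=
    ⟨continuousOn_const.add hθ.1, fun t ht => by
      rw [Complex.exp_add, Complex.exp_log hc, hθ.2 t ht]⟩
  rw [hθ.logVar_eq hab, h'.logVar_eq hab]
  ring

theorem logVar_comp_affine {f : ℝ → ℂ} {a b m k : ℝ} (hm : 0 < m) (hab : a ≤ b)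
    (hf : ContinuousOn f (Icc (m * a + k) (m * b + k)))
    (h0 : ∀ t ∈ Icc (m * a + k) (m * b + k), f t ≠ 0) :
    logVar (fun t => f (m * t + k)) a b = logVar f (m * a + k) (m * b + k) := by
  have hab' : m * a + k ≤ m * b + k := by nlinarith
  obtain ⟨θ, hθ⟩ := exists_isLogOn hab' hf h0
  have hmaps : MapsTo (fun t => m * t + k) (Icc a b) (Icc (m * a + k) (m * b + k)) := fun t ht =>
    ⟨by nlinarith [ht.1], by nlinarith [ht.2]⟩
  have h' : IsLogOn (fun t => f (m * t + k)) (fun t => θ (m * t + k)) a b :=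
    ⟨hθ.1.comp (by fun_prop) hmaps, fun t ht => hθ.2 _ (hmaps ht)⟩
  rw [hθ.logVar_eq hab', h'.logVar_eq hab]

theorem logVar_eq_sum {f : ℝ → ℂ} {x : ℕ → ℝ} (hx : Monotone x) (N : ℕ)
    (hf : ContinuousOn f (Icc (x 0) (x N))) (h0 : ∀ t ∈ Icc (x 0) (x N), f t ≠ 0) :
    logVar f (x 0) (x N) = ∑ i ∈ Finset.range N, logVar f (x i) (x (i + 1)) := by
  obtain ⟨θ, hθ⟩ := exists_isLogOn (hx (Nat.zero_le N)) hf h0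
  rw [hθ.logVar_eq (hx (Nat.zero_le N)), ← Finset.sum_range_sub (fun i => θ (x i))]
  refine Finset.sum_congr rfl fun i hi => ?_
  exact ((hθ.mono (hx (Nat.zero_le i)) (hx (Finset.mem_range.1 hi))).logVar_eq
    (hx (Nat.le_succ i))).symm

/-- For `w` near `z` the ratio `(γ - w) / (γ - z)` stays within distance `1` of `1`. Adding its
principal logarithm to a fixed logarithm of `γ - z` shows that the variation depends on `w` through
the endpoints only. -/
theorem continuousAt_logVar_sub {γ : ℝ → ℂ} {a b : ℝ} (hab : a ≤ b)
    (hγ : ContinuousOn γ (Icc a b)) {z : ℂ} (hz : z ∉ γ '' Icc a b) :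
    ContinuousAt (fun z => logVar (fun t => γ t - z) a b) z := by
  have hK : IsCompact (γ '' Icc a b) := isCompact_Icc.image_of_continuousOn hγ
  obtain ⟨ρ, hρ, hball⟩ := Metric.isOpen_iff.1 hK.isClosed.isOpen_compl z hz
  have hne : ∀ w ∈ Metric.ball z ρ, ∀ t ∈ Icc a b, γ t - w ≠ 0 := fun w hw t ht h =>
    hball hw ⟨t, ht, sub_eq_zero.1 h⟩
  have hge : ∀ t ∈ Icc a b, ρ ≤ ‖γ t - z‖ := fun t ht => by
    by_contra! h
    exact hball (show γ t ∈ Metric.ball z ρ by simpa [dist_eq_norm] using h) ⟨t, ht, rfl⟩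
  obtain ⟨θ, hθ⟩ := exists_isLogOn (f := fun t => γ t - z) hab (hγ.sub continuousOn_const)
    (hne z (Metric.mem_ball_self hρ))
  have hslit : ∀ w ∈ Metric.ball z ρ, ∀ t ∈ Icc a b, (γ t - w) / (γ t - z) ∈ Complex.slitPlane := by
    intro w hw t ht
    have h1 := hge t ht
    have h2 := hne z (Metric.mem_ball_self hρ) t ht
    rw [show (γ t - w) / (γ t - z) = 1 + (z - w) / (γ t - z) by field_simp; ring]
    refine Complex.mem_slitPlane_of_norm_lt_one ?_
    rw [norm_div, div_lt_one (by linarith)]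
    rw [Metric.mem_ball, dist_comm, dist_eq_norm] at hw
    linarith
  have hlog : ∀ w ∈ Metric.ball z ρ, logVar (fun t => γ t - w) a b = θ b - θ a +
      (Complex.log ((γ b - w) / (γ b - z)) - Complex.log ((γ a - w) / (γ a - z))) := by
    intro w hw
    have : IsLogOn (fun t => γ t - w)
        (fun t => θ t + Complex.log ((γ t - w) / (γ t - z))) a b := by
      refine ⟨hθ.1.add (ContinuousOn.clog (ContinuousOn.div (by fun_prop) (by fun_prop)
        (hne z (Metric.mem_ball_self hρ))) (hslit w hw)), fun t ht => ?_⟩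
      have h2 := hne z (Metric.mem_ball_self hρ) t ht
      rw [Complex.exp_add, hθ.2 t ht, Complex.exp_log (Complex.slitPlane_ne_zero (hslit w hw t ht))]
      field_simp
    rw [this.logVar_eq hab]
    ring
  have hev : (fun z => logVar (fun t => γ t - z) a b) =ᶠ[𝓝 z] fun w => θ b - θ a +
      (Complex.log ((γ b - w) / (γ b - z)) - Complex.log ((γ a - w) / (γ a - z))) := by
    filter_upwards [Metric.ball_mem_nhds z hρ] with w hw using hlog w hw
  refine ContinuousAt.congr ?_ hev.symm
  have hz' := Metric.mem_ball_self (x := z) hρ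
  refine continuousAt_const.add (ContinuousAt.sub ?_ ?_)
  · exact ContinuousAt.clog (by fun_prop) (hslit z hz' b (right_mem_Icc.2 hab))
  · exact ContinuousAt.clog (by fun_prop) (hslit z hz' a (left_mem_Icc.2 hab))

/-! ### Separation by simple closed curves -/

/-- A nowhere vanishing `F` has a global logarithm, whose variation around a large circle is `0`;
but `(z - z₁) ^ m` has variation `2πim` there. -/
theorem exponent_eq_zero_of_extension {F : ℂ → ℂ} (hF : Continuous F) (h0 : ∀ z, F z ≠ 0) {z₁ : ℂ}
    {m : ℤ} {R : ℝ} (hR : ∀ z, R ≤ ‖z - z₁‖ → F z = (z - z₁) ^ m) : m = 0 := by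
  obtain ⟨L, hL, he⟩ := exists_global_log hF h0
  set ρ := max R 1
  have hρ : 0 < ρ := lt_of_lt_of_le one_pos (le_max_right _ _)
  have hρ' : (ρ : ℂ) ≠ 0 := by exact_mod_cast hρ.ne'
  set φ : ℝ → ℂ := fun t => L (z₁ + ρ * Complex.exp (t * Complex.I)) - m * (t * Complex.I)
    - Complex.log ((ρ : ℂ) ^ m)
  have hφ : Continuous φ := by fun_prop
  have hφe : ∀ t, Complex.exp (φ t) = 1 := by
    intro t
    have hnorm : ‖z₁ + ρ * Complex.exp (t * Complex.I) - z₁‖ = ρ := by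
      rw [add_sub_cancel_left, norm_mul, Complex.norm_exp_ofReal_mul_I, mul_one, Complex.norm_real,
        Real.norm_of_nonneg hρ.le]
    have hp : (ρ : ℂ) ^ m ≠ 0 := zpow_ne_zero _ hρ'
    simp only [φ]
    rw [Complex.exp_sub, Complex.exp_sub, he, hR _ ((le_max_left R 1).trans hnorm.ge), add_sub_cancel_left,
      mul_zpow, Complex.exp_int_mul, Complex.exp_log hp]
    have := zpow_ne_zero m (Complex.exp_ne_zero (t * Complex.I))
    field_simp
  have := eq_of_exp_eq_one isPreconnected_univ hφ.continuousOn (fun t _ => hφe t)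
    (mem_univ (2 * Real.pi)) (mem_univ 0)
  have e1 : Complex.exp (((2 * Real.pi : ℝ) : ℂ) * Complex.I) = 1 := by
    push_cast; exact Complex.exp_two_pi_mul_I
  have e2 : Complex.exp (((0 : ℝ) : ℂ) * Complex.I) = 1 := by simp
  simp only [φ, e1, e2] at this
  have h3 : (m : ℂ) * (2 * Real.pi * Complex.I) = 0 := by
    push_cast at this
    linear_combination -this
  have := (mul_eq_zero.1 h3).resolve_right Complex.two_pi_I_ne_zero
  exact_mod_cast this

/-- Extend `L` by Tietze and glue `exp L * ψ` on `Y` to `(z - z₁) ^ m` outside. The two agree on the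
frontier, and `z₁` is interior to `Y`, so the glued function is continuous without zeros and equals
the power near infinity. All the separation statements come from this. -/
theorem exponent_eq_zero_of_log {Y A : Set ℂ} (hY : IsClosed Y) (hYb : Bornology.IsBounded Y)
    (hA : IsClosed A) (hfr : frontier Y ⊆ A) {z₁ : ℂ} (hz₁ : z₁ ∈ interior Y) {m : ℤ} {ψ L : ℂ → ℂ}
    (hψ : ContinuousOn ψ Y) (hψ0 : ∀ x ∈ Y, ψ x ≠ 0) (hL : ContinuousOn L A)
    (he : ∀ x ∈ A, Complex.exp (L x) * ψ x = (x - z₁) ^ m) : m = 0 := by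
  classical
  obtain ⟨L', hL'⟩ := ContinuousMap.exists_restrict_eq hA
    ⟨A.domRestrict L, continuousOn_iff_continuous_domRestrict.1 hL⟩
  have hLL' : ∀ x ∈ A, L' x = L x := fun x hx => congrArg (fun f : C(A, ℂ) => f ⟨x, hx⟩) hL'
  have hne : ∀ z ∈ closure Yᶜ, z - z₁ ≠ 0 := by
    intro z hz h
    rw [sub_eq_zero.1 h, closure_compl] at hz
    exact hz hz₁
  set F : ℂ → ℂ := Y.piecewise (fun z => Complex.exp (L' z) * ψ z) (fun z => (z - z₁) ^ m)
  have hF : Continuous F := by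
    refine continuous_piecewise (fun z hz => ?_) ?_ ?_
    · rw [hLL' z (hfr hz)]; exact he z (hfr hz)
    · rw [hY.closure_eq]
      exact (Complex.continuous_exp.comp L'.continuous).continuousOn.mul hψ
    · exact ContinuousOn.zpow₀ (by fun_prop) m fun z hz => Or.inl (hne z hz)
  have hF0 : ∀ z, F z ≠ 0 := by
    intro z
    by_cases hz : z ∈ Y
    · simp only [F, piecewise_eq_of_mem _ _ _ hz]
      exact mul_ne_zero (Complex.exp_ne_zero _) (hψ0 z hz)
    · simp only [F, piecewise_eq_of_notMem _ _ _ hz]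
      exact zpow_ne_zero _ (hne z (subset_closure hz))
  obtain ⟨R, hR⟩ := hYb.subset_ball z₁
  refine exponent_eq_zero_of_extension hF hF0 (z₁ := z₁) (R := R) fun z hz => ?_
  have : z ∉ Y := fun h => by
    have := hR h
    rw [Metric.mem_ball, dist_eq_norm] at this
    linarith
  exact piecewise_eq_of_notMem _ _ _ this

/-- A continuous map from a compact set onto its image is a quotient map. -/
theorem exists_descent {Γ θ : ℝ → ℂ} {S : Set ℝ} (hS : IsCompact S) (hΓ : ContinuousOn Γ S)
    (hθ : ContinuousOn θ S) (h : ∀ s ∈ S, ∀ t ∈ S, Γ s = Γ t → θ s = θ t) :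
    ∃ L : ℂ → ℂ, ContinuousOn L (Γ '' S) ∧ ∀ t ∈ S, L (Γ t) = θ t := by
  classical
  set L : ℂ → ℂ := fun x => if hx : x ∈ Γ '' S then θ hx.choose else 0
  have hLt : ∀ t ∈ S, L (Γ t) = θ t := fun t ht => by
    have hx : Γ t ∈ Γ '' S := ⟨t, ht, rfl⟩
    simp only [L, dif_pos hx]
    exact h _ hx.choose_spec.1 _ ht hx.choose_spec.2
  refine ⟨L, ?_, hLt⟩
  have : CompactSpace S := isCompact_iff_compactSpace.1 hS
  set q : S → Γ '' S := fun t => ⟨Γ t, t, t.2, rfl⟩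
  have hq : Continuous q :=
    (continuousOn_iff_continuous_domRestrict.1 hΓ).subtype_mk _
  have hqs : Function.Surjective q := by
    rintro ⟨_, t, ht, rfl⟩
    exact ⟨⟨t, ht⟩, rfl⟩
  have hquot := hq.isClosedMap.isQuotientMap hq hqs
  rw [continuousOn_iff_continuous_domRestrict, hquot.continuous_iff]
  have : (Γ '' S).domRestrict L ∘ q = S.domRestrict θ := by
    ext t
    exact hLt t t.2
  rw [this]
  exact continuousOn_iff_continuous_domRestrict.1 hθ

/-- `Γ : [0, T] → ℂ` is a simple closed curve. -/
structure IsSimpleLoop (Γ : ℝ → ℂ) (T : ℝ) : Prop where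
  pos : 0 < T
  continuousOn : ContinuousOn Γ (Icc 0 T)
  injOn : InjOn Γ (Ico 0 T)
  closed : Γ T = Γ 0

/-- `2πi` times the winding number. -/
def index (Γ : ℝ → ℂ) (T : ℝ) (z : ℂ) : ℂ := logVar (fun t => Γ t - z) 0 T

section
variable {Γ : ℝ → ℂ} {T : ℝ}

theorem IsSimpleLoop.isCompact (h : IsSimpleLoop Γ T) : IsCompact (Γ '' Icc 0 T) :=
  isCompact_Icc.image_of_continuousOn h.continuousOn

theorem IsSimpleLoop.exists_isLogOn (h : IsSimpleLoop Γ T) {z : ℂ} (hz : z ∉ Γ '' Icc 0 T) :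
    ∃ θ, IsLogOn (fun t => Γ t - z) θ 0 T :=
  GKF.exists_isLogOn h.pos.le (h.continuousOn.sub continuousOn_const) fun t ht h0 =>
    hz ⟨t, ht, sub_eq_zero.1 h0⟩

theorem IsSimpleLoop.exp_index (h : IsSimpleLoop Γ T) {z : ℂ} (hz : z ∉ Γ '' Icc 0 T) :
    Complex.exp (index Γ T z) = 1 := by
  have hne : ∀ t ∈ Icc 0 T, Γ t - z ≠ 0 := fun t ht h0 => hz ⟨t, ht, sub_eq_zero.1 h0⟩
  rw [index, exp_logVar (f := fun t => Γ t - z) h.pos.le (h.continuousOn.sub continuousOn_const) hne]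
  simp only [h.closed]
  rw [div_self (hne 0 (left_mem_Icc.2 h.pos.le))]

theorem IsSimpleLoop.continuousAt_index (h : IsSimpleLoop Γ T) {z : ℂ} (hz : z ∉ Γ '' Icc 0 T) :
    ContinuousAt (index Γ T) z :=
  continuousAt_logVar_sub h.pos.le h.continuousOn hz

theorem IsSimpleLoop.eq_or (h : IsSimpleLoop Γ T) {s t : ℝ} (hs : s ∈ Icc 0 T) (ht : t ∈ Icc 0 T)
    (hst : Γ s = Γ t) : s = t ∨ (s = 0 ∧ t = T) ∨ (s = T ∧ t = 0) := by
  have h0 : (0 : ℝ) ∈ Ico 0 T := ⟨le_rfl, h.pos⟩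
  rcases hs.2.lt_or_eq with hs' | rfl <;> rcases ht.2.lt_or_eq with ht' | rfl
  · exact Or.inl (h.injOn ⟨hs.1, hs'⟩ ⟨ht.1, ht'⟩ hst)
  · rw [h.closed] at hst
    exact Or.inr (Or.inl ⟨h.injOn ⟨hs.1, hs'⟩ h0 hst, rfl⟩)
  · rw [h.closed] at hst
    exact Or.inr (Or.inr ⟨rfl, (h.injOn h0 ⟨ht.1, ht'⟩ hst).symm⟩)
  · exact Or.inl rfl

theorem IsBoundedComponent.isOpen {Ω K : Set ℂ} (hΩ : IsBoundedComponent Ω K) (hK : IsClosed K) :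
    IsOpen Ω := by
  obtain ⟨⟨x, _, rfl⟩, _⟩ := hΩ
  exact hK.isOpen_compl.connectedComponentIn

theorem IsBoundedComponent.subset {Ω K : Set ℂ} (hΩ : IsBoundedComponent Ω K) : Ω ⊆ Kᶜ := by
  obtain ⟨⟨x, _, rfl⟩, _⟩ := hΩ
  exact connectedComponentIn_subset _ _

theorem IsBoundedComponent.nonempty {Ω K : Set ℂ} (hΩ : IsBoundedComponent Ω K) : Ω.Nonempty := by
  obtain ⟨⟨x, hx, rfl⟩, _⟩ := hΩ
  exact ⟨x, mem_connectedComponentIn hx⟩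

theorem IsBoundedComponent.isPreconnected {Ω K : Set ℂ} (hΩ : IsBoundedComponent Ω K) :
    IsPreconnected Ω := by
  obtain ⟨⟨x, _, rfl⟩, _⟩ := hΩ
  exact isPreconnected_connectedComponentIn

theorem IsBoundedComponent.isClosed_union {Ω K : Set ℂ} (hΩ : IsBoundedComponent Ω K)
    (hK : IsClosed K) : IsClosed (Ω ∪ K) := by
  obtain ⟨⟨x, hx, rfl⟩, _⟩ := hΩ
  rw [← isOpen_compl_iff, isOpen_iff_mem_nhds]
  intro z hz
  rw [compl_union] at hz
  have ho : IsOpen (connectedComponentIn Kᶜ z) := hK.isOpen_compl.connectedComponentIn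
  filter_upwards [ho.mem_nhds (mem_connectedComponentIn hz.2)] with w hw
  rw [compl_union]
  refine ⟨fun hw' => hz.1 ?_, connectedComponentIn_subset _ _ hw⟩
  rw [connectedComponentIn_eq hw', ← connectedComponentIn_eq hw]
  exact mem_connectedComponentIn hz.2

theorem IsBoundedComponent.frontier_union_subset {Ω K : Set ℂ} (hΩ : IsBoundedComponent Ω K)
    (hK : IsClosed K) : frontier (Ω ∪ K) ⊆ K := by
  intro z hz
  rw [frontier, (hΩ.isClosed_union hK).closure_eq] at hz
  refine hz.1.resolve_left fun h => hz.2 ?_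
  exact interior_mono subset_union_left ((hΩ.isOpen hK).interior_eq.symm ▸ h)

theorem IsBoundedComponent.frontier_closure_subset {Ω K : Set ℂ} (hΩ : IsBoundedComponent Ω K)
    (hK : IsClosed K) : frontier (closure Ω) ⊆ K := by
  intro z hz
  have h1 : z ∈ closure Ω := by
    have := frontier_subset_closure hz
    rwa [closure_closure] at this
  have h2 : z ∉ Ω := fun h => hz.2
    (interior_mono subset_closure ((hΩ.isOpen hK).interior_eq.symm ▸ h))
  exact (((hΩ.isClosed_union hK).closure_subset_iff.2 subset_union_left) h1).resolve_left h2

theorem IsBoundedComponent.subset_interior_union {Ω K : Set ℂ} (hΩ : IsBoundedComponent Ω K)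
    (hK : IsClosed K) : Ω ⊆ interior (Ω ∪ K) :=
  interior_maximal subset_union_left (hΩ.isOpen hK)

/-- With index `0` a logarithm of `Γ - z` closes up and descends to the curve, which forces the
exponent `1` to be `0`. -/
theorem IsSimpleLoop.index_ne_zero (h : IsSimpleLoop Γ T) {Ω : Set ℂ}
    (hΩ : IsBoundedComponent Ω (Γ '' Icc 0 T)) {z : ℂ} (hz : z ∈ Ω) : index Γ T z ≠ 0 := by
  intro h0
  have hK := h.isCompact.isClosed
  obtain ⟨θ, hθ⟩ := h.exists_isLogOn (hΩ.subset hz)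
  rw [index, hθ.logVar_eq h.pos.le, sub_eq_zero] at h0
  obtain ⟨L, hL, hLt⟩ := exists_descent isCompact_Icc h.continuousOn hθ.1 (fun s hs t ht hst => by
    rcases h.eq_or hs ht hst with rfl | ⟨rfl, rfl⟩ | ⟨rfl, rfl⟩
    · rfl
    · exact h0.symm
    · exact h0)
  have := exponent_eq_zero_of_log (hΩ.isClosed_union hK) (hΩ.2.union h.isCompact.isBounded) hK
    (hΩ.frontier_union_subset hK) (z₁ := z) (hΩ.subset_interior_union hK hz) (m := 1) (ψ := 1)
    continuousOn_const (fun _ _ => one_ne_zero) hL (by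
      rintro _ ⟨t, ht, rfl⟩
      rw [hLt t ht, hθ.2 t ht]
      simp)
  exact one_ne_zero this

/-- Let `2πi m₁` and `2πi m₂` be the indices at `z₁ ∈ Ω` and at `z`. The combination `m₂ θ₁ - m₁ θ₂`
closes up and gives `exp L * (x - z) ^ m₁ = (x - z₁) ^ m₂` on the curve. Since `x - z` has no zero
on `Ω` and the curve, `m₂ = 0`. -/
theorem IsSimpleLoop.index_eq_zero (h : IsSimpleLoop Γ T) {Ω : Set ℂ}
    (hΩ : IsBoundedComponent Ω (Γ '' Icc 0 T)) {z : ℂ} (hzK : z ∉ Γ '' Icc 0 T) (hz : z ∉ Ω) :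
    index Γ T z = 0 := by
  have hK := h.isCompact.isClosed
  obtain ⟨z₁, hz₁⟩ := hΩ.nonempty
  obtain ⟨θ₁, hθ₁⟩ := h.exists_isLogOn (hΩ.subset hz₁)
  obtain ⟨θ₂, hθ₂⟩ := h.exists_isLogOn hzK
  obtain ⟨m₁, hm₁⟩ := Complex.exp_eq_one_iff.1 (h.exp_index (hΩ.subset hz₁))
  obtain ⟨m₂, hm₂⟩ := Complex.exp_eq_one_iff.1 (h.exp_index hzK)
  have e1 := hm₁
  have e2 := hm₂
  rw [index, hθ₁.logVar_eq h.pos.le] at e1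
  rw [index, hθ₂.logVar_eq h.pos.le] at e2
  set θ : ℝ → ℂ := fun t => m₂ * θ₁ t - m₁ * θ₂ t
  have hθc : ContinuousOn θ (Icc 0 T) :=
    (continuousOn_const.mul hθ₁.1).sub (continuousOn_const.mul hθ₂.1)
  have hθT : θ T = θ 0 := by simp only [θ]; linear_combination (m₂ : ℂ) * e1 - m₁ * e2
  obtain ⟨L, hL, hLt⟩ := exists_descent isCompact_Icc h.continuousOn hθc (fun s hs t ht hst => by
    rcases h.eq_or hs ht hst with rfl | ⟨rfl, rfl⟩ | ⟨rfl, rfl⟩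
    · rfl
    · exact hθT.symm
    · exact hθT)
  have hne : ∀ x ∈ Ω ∪ Γ '' Icc 0 T, x - z ≠ 0 := by
    intro x hx h0
    rw [sub_eq_zero.1 h0] at hx
    exact hx.elim hz hzK
  have := exponent_eq_zero_of_log (hΩ.isClosed_union hK) (hΩ.2.union h.isCompact.isBounded) hK
    (hΩ.frontier_union_subset hK) (hΩ.subset_interior_union hK hz₁) (m := m₂)
    (ψ := fun x => (x - z) ^ m₁) (ContinuousOn.zpow₀ (by fun_prop) m₁ fun x hx => Or.inl (hne x hx))
    (fun x hx => zpow_ne_zero _ (hne x hx)) hL (by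
      rintro _ ⟨t, ht, rfl⟩
      have := zpow_ne_zero m₁ (hne _ (Or.inr ⟨t, ht, rfl⟩))
      rw [hLt t ht, Complex.exp_sub, Complex.exp_int_mul, Complex.exp_int_mul, hθ₁.2 t ht,
        hθ₂.2 t ht]
      field_simp)
  rw [hm₂, this]
  simp

theorem IsSimpleLoop.index_eq_of_mem (h : IsSimpleLoop Γ T) {Ω : Set ℂ}
    (hΩ : IsBoundedComponent Ω (Γ '' Icc 0 T)) {z w : ℂ} (hz : z ∈ Ω) (hw : w ∈ Ω) :
    index Γ T z = index Γ T w :=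
  eq_of_exp_eq_one hΩ.isPreconnected
    (fun _ hx => (h.continuousAt_index (hΩ.subset hx)).continuousWithinAt)
    (fun _ hx => h.exp_index (hΩ.subset hx)) hz hw

theorem IsSimpleLoop.exists_log_on_arc (h : IsSimpleLoop Γ T) {z : ℂ} (hz : z ∉ Γ '' Icc 0 T)
    {a b : ℝ} (ha : 0 < a) (hab : a < b) (hb : b < T) :
    ∃ L : ℂ → ℂ, ContinuousOn L (Γ '' (Icc 0 a ∪ Icc b T)) ∧
      ∀ x ∈ Γ '' (Icc 0 a ∪ Icc b T), Complex.exp (L x) = x - z := by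
  classical
  obtain ⟨θ, hθ⟩ := h.exists_isLogOn hz
  have hsub : Icc 0 a ∪ Icc b T ⊆ Icc 0 T :=
    union_subset (Icc_subset_Icc_right (by linarith)) (Icc_subset_Icc_left (by linarith))
  have h0T := hθ.2 0 (left_mem_Icc.2 h.pos.le)
  have hTT := hθ.2 T (right_mem_Icc.2 h.pos.le)
  set c := θ T - θ 0
  have hc : Complex.exp c = 1 := by
    rw [Complex.exp_sub, h0T, hTT]
    simp only [h.closed]
    rw [div_self]
    exact fun h0 => hz ⟨0, left_mem_Icc.2 h.pos.le, sub_eq_zero.1 h0⟩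
  -- Removing the open arc `(a, b)` allows a jump: subtracting the full variation `c` on `[b, T]`
  -- makes the values at `0` and `T` agree, and `exp c = 1` keeps it a logarithm.
  set θ' : ℝ → ℂ := fun t => if t ≤ a then θ t else θ t - c
  have h1 : ContinuousOn θ' (Icc 0 a) :=
    (hθ.1.mono (subset_union_left.trans hsub)).congr fun t ht => if_pos ht.2
  have h2 : ContinuousOn θ' (Icc b T) :=
    ((hθ.1.mono (subset_union_right.trans hsub)).sub continuousOn_const).congr fun t ht =>
      if_neg (by linarith [ht.1])
  have hθ'c := h1.union_of_isClosed h2 isClosed_Icc isClosed_Icc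
  have e0 : θ' 0 = θ 0 := if_pos ha.le
  have eT : θ' T = θ 0 := by simp only [θ', if_neg (show ¬ T ≤ a by linarith), c]; ring
  obtain ⟨L, hL, hLt⟩ := exists_descent (isCompact_Icc.union isCompact_Icc)
    (h.continuousOn.mono hsub) hθ'c (fun s hs t ht hst => by
      rcases h.eq_or (hsub hs) (hsub ht) hst with rfl | ⟨rfl, rfl⟩ | ⟨rfl, rfl⟩
      · rfl
      · rw [e0, eT]
      · rw [e0, eT])
  refine ⟨L, hL, ?_⟩
  rintro _ ⟨t, ht, rfl⟩
  rw [hLt t ht]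
  refine Eq.trans ?_ (hθ.2 t (hsub ht))
  by_cases hta : t ≤ a
  · simp only [θ', if_pos hta]
  · simp only [θ', if_neg hta]
    rw [Complex.exp_sub, hc, div_one]

/-- An arc does not separate the plane. If `B` missed one side, `closure Ω` or the union of `Ω` and
the curve would be a bounded set around `z₁` with frontier in the curve minus a subarc inside `B`;
there `x - z₁` has a logarithm, a contradiction. -/
theorem IsSimpleLoop.both_sides (h : IsSimpleLoop Γ T) {Ω : Set ℂ}
    (hΩ : IsBoundedComponent Ω (Γ '' Icc 0 T)) {p : ℂ} (hp : p ∈ Γ '' Icc 0 T) {B : Set ℂ}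
    (hB : IsOpen B) (hpB : p ∈ B) :
    (∃ z ∈ B, z ∈ Ω) ∧ (∃ z ∈ B, z ∉ Ω ∧ z ∉ Γ '' Icc 0 T) := by
  have hK := h.isCompact.isClosed
  obtain ⟨z₁, hz₁⟩ := hΩ.nonempty
  obtain ⟨a, b, ha, hab, hb, hsub⟩ : ∃ a b, 0 < a ∧ a < b ∧ b < T ∧ ∀ t ∈ Icc a b, Γ t ∈ B := by
    obtain ⟨t₀, ht₀, rfl⟩ := hp
    have hpre : ∀ᶠ t in 𝓝[Icc 0 T] t₀, Γ t ∈ B := (h.continuousOn t₀ ht₀) (hB.mem_nhds hpB)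
    obtain ⟨δ, hδ, hδB⟩ := Metric.mem_nhdsWithin_iff.1 hpre
    have hball : ∀ t, |t - t₀| < δ → 0 ≤ t → t ≤ T → Γ t ∈ B := fun t h1 h2 h3 =>
      hδB ⟨by rwa [Metric.mem_ball, Real.dist_eq], h2, h3⟩
    have hT := h.pos
    -- The subarc is taken on the side of `t₀` with more room, to keep `0 < a < b < T`.
    rcases le_or_gt T (2 * t₀) with h1 | h1
    · set η := min (δ / 2) (T / 4)
      have hη : 0 < η := by positivity
      have hη1 : η ≤ δ / 2 := min_le_left _ _
      have hη2 : η ≤ T / 4 := min_le_right _ _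
      refine ⟨t₀ - η, t₀ - η / 2, by linarith, by linarith, by linarith [ht₀.2], fun t ht =>
        hball t ?_ (by linarith [ht.1]) (by linarith [ht.2, ht₀.2])⟩
      rw [abs_lt]; constructor <;> linarith [ht.1, ht.2]
    · set η := min (δ / 2) (T / 4)
      have hη : 0 < η := by positivity
      have hη1 : η ≤ δ / 2 := min_le_left _ _
      have hη2 : η ≤ T / 4 := min_le_right _ _
      refine ⟨t₀ + η / 2, t₀ + η, by linarith [ht₀.1], by linarith, by linarith, fun t ht =>
        hball t ?_ (by linarith [ht.1, ht₀.1]) (by linarith [ht.2])⟩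
      rw [abs_lt]; constructor <;> linarith [ht.1, ht.2]
  set A := Γ '' (Icc 0 a ∪ Icc b T)
  have hA : IsClosed A := ((isCompact_Icc.union isCompact_Icc).image_of_continuousOn
    (h.continuousOn.mono (union_subset (Icc_subset_Icc_right (by linarith))
      (Icc_subset_Icc_left (by linarith))))).isClosed
  have hKA : ∀ x ∈ Γ '' Icc 0 T, x ∉ B → x ∈ A := by
    rintro _ ⟨t, ht, rfl⟩ hx
    by_contra hnA
    have h1 : ¬ t ≤ a := fun h1 => hnA ⟨t, Or.inl ⟨ht.1, h1⟩, rfl⟩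
    have h2 : ¬ b ≤ t := fun h2 => hnA ⟨t, Or.inr ⟨h2, ht.2⟩, rfl⟩
    exact hx (hsub t ⟨by linarith, by linarith⟩)
  obtain ⟨L, hL, hLe⟩ := h.exists_log_on_arc (hΩ.subset hz₁) ha hab hb
  have key : ∀ Y : Set ℂ, IsClosed Y → Bornology.IsBounded Y → frontier Y ⊆ A → z₁ ∈ interior Y →
      False := fun Y h1 h2 h3 h4 =>
    one_ne_zero (exponent_eq_zero_of_log h1 h2 hA h3 h4 (m := 1) (ψ := 1) continuousOn_const
      (fun _ _ => one_ne_zero) hL (fun _ hx => by rw [hLe _ hx]; simp))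
  constructor
  · by_contra! hcon
    refine key (closure Ω) isClosed_closure hΩ.2.closure (fun x hx => ?_)
      (interior_mono subset_closure ((hΩ.isOpen hK).interior_eq.symm ▸ hz₁))
    refine hKA x (hΩ.frontier_closure_subset hK hx) fun hxB => ?_
    have hx' : x ∈ closure Ω := by
      have := frontier_subset_closure hx
      rwa [closure_closure] at this
    obtain ⟨w, hwB, hwΩ⟩ := mem_closure_iff.1 hx' B hB hxB
    exact hcon w hwB hwΩ
  · by_contra! hcon
    refine key (Ω ∪ Γ '' Icc 0 T) (hΩ.isClosed_union hK) (hΩ.2.union h.isCompact.isBounded)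
      (fun x hx => ?_) (hΩ.subset_interior_union hK hz₁)
    refine hKA x (hΩ.frontier_union_subset hK hx) fun hxB => hx.2 ?_
    refine mem_interior.2 ⟨B, fun w hw => ?_, hB, hxB⟩
    by_cases hwΩ : w ∈ Ω
    · exact Or.inl hwΩ
    · exact Or.inr (hcon w hw hwΩ)

end

/-! ### Curves composed of similar copies of one arc -/

/-- The logarithmic variation of `γ - z` along the arc `γ : [0, 1] → ℂ`. -/
def arcVar (γ : ℝ → ℂ) (z : ℂ) : ℂ := logVar (fun t => γ t - z) 0 1

theorem continuousAt_arcVar {γ : ℝ → ℂ} (hγ : ContinuousOn γ (Icc 0 1)) {z : ℂ}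
    (hz : z ∉ γ '' Icc 0 1) : ContinuousAt (arcVar γ) z :=
  continuousAt_logVar_sub zero_le_one hγ hz

/-- The similar copy `a C + b` of `C`. -/
def copy (a b : ℂ) (C : Set ℂ) : Set ℂ := (fun z => a * z + b) '' C

theorem mem_copy {a b : ℂ} (ha : a ≠ 0) {C : Set ℂ} {z : ℂ} :
    z ∈ copy a b C ↔ (z - b) / a ∈ C := by
  constructor
  · rintro ⟨w, hw, rfl⟩
    simpa [ha] using hw
  · intro h
    exact ⟨_, h, by field_simp; ring⟩

theorem isCompact_copy {a b : ℂ} {C : Set ℂ} (hC : IsCompact C) : IsCompact (copy a b C) :=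
  hC.image (by fun_prop)

/-- The variation is additive over the pieces, and on each piece the factor `a i` drops out, so
every term is the variation of the one arc `γ` seen from the pulled back point. -/
theorem logVar_eq_sum_arcVar {γ Γ : ℝ → ℂ} {N : ℕ} {a b : ℕ → ℂ} (hγ : ContinuousOn γ (Icc 0 1))
    (hΓ : ContinuousOn Γ (Icc 0 N)) (ha : ∀ i < N, a i ≠ 0)
    (hp : ∀ i < N, ∀ t ∈ Icc (0 : ℝ) 1, Γ (i + t) = a i * γ t + b i) {z : ℂ}
    (hz : z ∉ Γ '' Icc 0 N) :
    logVar (fun t => Γ t - z) 0 N = ∑ i ∈ Finset.range N, arcVar γ ((z - b i) / a i) := by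
  have hne : ∀ t ∈ Icc (0 : ℝ) N, Γ t - z ≠ 0 := fun t ht h => hz ⟨t, ht, sub_eq_zero.1 h⟩
  have hcont : ContinuousOn (fun t => Γ t - z) (Icc 0 N) := hΓ.sub continuousOn_const
  have h1 := logVar_eq_sum (f := fun t => Γ t - z) (x := fun i : ℕ => (i : ℝ)) Nat.mono_cast N
    (by simpa using hcont) (by simpa using hne)
  rw [Nat.cast_zero] at h1
  rw [h1]
  refine Finset.sum_congr rfl fun i hi => ?_
  have hi := Finset.mem_range.1 hi
  have hiN : (i : ℝ) + 1 ≤ N := by exact_mod_cast hi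
  have hi0 : (0 : ℝ) ≤ i := Nat.cast_nonneg i
  have hsub : Icc (1 * (0 : ℝ) + i) (1 * 1 + i) ⊆ Icc (0 : ℝ) N := by
    refine Icc_subset_Icc ?_ ?_ <;> linarith
  have h2 := logVar_comp_affine (f := fun t => Γ t - z) (a := 0) (b := 1) (m := 1) (k := i) one_pos
    zero_le_one (hcont.mono hsub) (fun t ht => hne t (hsub ht))
  have hmem : ∀ t ∈ Icc (0 : ℝ) 1, (i : ℝ) + t ∈ Icc (0 : ℝ) N := fun t ht =>
    ⟨by linarith [ht.1], by linarith [ht.2]⟩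
  have h3 : EqOn (fun t => Γ (1 * t + i) - z) (fun t => a i * (γ t - (z - b i) / a i)) (Icc 0 1) := by
    intro t ht
    have := ha i hi
    simp only
    rw [one_mul, add_comm, hp i hi t ht]
    field_simp
    ring
  rw [logVar_congr h3, logVar_const_mul zero_le_one (by fun_prop) (fun t ht h => by
    refine hne (i + t) (hmem t ht) ?_
    have := h3 ht
    simp only [h, mul_zero, one_mul] at this
    rwa [add_comm]) (ha i hi)] at h2
  rw [arcVar, h2]
  congr 1
  · ring
  · push_cast; ring

/-- `γ : [0, 1] → ℂ` is a simple arc from `0` to `1` that is composed of `n + 1` similar copies of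
itself, the first and the last of which are homothetic copies of ratio `l`. -/
structure IsSelfSimilarArc (γ : ℝ → ℂ) (n : ℕ) (l : ℝ) (A B : ℕ → ℂ) : Prop where
  l_pos : 0 < l
  l_lt_one : l < 1
  continuousOn : ContinuousOn γ (Icc 0 1)
  injOn : InjOn γ (Icc 0 1)
  piece : ∀ k < n + 1, ∀ t ∈ Icc (0 : ℝ) 1, γ ((k + t) / (n + 1)) = A k * γ t + B k
  A_ne : ∀ k < n + 1, A k ≠ 0
  A_zero : A 0 = l
  B_zero : B 0 = 0
  A_last : A n = l
  B_last : B n = 1 - l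
  zero : γ 0 = 0
  one : γ 1 = 1

/-- The closed curve `Γ : [0, N] → ℂ` is simple and composed of `N` similar copies of `γ`. -/
structure IsLoopOfArcs (γ : ℝ → ℂ) (N : ℕ) (a b : ℕ → ℂ) (Γ : ℝ → ℂ) : Prop where
  ne_zero : ∀ i < N, a i ≠ 0
  loop : IsSimpleLoop Γ N
  piece : ∀ i < N, ∀ t ∈ Icc (0 : ℝ) 1, Γ (i + t) = a i * γ t + b i

section arc
variable {γ : ℝ → ℂ} {n : ℕ} {l : ℝ} {A B : ℕ → ℂ}

theorem IsSelfSimilarArc.isCompact (h : IsSelfSimilarArc γ n l A B) : IsCompact (γ '' Icc 0 1) :=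
  isCompact_Icc.image_of_continuousOn h.continuousOn

theorem mem_Icc_div {n k : ℕ} (hk : k < n + 1) {t : ℝ} (ht : t ∈ Icc (0 : ℝ) 1) :
    (k + t) / (n + 1) ∈ Icc (0 : ℝ) 1 := by
  have hk' : (k : ℝ) + 1 ≤ n + 1 := by exact_mod_cast hk
  have := ht.1
  have := ht.2
  refine ⟨by positivity, ?_⟩
  rw [div_le_one (by positivity)]
  linarith

theorem IsSelfSimilarArc.copy_subset (h : IsSelfSimilarArc γ n l A B) {k : ℕ} (hk : k < n + 1) :
    copy (A k) (B k) (γ '' Icc 0 1) ⊆ γ '' Icc 0 1 := by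
  rintro _ ⟨_, ⟨t, ht, rfl⟩, rfl⟩
  exact ⟨_, mem_Icc_div hk ht, h.piece k hk t ht⟩

theorem exists_floor {N : ℕ} (hN : 0 < N) {x : ℝ} (hx : x ∈ Icc (0 : ℝ) N) :
    ∃ i < N, ∃ t ∈ Icc (0 : ℝ) 1, x = i + t := by
  rcases hx.2.lt_or_eq with h1 | rfl
  · refine ⟨⌊x⌋₊, (Nat.floor_lt hx.1).2 h1, x - ⌊x⌋₊, ⟨?_, ?_⟩, by ring⟩
    · linarith [Nat.floor_le hx.1]
    · linarith [Nat.lt_floor_add_one x]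
  · refine ⟨N - 1, by omega, 1, ⟨zero_le_one, le_rfl⟩, ?_⟩
    rw [Nat.cast_pred hN]
    ring

theorem IsSelfSimilarArc.exists_mem_copy (h : IsSelfSimilarArc γ n l A B) {z : ℂ}
    (hz : z ∈ γ '' Icc 0 1) : ∃ k < n + 1, z ∈ copy (A k) (B k) (γ '' Icc 0 1) := by
  obtain ⟨x, hx, rfl⟩ := hz
  obtain ⟨k, hk, t, ht, hxt⟩ := exists_floor (N := n + 1) (x := x * (n + 1)) (by omega)
    ⟨by have := hx.1; positivity, by push_cast; nlinarith [hx.2, Nat.cast_nonneg (α := ℝ) n]⟩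
  refine ⟨k, hk, γ t, ⟨t, ht, rfl⟩, ?_⟩
  have hn : (n : ℝ) + 1 ≠ 0 := by positivity
  change A k * γ t + B k = γ x
  rw [← h.piece k hk t ht, ← hxt, mul_div_cancel_right₀ _ hn]

theorem IsSelfSimilarArc.arcVar_eq_sum (h : IsSelfSimilarArc γ n l A B) {z : ℂ}
    (hz : z ∉ γ '' Icc 0 1) :
    arcVar γ z = ∑ k ∈ Finset.range (n + 1), arcVar γ ((z - B k) / A k) := by
  have hn : (0 : ℝ) < n + 1 := by positivity
  have hmaps : MapsTo (fun x : ℝ => x / (n + 1)) (Icc 0 ((n + 1 : ℕ) : ℝ)) (Icc 0 1) := by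
    intro x hx
    push_cast at hx
    exact ⟨div_nonneg hx.1 hn.le, (div_le_one hn).2 hx.2⟩
  have h1 := logVar_eq_sum_arcVar (Γ := fun x => γ (x / (n + 1))) (N := n + 1) (a := A) (b := B)
    h.continuousOn (h.continuousOn.comp (by fun_prop) hmaps) h.A_ne (fun i hi t ht => h.piece i hi t ht)
    (z := z) (by rintro ⟨x, hx, rfl⟩; exact hz ⟨_, hmaps hx, rfl⟩)
  rw [← h1, arcVar]
  have e1 : ((n : ℝ) + 1)⁻¹ * ((n + 1 : ℕ) : ℝ) + 0 = 1 := by push_cast; field_simp; ring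
  have e0 : ((n : ℝ) + 1)⁻¹ * 0 + 0 = 0 := by ring
  have h2 := logVar_comp_affine (f := fun t => γ t - z) (a := 0) (b := ((n + 1 : ℕ) : ℝ))
    (m := ((n : ℝ) + 1)⁻¹) (k := 0) (by positivity) (by positivity)
    (by rw [e0, e1]; exact h.continuousOn.sub continuousOn_const)
    (by rw [e0, e1]; exact fun t ht h0 => hz ⟨t, ht, sub_eq_zero.1 h0⟩)
  rw [e0, e1] at h2
  rw [← h2]
  refine logVar_congr fun t _ => ?_
  rw [add_zero, inv_mul_eq_div]

/-- Near `p`, the set `X` is invariant under the homothety of centre `p` and ratio `l`. -/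
def LocInv (l : ℝ) (p : ℂ) (X : Set ℂ) : Prop := ∀ᶠ z in 𝓝 p, (p + l * (z - p) ∈ X ↔ z ∈ X)

theorem tendsto_homothety (l : ℝ) (p : ℂ) : Tendsto (fun z => p + l * (z - p)) (𝓝 p) (𝓝 p) := by
  have : Continuous fun z : ℂ => p + l * (z - p) := by fun_prop
  simpa using this.tendsto p

theorem locInv_of_notMem {l : ℝ} {p : ℂ} {X : Set ℂ} (hX : IsClosed X) (hp : p ∉ X) :
    LocInv l p X := by
  have h1 : ∀ᶠ z in 𝓝 p, z ∉ X := hX.isOpen_compl.mem_nhds hp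
  filter_upwards [h1, (tendsto_homothety l p).eventually h1] with z hz hz'
  exact iff_of_false hz' hz

theorem LocInv.copy {l : ℝ} {p : ℂ} {X : Set ℂ} (h : LocInv l p X) {a b : ℂ} (ha : a ≠ 0) :
    LocInv l (a * p + b) (copy a b X) := by
  have ht : Tendsto (fun z => (z - b) / a) (𝓝 (a * p + b)) (𝓝 p) := by
    have : Continuous fun z : ℂ => (z - b) / a := by fun_prop
    have := this.tendsto (a * p + b)
    rwa [add_sub_cancel_right, mul_div_cancel_left₀ _ ha] at this
  filter_upwards [ht.eventually h] with z hz
  rw [mem_copy ha, mem_copy ha, ← hz]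
  refine iff_of_eq (congrArg (· ∈ X) ?_)
  field_simp
  ring

theorem IsSelfSimilarArc.zero_notMem_copy (h : IsSelfSimilarArc γ n l A B) {k : ℕ}
    (hk : k < n + 1) (hk0 : k ≠ 0) : (0 : ℂ) ∉ copy (A k) (B k) (γ '' Icc 0 1) := by
  rintro ⟨_, ⟨t, ht, rfl⟩, hz⟩
  simp only at hz
  rw [← h.piece k hk t ht, ← h.zero] at hz
  have := h.injOn (mem_Icc_div hk ht) ⟨le_rfl, zero_le_one⟩ hz
  have hk' : (0 : ℝ) < k := by exact_mod_cast Nat.pos_of_ne_zero hk0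
  have ht0 := ht.1
  have : 0 < (k + t) / ((n : ℝ) + 1) := by positivity
  linarith

theorem IsSelfSimilarArc.one_notMem_copy (h : IsSelfSimilarArc γ n l A B) {k : ℕ} (hk : k < n) :
    (1 : ℂ) ∉ copy (A k) (B k) (γ '' Icc 0 1) := by
  have hk1 : k < n + 1 := by omega
  rintro ⟨_, ⟨t, ht, rfl⟩, hz⟩
  simp only at hz
  rw [← h.piece k hk1 t ht, ← h.one] at hz
  have := h.injOn (mem_Icc_div hk1 ht) ⟨zero_le_one, le_rfl⟩ hz
  have hk' : (k : ℝ) + 1 ≤ n := by exact_mod_cast hk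
  rw [div_eq_one_iff_eq (by positivity)] at this
  linarith [ht.2]

theorem eventually_notMem_copy {C : Set ℂ} (hC : IsCompact C) {a b p : ℂ} (hp : p ∉ copy a b C) :
    ∀ᶠ z in 𝓝 p, z ∉ copy a b C :=
  (isCompact_copy hC).isClosed.isOpen_compl.mem_nhds hp

/-- By injectivity only the first piece, the copy of ratio `l` about `0`, reaches a neighbourhood of
`0`. -/
theorem IsSelfSimilarArc.locInv_zero (h : IsSelfSimilarArc γ n l A B) :
    LocInv l 0 (γ '' Icc 0 1) := by
  have hl : (l : ℂ) ≠ 0 := by exact_mod_cast h.l_pos.ne'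
  have hev : ∀ᶠ z in 𝓝 (0 : ℂ), ∀ k ∈ Finset.range (n + 1), k ≠ 0 →
      z ∉ GKF.copy (A k) (B k) (γ '' Icc 0 1) := by
    rw [Filter.eventually_all_finset]
    intro k hk
    rw [Filter.eventually_imp_distrib_left]
    intro hk0
    exact eventually_notMem_copy h.isCompact (h.zero_notMem_copy (Finset.mem_range.1 hk) hk0)
  filter_upwards [(tendsto_homothety l 0).eventually hev] with z hz
  simp only [zero_add, sub_zero] at hz ⊢
  have hcopy : ∀ z, (l : ℂ) * z ∈ GKF.copy (A 0) (B 0) (γ '' Icc 0 1) ↔ z ∈ γ '' Icc 0 1 := by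
    intro z
    rw [mem_copy (h.A_ne 0 (by omega)), h.A_zero, h.B_zero, sub_zero, mul_div_cancel_left₀ _ hl]
  constructor
  · intro hm
    obtain ⟨k, hk, hmk⟩ := h.exists_mem_copy hm
    have : k = 0 := by
      by_contra hk0
      exact hz k (Finset.mem_range.2 hk) hk0 hmk
    subst this
    exact (hcopy z).1 hmk
  · intro hm
    exact h.copy_subset (by omega) ((hcopy z).2 hm)

theorem IsSelfSimilarArc.locInv_one (h : IsSelfSimilarArc γ n l A B) :
    LocInv l 1 (γ '' Icc 0 1) := by
  have hl : (l : ℂ) ≠ 0 := by exact_mod_cast h.l_pos.ne'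
  have hev : ∀ᶠ z in 𝓝 (1 : ℂ), ∀ k ∈ Finset.range n,
      z ∉ GKF.copy (A k) (B k) (γ '' Icc 0 1) := by
    rw [Filter.eventually_all_finset]
    intro k hk
    exact eventually_notMem_copy h.isCompact (h.one_notMem_copy (Finset.mem_range.1 hk))
  filter_upwards [(tendsto_homothety l 1).eventually hev] with z hz
  have hcopy : ∀ z, 1 + (l : ℂ) * (z - 1) ∈ GKF.copy (A n) (B n) (γ '' Icc 0 1)
      ↔ z ∈ γ '' Icc 0 1 := by
    intro z
    rw [mem_copy (h.A_ne n (by omega)), h.A_last, h.B_last,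
      show (1 + (l : ℂ) * (z - 1) - (1 - l)) = l * z by ring, mul_div_cancel_left₀ _ hl]
  constructor
  · intro hm
    obtain ⟨k, hk, hmk⟩ := h.exists_mem_copy hm
    have : k = n := by
      by_contra hkn
      exact hz k (Finset.mem_range.2 (by omega)) hmk
    subst this
    exact (hcopy z).1 hmk
  · intro hm
    exact h.copy_subset (by omega) ((hcopy z).2 hm)

/-- Near `p`, the function `F`, restricted to the complement of `K`, extends continuously to `K`. -/
def ExtendsAt (F : ℂ → ℂ) (K : Set ℂ) (p : ℂ) : Prop :=
  ∃ D : ℂ → ℂ, (∀ᶠ z in 𝓝 p, ContinuousAt D z) ∧ ∀ᶠ z in 𝓝 p, z ∉ K → F z = D z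

theorem ExtendsAt.sum {ι : Type*} {s : Finset ι} {F : ι → ℂ → ℂ} {K : Set ℂ} {p : ℂ}
    (h : ∀ i ∈ s, ExtendsAt (F i) K p) : ExtendsAt (fun z => ∑ i ∈ s, F i z) K p := by
  classical
  choose! D hD hFD using h
  refine ⟨fun z => ∑ i ∈ s, D i z, ?_, ?_⟩
  · filter_upwards [(Filter.eventually_all_finset s).2 hD] with z hz
    exact tendsto_finsetSum s fun i hi => hz i hi
  · filter_upwards [(Filter.eventually_all_finset s).2 hFD] with z hz hzK
    exact Finset.sum_congr rfl fun i hi => hz i hi hzK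

theorem ExtendsAt.mono {F : ℂ → ℂ} {K K' : Set ℂ} {p : ℂ} (h : ExtendsAt F K p) (hK : K ⊆ K') :
    ExtendsAt F K' p := by
  obtain ⟨D, hD, hFD⟩ := h
  exact ⟨D, hD, hFD.mono fun z hz hzK => hz fun h => hzK (hK h)⟩

theorem extendsAt_of_continuousAt {F : ℂ → ℂ} {K : Set ℂ} {p : ℂ}
    (h : ∀ᶠ z in 𝓝 p, ContinuousAt F z) : ExtendsAt F K p :=
  ⟨F, h, Eventually.of_forall fun _ _ => rfl⟩

theorem continuousAt_arcVar_div {a b z : ℂ} (hγ : ContinuousOn γ (Icc 0 1)) (ha : a ≠ 0)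
    (hz : z ∉ copy a b (γ '' Icc 0 1)) : ContinuousAt (fun z => arcVar γ ((z - b) / a)) z := by
  rw [mem_copy ha] at hz
  exact ContinuousAt.comp (f := fun z : ℂ => (z - b) / a) (continuousAt_arcVar hγ hz) (by fun_prop)

theorem eventually_continuousAt_arcVar_div {a b p : ℂ} (h : IsSelfSimilarArc γ n l A B) (ha : a ≠ 0)
    (hp : p ∉ copy a b (γ '' Icc 0 1)) :
    ∀ᶠ z in 𝓝 p, ContinuousAt (fun z => arcVar γ ((z - b) / a)) z := by
  filter_upwards [eventually_notMem_copy h.isCompact hp] with z hz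
  exact continuousAt_arcVar_div h.continuousOn ha hz

theorem eventually_comp_homothety {F : ℂ → ℂ} {l : ℝ} {p : ℂ} (h : ∀ᶠ z in 𝓝 p, ContinuousAt F z) :
    ∀ᶠ z in 𝓝 p, ContinuousAt (fun z => F (p + l * (z - p))) z := by
  filter_upwards [(tendsto_homothety l p).eventually h] with z hz
  exact ContinuousAt.comp (f := fun z : ℂ => p + l * (z - p)) hz (by fun_prop)

/-- Expand `arcVar γ (l * w)` over the pieces: the first term is `arcVar γ w` itself and cancels,
while the remaining pieces stay away from `0` and contribute continuously. -/
theorem IsSelfSimilarArc.extendsAt_zero (h : IsSelfSimilarArc γ n l A B) :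
    ExtendsAt (fun w => arcVar γ (0 + l * (w - 0)) - arcVar γ w) (γ '' Icc 0 1) 0 := by
  have hl : (l : ℂ) ≠ 0 := by exact_mod_cast h.l_pos.ne'
  refine ⟨fun w => ∑ k ∈ Finset.range n, arcVar γ (((0 + l * (w - 0)) - B (k + 1)) / A (k + 1)),
    ?_, ?_⟩
  · have : ∀ k ∈ Finset.range n, ∀ᶠ z in 𝓝 (0 : ℂ), ContinuousAt
        (fun w => arcVar γ (((0 + l * (w - 0)) - B (k + 1)) / A (k + 1))) z := fun k hk => by
      have hk := Finset.mem_range.1 hk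
      exact eventually_comp_homothety (F := fun z => arcVar γ ((z - B (k + 1)) / A (k + 1)))
        (eventually_continuousAt_arcVar_div h (h.A_ne _ (by omega))
          (h.zero_notMem_copy (by omega) (by omega)))
    filter_upwards [(Filter.eventually_all_finset _).2 this] with z hz
    exact tendsto_finsetSum _ fun i hi => hz i hi
  · filter_upwards [h.locInv_zero] with w hw hwC
    rw [h.arcVar_eq_sum (mt hw.1 hwC), Finset.sum_range_succ', h.A_zero, h.B_zero]
    simp [hl]

theorem IsSelfSimilarArc.extendsAt_one (h : IsSelfSimilarArc γ n l A B) :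
    ExtendsAt (fun w => arcVar γ (1 + l * (w - 1)) - arcVar γ w) (γ '' Icc 0 1) 1 := by
  have hl : (l : ℂ) ≠ 0 := by exact_mod_cast h.l_pos.ne'
  refine ⟨fun w => ∑ k ∈ Finset.range n, arcVar γ (((1 + l * (w - 1)) - B k) / A k), ?_, ?_⟩
  · have : ∀ k ∈ Finset.range n, ∀ᶠ z in 𝓝 (1 : ℂ), ContinuousAt
        (fun w => arcVar γ (((1 + l * (w - 1)) - B k) / A k)) z := fun k hk => by
      have hk := Finset.mem_range.1 hk
      exact eventually_comp_homothety (F := fun z => arcVar γ ((z - B k) / A k))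
        (eventually_continuousAt_arcVar_div h (h.A_ne _ (by omega)) (h.one_notMem_copy hk))
    filter_upwards [(Filter.eventually_all_finset _).2 this] with z hz
    exact tendsto_finsetSum _ fun i hi => hz i hi
  · filter_upwards [h.locInv_one] with w hw hwC
    rw [h.arcVar_eq_sum (mt hw.1 hwC), Finset.sum_range_succ, h.A_last, h.B_last,
      show (1 + (l : ℂ) * (w - 1) - (1 - l)) = l * w by ring, mul_div_cancel_left₀ _ hl]
    ring

theorem ExtendsAt.copy {F : ℂ → ℂ} {C : Set ℂ} {p : ℂ} (hF : ExtendsAt F C p) {a b : ℂ}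
    (ha : a ≠ 0) : ExtendsAt (fun z => F ((z - b) / a)) (copy a b C) (a * p + b) := by
  have hc : Continuous fun z : ℂ => (z - b) / a := by fun_prop
  have ht : Tendsto (fun z => (z - b) / a) (𝓝 (a * p + b)) (𝓝 p) := by
    have := hc.tendsto (a * p + b)
    rwa [add_sub_cancel_right, mul_div_cancel_left₀ _ ha] at this
  obtain ⟨D, hD, hFD⟩ := hF
  refine ⟨fun z => D ((z - b) / a), ?_, ?_⟩
  · filter_upwards [ht.eventually hD] with z hz
    exact ContinuousAt.comp (f := fun z : ℂ => (z - b) / a) hz hc.continuousAt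
  · filter_upwards [ht.eventually hFD] with z hz hzC
    exact hz (fun h => hzC ((mem_copy ha).2 h))

/-- At an endpoint of the copy this is the transported statement at `0` or `1`; off the copy both
terms are continuous. -/
theorem IsSelfSimilarArc.extendsAt_copy (h : IsSelfSimilarArc γ n l A B) {a b p : ℂ} (ha : a ≠ 0)
    (hp : p ∈ GKF.copy a b (γ '' Icc 0 1) → p = a * 0 + b ∨ p = a * 1 + b) :
    ExtendsAt (fun z => arcVar γ ((p + l * (z - p) - b) / a) - arcVar γ ((z - b) / a))
      (GKF.copy a b (γ '' Icc 0 1)) p := by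
  by_cases hpC : p ∈ GKF.copy a b (γ '' Icc 0 1)
  · rcases hp hpC with rfl | rfl
    · refine (h.extendsAt_zero.copy ha (b := b)).imp fun D hD => ⟨hD.1, hD.2.mono fun z hz hzC => ?_⟩
      have e : (a * 0 + b + l * (z - (a * 0 + b)) - b) / a = 0 + l * ((z - b) / a - 0) := by
        field_simp
        ring
      rw [← hz hzC]
      beta_reduce
      rw [e]
    · refine (h.extendsAt_one.copy ha (b := b)).imp fun D hD => ⟨hD.1, hD.2.mono fun z hz hzC => ?_⟩
      have e : (a * 1 + b + l * (z - (a * 1 + b)) - b) / a = 1 + l * ((z - b) / a - 1) := by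
        field_simp
        ring
      rw [← hz hzC]
      beta_reduce
      rw [e]
  · have h1 := eventually_continuousAt_arcVar_div h ha hpC
    refine extendsAt_of_continuousAt ?_
    filter_upwards [h1, eventually_comp_homothety (l := l) h1] with z hz hz'
    exact hz'.sub hz

end arc

/-! ### Local symmetries of a simple closed curve and its two sides -/

section sides
variable {Γ : ℝ → ℂ} {T : ℝ}

/-- If a map preserves the curve near a connected part of it and changes the winding number by a
function that is continuous across the curve, then it preserves the inside. -/
theorem IsSimpleLoop.preserves_inside (h : IsSimpleLoop Γ T) {Ω : Set ℂ}
    (hΩ : IsBoundedComponent Ω (Γ '' Icc 0 T)) {S U : Set ℂ} (hS : IsPreconnected S)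
    (hSK : S ⊆ Γ '' Icc 0 T) (hU : IsOpen U) (hSU : S ⊆ U) {φ D : ℂ → ℂ}
    (hD : ∀ z ∈ U, ContinuousAt D z) (hφ : ∀ z ∈ U, (φ z ∈ Γ '' Icc 0 T ↔ z ∈ Γ '' Icc 0 T))
    (hi : ∀ z ∈ U, z ∉ Γ '' Icc 0 T → index Γ T (φ z) - index Γ T z = D z) :
    ∀ p ∈ S, ∀ᶠ z in 𝓝 p, (φ z ∈ Ω ↔ z ∈ Ω) := by
  -- Off the curve this is integrality of the index; points of `Ω` accumulate at each point of the
  -- curve, so continuity of `D` extends it.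
  have hexp : ∀ z ∈ U, Complex.exp (D z) = 1 := by
    have hoff : ∀ z ∈ U, z ∉ Γ '' Icc 0 T → Complex.exp (D z) = 1 := fun z hz hzK => by
      rw [← hi z hz hzK, Complex.exp_sub, h.exp_index hzK, h.exp_index (mt (hφ z hz).1 hzK), div_one]
    intro z hz
    by_contra hne
    by_cases hzK : z ∈ Γ '' Icc 0 T
    · have hev : ∀ᶠ w in 𝓝 z, Complex.exp (D w) ≠ 1 ∧ w ∈ U :=
        ((Complex.continuous_exp.continuousAt.comp (hD z hz)).eventually_ne hne).and (hU.mem_nhds hz)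
      obtain ⟨V, hVsub, hV, hzV⟩ := eventually_nhds_iff.1 hev
      obtain ⟨w, hwV, hwΩ⟩ := (h.both_sides hΩ hzK hV hzV).1
      exact (hVsub w hwV).1 (hoff w (hVsub w hwV).2 (hΩ.subset hwΩ))
    · exact hne (hoff z hz hzK)
  intro p hp
  have hconst : ∀ q ∈ S, D q = D p := fun q hq =>
    eq_of_exp_eq_one hS (fun z hz => (hD z (hSU hz)).continuousWithinAt)
      (fun z hz => hexp z (hSU hz)) hq hp
  obtain ⟨ρ, hρ, hball⟩ := Metric.isOpen_iff.1 hU p (hSU hp)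
  have hb : ∀ z ∈ Metric.ball p ρ, D z = D p := fun z hz =>
    eq_of_exp_eq_one (convex_ball p ρ).isPreconnected
      (fun z hz => (hD z (hball hz)).continuousWithinAt) (fun z hz => hexp z (hball hz)) hz
      (Metric.mem_ball_self hρ)
  obtain ⟨⟨z, hzB, hzΩ⟩, w, hwB, hwΩ, hwK⟩ :=
    h.both_sides hΩ (hSK hp) Metric.isOpen_ball (Metric.mem_ball_self hρ)
  have hval : ∀ x, x ∉ Γ '' Icc 0 T → index Γ T x = 0 ∨ index Γ T x = index Γ T z := fun x hx => by
    by_cases hxΩ : x ∈ Ω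
    · exact Or.inr (h.index_eq_of_mem hΩ hxΩ hzΩ)
    · exact Or.inl (h.index_eq_zero hΩ hx hxΩ)
  have hz0 := h.index_ne_zero hΩ hzΩ
  have hw0 := h.index_eq_zero hΩ hwK hwΩ
  have e1 := hi z (hball hzB) (hΩ.subset hzΩ)
  have e2 := hi w (hball hwB) hwK
  rw [hb z hzB] at e1
  rw [hb w hwB, hw0, sub_zero] at e2
  -- The index takes only the values `0` and `ι ≠ 0`. The outside point `w` gives `D p ∈ {0, ι}`,
  -- and `D p = ι` would give the index `2ι` at the image of the inside point `z`.
  have hDp : D p = 0 := by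
    have h1 := hval (φ z) (mt (hφ z (hball hzB)).1 (hΩ.subset hzΩ))
    have h2 := hval (φ w) (mt (hφ w (hball hwB)).1 hwK)
    rcases h2 with h2 | h2
    · rw [← e2, h2]
    · rcases h1 with h1 | h1
      · exfalso
        rw [h1, ← e2, h2] at e1
        exact hz0 (by linear_combination (-1 / 2 : ℂ) * e1)
      · rw [← e1, h1, sub_self]
  filter_upwards [Metric.ball_mem_nhds p hρ] with x hx
  by_cases hxK : x ∈ Γ '' Icc 0 T
  · exact iff_of_false (fun h' => hΩ.subset h' ((hφ x (hball hx)).2 hxK))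
      (fun h' => hΩ.subset h' hxK)
  · have e3 := hi x (hball hx) hxK
    rw [hb x hx, hDp, sub_eq_zero] at e3
    have hφK := mt (hφ x (hball hx)).1 hxK
    constructor
    · intro h'
      by_contra hn
      exact h.index_ne_zero hΩ h' (e3.trans (h.index_eq_zero hΩ hxK hn))
    · intro h'
      by_contra hn
      exact h.index_ne_zero hΩ h' (e3.symm.trans (h.index_eq_zero hΩ hφK hn))

end sides

/-! ### The inside of a loop of arcs near its corners and near its open pieces -/

section
variable {γ : ℝ → ℂ} {n : ℕ} {l : ℝ} {A B : ℕ → ℂ} {N : ℕ} {a b : ℕ → ℂ} {Γ : ℝ → ℂ}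

/-- The points at which consecutive pieces of a loop meet. -/
def corners (Γ : ℝ → ℂ) (N : ℕ) : Set ℂ := (fun i : ℕ => Γ i) '' Iio N

theorem finite_corners : (corners Γ N).Finite := (finite_Iio N).image _

theorem IsLoopOfArcs.pos (h : IsLoopOfArcs γ N a b Γ) : 0 < N := by
  exact_mod_cast h.loop.pos

theorem add_mem_Icc_of_lt {i : ℕ} (hi : i < N) {t : ℝ} (ht : t ∈ Icc (0 : ℝ) 1) :
    (i + t) ∈ Icc (0 : ℝ) N := by
  have : (i : ℝ) + 1 ≤ N := by exact_mod_cast hi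
  have := ht.2
  exact ⟨add_nonneg (Nat.cast_nonneg i) ht.1, by linarith⟩

theorem IsLoopOfArcs.mem_iff (h : IsLoopOfArcs γ N a b Γ) {z : ℂ} :
    z ∈ Γ '' Icc 0 N ↔ ∃ i < N, z ∈ copy (a i) (b i) (γ '' Icc 0 1) := by
  constructor
  · rintro ⟨x, hx, rfl⟩
    obtain ⟨i, hi, t, ht, rfl⟩ := exists_floor h.pos hx
    exact ⟨i, hi, γ t, ⟨t, ht, rfl⟩, (h.piece i hi t ht).symm⟩
  · rintro ⟨i, hi, _, ⟨t, ht, rfl⟩, rfl⟩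
    exact ⟨i + t, add_mem_Icc_of_lt hi ht, h.piece i hi t ht⟩

/-- A corner has an integer parameter, so by simplicity a piece can contain it only as an end. -/
theorem IsLoopOfArcs.eq_endpoint (h : IsLoopOfArcs γ N a b Γ) (hγ : IsSelfSimilarArc γ n l A B)
    {p : ℂ} (hp : p ∈ corners Γ N) {i : ℕ} (hi : i < N)
    (hpi : p ∈ copy (a i) (b i) (γ '' Icc 0 1)) : p = a i * 0 + b i ∨ p = a i * 1 + b i := by
  obtain ⟨m, hm, rfl⟩ := hp
  obtain ⟨_, ⟨t, ht, rfl⟩, hpt⟩ := hpi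
  have hm : m < N := hm
  have hmN : (m : ℝ) < N := by exact_mod_cast hm
  have hiN : (i : ℝ) + 1 ≤ N := by exact_mod_cast hi
  have hpt : Γ m = a i * γ t + b i := hpt.symm
  have hpt' := hpt
  rw [← h.piece i hi t ht] at hpt'
  have ht01 : t = 0 ∨ t = 1 := by
    rcases h.loop.eq_or ⟨Nat.cast_nonneg m, hmN.le⟩ (add_mem_Icc_of_lt hi ht) hpt' with
      h1 | ⟨_, h1⟩ | ⟨h1, _⟩
    · rcases le_or_gt m i with h2 | h2
      · have : (m : ℝ) ≤ i := by exact_mod_cast h2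
        exact Or.inl (by linarith [ht.1])
      · have : (i : ℝ) + 1 ≤ m := by exact_mod_cast h2
        exact Or.inr (by linarith [ht.2])
    · exact Or.inr (by linarith [ht.2])
    · exact absurd h1 hmN.ne
  change Γ m = _ ∨ Γ m = _
  rw [hpt]
  rcases ht01 with rfl | rfl
  · left; rw [hγ.zero]
  · right; rw [hγ.one]

theorem IsLoopOfArcs.notMem_copy (h : IsLoopOfArcs γ N a b Γ) {i j : ℕ} (hi : i < N) (hj : j < N)
    (hij : j ≠ i) {t : ℝ} (ht : t ∈ Ioo (0 : ℝ) 1) :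
    a i * γ t + b i ∉ copy (a j) (b j) (γ '' Icc 0 1) := by
  rintro ⟨_, ⟨t', ht', rfl⟩, hz⟩
  have hz : a j * γ t' + b j = a i * γ t + b i := hz
  have hiN : (i : ℝ) + 1 ≤ N := by exact_mod_cast hi
  have hi0 : (0 : ℝ) ≤ i := Nat.cast_nonneg i
  rw [← h.piece i hi t (Ioo_subset_Icc_self ht), ← h.piece j hj t' ht'] at hz
  have := ht.1
  have := ht.2
  have := ht'.1
  have := ht'.2
  rcases h.loop.eq_or (add_mem_Icc_of_lt hj ht') (add_mem_Icc_of_lt hi (Ioo_subset_Icc_self ht)) hz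
    with h1 | ⟨_, h1⟩ | ⟨_, h1⟩
  · rcases lt_or_gt_of_ne hij with h2 | h2
    · have : (j : ℝ) + 1 ≤ i := by exact_mod_cast h2
      linarith
    · have : (i : ℝ) + 1 ≤ j := by exact_mod_cast h2
      linarith
  · linarith
  · linarith

theorem IsLoopOfArcs.exists_interior (h : IsLoopOfArcs γ N a b Γ) {x : ℂ} (hx : x ∈ Γ '' Icc 0 N)
    (hxc : x ∉ corners Γ N) : ∃ i < N, ∃ t ∈ Ioo (0 : ℝ) 1, x = a i * γ t + b i := by
  obtain ⟨y, hy, rfl⟩ := hx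
  obtain ⟨i, hi, t, ht, rfl⟩ := exists_floor h.pos hy
  refine ⟨i, hi, t, ⟨lt_of_le_of_ne ht.1 ?_, lt_of_le_of_ne ht.2 ?_⟩, h.piece i hi t ht⟩
  · rintro rfl
    exact hxc ⟨i, hi, by simp⟩
  · rintro rfl
    rcases (Nat.succ_le_of_lt hi).lt_or_eq with h1 | h1
    · exact hxc ⟨i + 1, h1, by simp⟩
    · have : (i : ℝ) + 1 = N := by exact_mod_cast h1
      exact hxc ⟨0, h.pos, by simp only [Nat.cast_zero]; rw [this, h.loop.closed]⟩

theorem LocInv.biUnion {p : ℂ} {ι : Type*} {s : Finset ι} {X : ι → Set ℂ}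
    (h : ∀ i ∈ s, LocInv l p (X i)) : LocInv l p {z | ∃ i ∈ s, z ∈ X i} := by
  filter_upwards [(Filter.eventually_all_finset s).2 h] with z hz
  exact ⟨fun ⟨i, hi, hm⟩ => ⟨i, hi, (hz i hi).1 hm⟩, fun ⟨i, hi, hm⟩ => ⟨i, hi, (hz i hi).2 hm⟩⟩

theorem IsLoopOfArcs.locInv_copy (h : IsLoopOfArcs γ N a b Γ) (hγ : IsSelfSimilarArc γ n l A B)
    {p : ℂ} (hp : p ∈ corners Γ N) {i : ℕ} (hi : i < N) :
    LocInv l p (copy (a i) (b i) (γ '' Icc 0 1)) := by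
  by_cases hpi : p ∈ copy (a i) (b i) (γ '' Icc 0 1)
  · rcases h.eq_endpoint hγ hp hi hpi with rfl | rfl
    · exact hγ.locInv_zero.copy (h.ne_zero i hi)
    · exact hγ.locInv_one.copy (h.ne_zero i hi)
  · exact locInv_of_notMem (isCompact_copy hγ.isCompact).isClosed hpi

theorem IsLoopOfArcs.locInv_curve (h : IsLoopOfArcs γ N a b Γ) (hγ : IsSelfSimilarArc γ n l A B)
    {p : ℂ} (hp : p ∈ corners Γ N) : LocInv l p (Γ '' Icc 0 N) := by
  have : Γ '' Icc 0 N = {z | ∃ i ∈ Finset.range N, z ∈ copy (a i) (b i) (γ '' Icc 0 1)} := by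
    ext z
    simp [h.mem_iff]
  rw [this]
  exact LocInv.biUnion fun i hi => h.locInv_copy hγ hp (Finset.mem_range.1 hi)

theorem IsLoopOfArcs.index_eq_sum (h : IsLoopOfArcs γ N a b Γ) (hγ : IsSelfSimilarArc γ n l A B)
    {z : ℂ} (hz : z ∉ Γ '' Icc 0 N) :
    index Γ N z = ∑ i ∈ Finset.range N, arcVar γ ((z - b i) / a i) :=
  logVar_eq_sum_arcVar hγ.continuousOn h.loop.continuousOn h.ne_zero h.piece hz

theorem corners_subset : corners Γ N ⊆ Γ '' Icc 0 N := by
  intro p hp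
  obtain ⟨m, hm, rfl⟩ := hp
  exact ⟨m, ⟨Nat.cast_nonneg m, by exact_mod_cast (le_of_lt hm)⟩, rfl⟩

/-- The homothety preserves the curve near the corner, and each piece changes the index by a
function extending continuously across it. -/
theorem IsLoopOfArcs.locInv_inside (h : IsLoopOfArcs γ N a b Γ) (hγ : IsSelfSimilarArc γ n l A B)
    {Ω : Set ℂ} (hΩ : IsBoundedComponent Ω (Γ '' Icc 0 N)) {p : ℂ} (hp : p ∈ corners Γ N) :
    LocInv l p Ω := by
  have hK := h.locInv_curve hγ hp
  obtain ⟨D, hD, hFD⟩ : ExtendsAt (fun z => ∑ i ∈ Finset.range N,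
      (arcVar γ ((p + l * (z - p) - b i) / a i) - arcVar γ ((z - b i) / a i)))
      (Γ '' Icc 0 N) p := by
    refine ExtendsAt.sum fun i hi => ?_
    have hi := Finset.mem_range.1 hi
    exact (hγ.extendsAt_copy (h.ne_zero i hi) (h.eq_endpoint hγ hp hi)).mono
      fun z hz => h.mem_iff.2 ⟨i, hi, hz⟩
  obtain ⟨U, hU, hUo, hpU⟩ := eventually_nhds_iff.1 ((hD.and hFD).and hK)
  refine h.loop.preserves_inside hΩ (S := {p}) isPreconnected_singleton
    (singleton_subset_iff.2 (corners_subset hp)) hUo (singleton_subset_iff.2 hpU)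
    (φ := fun z => p + l * (z - p)) (D := D) (fun z hz => (hU z hz).1.1) (fun z hz => (hU z hz).2)
    (fun z hz hzK => ?_) p rfl
  rw [← (hU z hz).1.2 hzK, h.index_eq_sum hγ hzK, h.index_eq_sum hγ (mt (hU z hz).2.1 hzK),
    ← Finset.sum_sub_distrib]

/-- Piece `0` of `Γ'` is `γ` itself. Under `w ↦ a i * w + b i` the term of piece `i` in the index at
the image equals the term of piece `0` in the index at `w`. After cancellation only pieces away from
the open arc remain, and these are continuous. `Γ` may be a finer cut of the same curve. -/
theorem IsLoopOfArcs.piece_preserves_inside {N' : ℕ} {a' b' : ℕ → ℂ} {Γ' : ℝ → ℂ}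
    (h : IsLoopOfArcs γ N a b Γ) (h' : IsLoopOfArcs γ N' a' b' Γ') (hγ : IsSelfSimilarArc γ n l A B)
    (ha' : a' 0 = 1) (hb' : b' 0 = 0) (hK : Γ '' Icc 0 N = Γ' '' Icc 0 N')
    (hidx : ∀ z, z ∉ Γ' '' Icc 0 N' → index Γ N z = index Γ' N' z) {Ω : Set ℂ}
    (hΩ : IsBoundedComponent Ω (Γ' '' Icc 0 N')) {i : ℕ} (hi : i < N) {t : ℝ}
    (ht : t ∈ Ioo (0 : ℝ) 1) : ∀ᶠ w in 𝓝 (γ t), (a i * w + b i ∈ Ω ↔ w ∈ Ω) := by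
  have hai := h.ne_zero i hi
  have hφ : Continuous fun w : ℂ => a i * w + b i := by fun_prop
  set U : Set ℂ := (⋂ k ∈ (Finset.range N).erase i,
      (fun w => a i * w + b i) ⁻¹' (copy (a k) (b k) (γ '' Icc 0 1))ᶜ) ∩
    ⋂ j ∈ (Finset.range N').erase 0, (copy (a' j) (b' j) (γ '' Icc 0 1))ᶜ with hUdef
  have hUo : IsOpen U := by
    refine IsOpen.inter ?_ ?_
    · exact isOpen_biInter_finset fun k _ =>
        (isCompact_copy hγ.isCompact).isClosed.isOpen_compl.preimage hφ
    · exact isOpen_biInter_finset fun k _ => (isCompact_copy hγ.isCompact).isClosed.isOpen_compl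
  have hU1 : ∀ w ∈ U, ∀ k < N, k ≠ i → a i * w + b i ∉ copy (a k) (b k) (γ '' Icc 0 1) := by
    intro w hw k hk hki
    exact mem_iInter₂.1 hw.1 k (Finset.mem_erase.2 ⟨hki, Finset.mem_range.2 hk⟩)
  have hU2 : ∀ w ∈ U, ∀ j < N', j ≠ 0 → w ∉ copy (a' j) (b' j) (γ '' Icc 0 1) := by
    intro w hw j hj hj0
    exact mem_iInter₂.1 hw.2 j (Finset.mem_erase.2 ⟨hj0, Finset.mem_range.2 hj⟩)
  have hC0 : ∀ w, w ∈ copy (a' 0) (b' 0) (γ '' Icc 0 1) ↔ w ∈ γ '' Icc 0 1 := fun w => by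
    rw [ha', hb', mem_copy one_ne_zero, sub_zero, div_one]
  have hCi : ∀ w, a i * w + b i ∈ copy (a i) (b i) (γ '' Icc 0 1) ↔ w ∈ γ '' Icc 0 1 := fun w => by
    rw [mem_copy hai, add_sub_cancel_right, mul_div_cancel_left₀ _ hai]
  have hwK : ∀ w ∈ U, (w ∈ Γ' '' Icc 0 N' ↔ w ∈ γ '' Icc 0 1) := by
    intro w hw
    rw [h'.mem_iff, ← hC0 w]
    refine ⟨fun ⟨j, hj, hm⟩ => ?_, fun hm => ⟨0, h'.pos, hm⟩⟩
    by_cases hj0 : j = 0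
    · rwa [hj0] at hm
    · exact absurd hm (hU2 w hw j hj hj0)
  have hφK : ∀ w ∈ U, (a i * w + b i ∈ Γ' '' Icc 0 N' ↔ w ∈ γ '' Icc 0 1) := by
    intro w hw
    rw [← hK, h.mem_iff, ← hCi w]
    refine ⟨fun ⟨k, hk, hm⟩ => ?_, fun hm => ⟨i, hi, hm⟩⟩
    by_cases hki : k = i
    · rwa [hki] at hm
    · exact absurd hm (hU1 w hw k hk hki)
  have hSU : γ '' Ioo 0 1 ⊆ U := by
    rintro _ ⟨s, hs, rfl⟩
    refine ⟨mem_iInter₂.2 fun k hk => ?_, mem_iInter₂.2 fun j hj => ?_⟩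
    · exact h.notMem_copy hi (Finset.mem_range.1 (Finset.mem_erase.1 hk).2)
        (Finset.mem_erase.1 hk).1 hs
    · have := h'.notMem_copy h'.pos (Finset.mem_range.1 (Finset.mem_erase.1 hj).2)
        (Finset.mem_erase.1 hj).1 hs
      rwa [ha', hb', one_mul, add_zero] at this
  refine h'.loop.preserves_inside hΩ (S := γ '' Ioo 0 1)
    (isPreconnected_Ioo.image _ (hγ.continuousOn.mono Ioo_subset_Icc_self))
    (fun w hw => (hwK w (hSU hw)).2 (image_mono Ioo_subset_Icc_self hw)) hUo hSU
    (φ := fun w => a i * w + b i)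
    (D := fun w => ∑ k ∈ (Finset.range N).erase i, arcVar γ ((a i * w + b i - b k) / a k) -
      ∑ j ∈ (Finset.range N').erase 0, arcVar γ ((w - b' j) / a' j))
    (fun w hw => ?_) (fun w hw => (hφK w hw).trans (hwK w hw).symm) (fun w hw hwn => ?_) (γ t)
    ⟨t, ht, rfl⟩
  · refine ContinuousAt.sub (tendsto_finsetSum _ fun k hk => ?_) (tendsto_finsetSum _ fun j hj => ?_)
    · obtain ⟨hki, hk⟩ := Finset.mem_erase.1 hk
      have hk := Finset.mem_range.1 hk
      exact ContinuousAt.comp (f := fun w => a i * w + b i)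
        (continuousAt_arcVar_div hγ.continuousOn (h.ne_zero k hk) (hU1 w hw k hk hki))
        hφ.continuousAt
    · obtain ⟨hj0, hj⟩ := Finset.mem_erase.1 hj
      have hj := Finset.mem_range.1 hj
      exact continuousAt_arcVar_div hγ.continuousOn (h'.ne_zero j hj) (hU2 w hw j hj hj0)
  · have hφn : a i * w + b i ∉ Γ' '' Icc 0 N' := by rwa [hφK w hw, ← hwK w hw]
    rw [← hidx _ hφn, h.index_eq_sum hγ (by rwa [hK]), h'.index_eq_sum hγ hwn,
      ← Finset.add_sum_erase _ _ (Finset.mem_range.2 hi),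
      ← Finset.add_sum_erase (Finset.range N') _ (Finset.mem_range.2 h'.pos), ha', hb', sub_zero,
      div_one, add_sub_cancel_right, mul_div_cancel_left₀ _ hai]
    ring

theorem IsLoopOfArcs.inside_eq_copy_near {N' : ℕ} {a' b' : ℕ → ℂ} {Γ' : ℝ → ℂ}
    (h : IsLoopOfArcs γ N a b Γ) (h' : IsLoopOfArcs γ N' a' b' Γ') (hγ : IsSelfSimilarArc γ n l A B)
    (ha' : a' 0 = 1) (hb' : b' 0 = 0) (hK : Γ '' Icc 0 N = Γ' '' Icc 0 N')
    (hidx : ∀ z, z ∉ Γ' '' Icc 0 N' → index Γ N z = index Γ' N' z) {Ω : Set ℂ}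
    (hΩ : IsBoundedComponent Ω (Γ' '' Icc 0 N')) {x : ℂ} (hx : x ∈ Γ '' Icc 0 N)
    (hxc : x ∉ corners Γ N) :
    ∃ i < N, (∀ᶠ z in 𝓝 x, (z ∈ Ω ↔ z ∈ copy (a i) (b i) Ω)) ∧
      ∀ j < N, j ≠ i → x ∉ copy (a j) (b j) (γ '' Icc 0 1) := by
  obtain ⟨i, hi, t, ht, rfl⟩ := h.exists_interior hx hxc
  have hai := h.ne_zero i hi
  refine ⟨i, hi, ?_, fun j hj hji => h.notMem_copy hi hj hji ht⟩
  have hc : Continuous fun z : ℂ => (z - b i) / a i := by fun_prop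
  have htend : Tendsto (fun z => (z - b i) / a i) (𝓝 (a i * γ t + b i)) (𝓝 (γ t)) := by
    have := hc.tendsto (a i * γ t + b i)
    rwa [add_sub_cancel_right, mul_div_cancel_left₀ _ hai] at this
  filter_upwards [htend.eventually
    (h.piece_preserves_inside h' hγ ha' hb' hK hidx hΩ hi ht)] with z hz
  rw [mem_copy hai, ← hz, mul_div_cancel₀ _ hai, sub_add_cancel]

end

/-! ### Tubes near corners -/

theorem eventually_notMem_thickening {X : Set ℂ} (hX : IsClosed X) {x : ℂ} (hx : x ∉ X) :
    ∀ᶠ q : ℝ × ℂ in 𝓝 (0, x), q.2 ∉ Metric.thickening q.1 X := by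
  obtain ⟨ρ, hρ, hball⟩ := Metric.isOpen_iff.1 hX.isOpen_compl x hx
  have h1 : ∀ᶠ q : ℝ × ℂ in 𝓝 (0, x), q.1 < ρ / 2 ∧ dist q.2 x < ρ / 2 :=
    ((continuous_fst.tendsto ((0 : ℝ), x)).eventually (gt_mem_nhds (half_pos hρ))).and
      ((continuous_snd.tendsto ((0 : ℝ), x)).eventually (Metric.ball_mem_nhds x (half_pos hρ)))
  filter_upwards [h1] with q hq hmem
  obtain ⟨y, hy, hd⟩ := Metric.mem_thickening_iff.1 hmem
  have := dist_triangle_left y x q.2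
  exact hball (show y ∈ Metric.ball x ρ from Metric.mem_ball.2 (by linarith [hq.1, hq.2])) hy

theorem homothety_dist {l : ℝ} (hl : 0 < l) (p z w : ℂ) :
    dist (p + l * (z - p)) (p + l * (w - p)) = l * dist z w := by
  rw [dist_add_left, dist_eq_norm, ← mul_sub, norm_mul, sub_sub_sub_cancel_right, Complex.norm_real,
    Real.norm_of_nonneg hl.le, dist_eq_norm]

theorem homothety_surj {l : ℝ} (hl : 0 < l) (p y : ℂ) : ∃ w, y = p + l * (w - p) := by
  have hl' : (l : ℂ) ≠ 0 := by exact_mod_cast hl.ne'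
  exact ⟨p + (y - p) / l, by field_simp; ring⟩

theorem tendsto_scale_prod (l : ℝ) (p : ℂ) :
    Tendsto (fun q : ℝ × ℂ => (l * q.1, p + l * (q.2 - p))) (𝓝 (0, p)) (𝓝 (0, p)) := by
  have : Continuous fun q : ℝ × ℂ => (l * q.1, p + l * (q.2 - p)) := by fun_prop
  simpa using this.tendsto (0, p)

/-- Points within `q.1` of `q.2` remain in the neighbourhood where `X` is invariant, and the
homothety scales distances by `l`. -/
theorem LocInv.thickening {l : ℝ} (hl : 0 < l) {p : ℂ} {X : Set ℂ}
    (h : LocInv l p X) : ∀ᶠ q : ℝ × ℂ in 𝓝 (0, p),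
      (p + l * (q.2 - p) ∈ Metric.thickening (l * q.1) X ↔ q.2 ∈ Metric.thickening q.1 X) := by
  obtain ⟨ρ, hρ, hball⟩ := Metric.eventually_nhds_iff.1 h
  have h1 : ∀ᶠ q : ℝ × ℂ in 𝓝 (0, p), q.1 < ρ / 2 ∧ dist q.2 p < ρ / 2 :=
    ((continuous_fst.tendsto ((0 : ℝ), p)).eventually (gt_mem_nhds (half_pos hρ))).and
      ((continuous_snd.tendsto ((0 : ℝ), p)).eventually (Metric.ball_mem_nhds p (half_pos hρ)))
  filter_upwards [h1] with q hq
  have key : ∀ w, dist q.2 w < q.1 → dist w p < ρ := fun w hw => by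
    have := dist_triangle_left w p q.2
    linarith [hq.1, hq.2]
  constructor
  · intro hm
    obtain ⟨y, hy, hd⟩ := Metric.mem_thickening_iff.1 hm
    obtain ⟨w, rfl⟩ := homothety_surj hl p y
    rw [homothety_dist hl] at hd
    have hd' := lt_of_mul_lt_mul_left hd hl.le
    exact Metric.mem_thickening_iff.2 ⟨w, (hball (key w hd')).1 hy, hd'⟩
  · intro hm
    obtain ⟨w, hw, hd⟩ := Metric.mem_thickening_iff.1 hm
    refine Metric.mem_thickening_iff.2 ⟨_, (hball (key w hd)).2 hw, ?_⟩
    rw [homothety_dist hl]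
    exact mul_lt_mul_of_pos_left hd hl

/-- The indicator function of the part of the `ε`-tube of `X` in `Ω`. -/
def tubeInd (X Ω : Set ℂ) (ε : ℝ) : ℂ → ℝ := (Metric.thickening ε X ∩ Ω).indicator 1

theorem tubeInd_eq_zero {X Ω : Set ℂ} {ε : ℝ} {z : ℂ} (h : z ∉ Metric.thickening ε X) :
    tubeInd X Ω ε z = 0 := indicator_of_notMem (fun h' => h h'.1) _

theorem tubeInd_congr {X Y Ω Ω' : Set ℂ} {ε ε' : ℝ} {z z' : ℂ}
    (h : z ∈ Metric.thickening ε X ↔ z' ∈ Metric.thickening ε' Y) (h' : z ∈ Ω ↔ z' ∈ Ω') :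
    tubeInd X Ω ε z = tubeInd Y Ω' ε' z' := by
  classical
  simp only [tubeInd, indicator_apply, mem_inter_iff, h, h', Pi.one_apply]

theorem tubeInd_integrable {X Ω : Set ℂ} (hX : IsCompact X) (hΩ : IsOpen Ω) (ε : ℝ) :
    Integrable (tubeInd X Ω ε) ∧ ∫ z, tubeInd X Ω ε z = tubeFun X Ω ε := by
  have hm : MeasurableSet (Metric.thickening ε X ∩ Ω) :=
    (Metric.isOpen_thickening.inter hΩ).measurableSet
  have hfin : volume (Metric.thickening ε X ∩ Ω) < ⊤ :=
    (hX.isBounded.thickening.subset inter_subset_left).measure_lt_top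
  refine ⟨(integrable_indicator_iff hm).2 (integrableOn_const hfin.ne), ?_⟩
  rw [tubeInd, integral_indicator_one hm, tubeFun, Measure.real]

theorem integral_comp_homothety {l : ℝ} (hl : 0 < l) (p : ℂ) (f : ℂ → ℝ) :
    ∫ z, f z = l ^ 2 * ∫ z, f (p + l * (z - p)) := by
  have h1 : ∫ z, f (p + l * (z - p)) = ∫ z, f (p + l • z) := by
    rw [← integral_sub_right_eq_self (fun z => f (p + l • z)) p]
    simp only [Complex.real_smul]
  rw [h1, Measure.integral_comp_smul volume (fun z => f (p + z)) l, Complex.finrank_real_complex,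
    integral_add_left_eq_self (fun z => f z) p, smul_eq_mul, abs_of_pos (by positivity)]
  field_simp

/-- A function family that vanishes near all points outside a finite set and is self-similar near the
points of this finite set has a self-similar integral. -/
theorem integral_scale_of_corners {u : ℝ → ℂ → ℝ} (hu : ∀ ε, Integrable (u ε)) {R : ℝ}
    (hR : ∀ ε < 1, ∀ z, R ≤ ‖z‖ → u ε z = 0) {P : Set ℂ} (hP : P.Finite) {l : ℝ} (hl : 0 < l)
    (hl1 : l < 1) (haway : ∀ x ∉ P, ∀ᶠ q : ℝ × ℂ in 𝓝 (0, x), u q.1 q.2 = 0)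
    (hcorner : ∀ p ∈ P, ∀ᶠ q : ℝ × ℂ in 𝓝 (0, p), u (l * q.1) (p + l * (q.2 - p)) = u q.1 q.2) :
    ∀ᶠ ε in 𝓝 (0 : ℝ), ∫ z, u (l * ε) z = l ^ 2 * ∫ z, u ε z := by
  classical
  obtain ⟨ρ, hρ, hρdisj, hρc⟩ : ∃ ρ > 0, P.PairwiseDisjoint (fun p => Metric.ball p ρ) ∧
      ∀ p ∈ P, ∀ᶠ ε in 𝓝 (0 : ℝ), ∀ z ∈ Metric.ball p ρ,
        u (l * ε) (p + l * (z - p)) = u ε z := by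
    have h1 : ∀ᶠ ρ in 𝓝[>] (0 : ℝ), P.PairwiseDisjoint (fun p => Metric.ball p ρ) := by
      have h2 : ∀ p ∈ P, ∀ᶠ ρ in 𝓝[>] (0 : ℝ), ∀ q ∈ P, p ≠ q →
          Disjoint (Metric.ball p ρ) (Metric.ball q ρ) := by
        intro p _
        refine (Filter.eventually_all_finite hP).2 fun q _ => ?_
        by_cases hpq : p = q
        · exact Eventually.of_forall fun _ h => absurd hpq h
        · have hd : 0 < dist p q / 2 := half_pos (dist_pos.2 hpq)
          filter_upwards [nhdsWithin_le_nhds (gt_mem_nhds hd)] with ρ hρ _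
          exact Metric.ball_disjoint_ball (by linarith)
      filter_upwards [(Filter.eventually_all_finite hP).2 h2] with ρ hρ p hp q hq hpq
      exact hρ p hp q hq hpq
    have h3 : ∀ p ∈ P, ∀ᶠ ρ in 𝓝[>] (0 : ℝ), ∀ᶠ ε in 𝓝 (0 : ℝ), ∀ z ∈ Metric.ball p ρ,
        u (l * ε) (p + l * (z - p)) = u ε z := by
      intro p hp
      obtain ⟨η, hη, hball⟩ := Metric.eventually_nhds_iff.1 (hcorner p hp)
      filter_upwards [nhdsWithin_le_nhds (gt_mem_nhds hη)] with ρ hρ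
      filter_upwards [Metric.ball_mem_nhds (0 : ℝ) hη] with ε hε z hz
      refine hball (y := (ε, z)) ?_
      rw [Prod.dist_eq]
      exact max_lt hε ((Metric.mem_ball.1 hz).trans hρ)
    obtain ⟨ρ, h4, h5, h6⟩ :=
      (h1.and (((Filter.eventually_all_finite hP).2 h3).and self_mem_nhdsWithin)).exists
    exact ⟨ρ, h6, h4, h5⟩
  have hlρ : l * ρ < ρ := by nlinarith
  -- On this compact set `u ε` vanishes for small `ε`, so its support lies in the balls of radius `l
  -- * ρ`. Splitting `u ε` with radius `ρ` and `u (l * ε)` with radius `l * ρ` matches the integrals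
  -- under the homotheties.
  set Q := Metric.closedBall (0 : ℂ) R \ ⋃ p ∈ P, Metric.ball p (l * ρ)
  have hQ : IsCompact Q := (isCompact_closedBall _ _).diff
    (isOpen_biUnion fun _ _ => Metric.isOpen_ball)
  have hQ0 : ∀ᶠ ε in 𝓝 (0 : ℝ), ∀ z ∈ Q, u ε z = 0 := by
    refine hQ.eventually_forall_of_forall_eventually fun z hz => haway z fun hzP => hz.2 ?_
    exact mem_iUnion₂.2 ⟨z, hzP, Metric.mem_ball_self (by positivity)⟩
  have hsupp : ∀ᶠ ε in 𝓝 (0 : ℝ), ∀ z, u ε z ≠ 0 → ∃ p ∈ P, z ∈ Metric.ball p (l * ρ) := by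
    filter_upwards [hQ0, gt_mem_nhds one_pos] with ε h1 h2 z hz
    by_contra! hcon
    refine hz (h1 z ⟨?_, ?_⟩)
    · rw [mem_closedBall_zero_iff]
      by_contra! h3
      exact hz (hR ε h2 z h3.le)
    · simpa using hcon
  have hdecomp : ∀ σ, 0 < σ → σ ≤ ρ → ∀ ε, (∀ z, u ε z ≠ 0 → ∃ p ∈ P, z ∈ Metric.ball p σ) →
      ∫ z, u ε z = ∑ p ∈ hP.toFinset, ∫ z, (Metric.ball p σ).indicator (u ε) z := by
    intro σ _ hσρ ε hs
    rw [← integral_finsetSum _ fun p _ => (hu ε).indicator Metric.isOpen_ball.measurableSet]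
    congr 1
    ext z
    by_cases hz : ∃ p ∈ P, z ∈ Metric.ball p σ
    · obtain ⟨p, hp, hzp⟩ := hz
      rw [Finset.sum_eq_single_of_mem p (hP.mem_toFinset.2 hp), indicator_of_mem hzp]
      intro q hq hqp
      refine indicator_of_notMem (fun hzq => ?_) _
      exact (hρdisj (hP.mem_toFinset.1 hq) hp hqp).le_bot
        ⟨Metric.ball_subset_ball hσρ hzq, Metric.ball_subset_ball hσρ hzp⟩
    · have h0 : u ε z = 0 := by
        by_contra h0
        exact hz (hs z h0)
      rw [h0]
      refine (Finset.sum_eq_zero fun p _ => ?_).symm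
      by_cases hzp : z ∈ Metric.ball p σ
      · rw [indicator_of_mem hzp, h0]
      · rw [indicator_of_notMem hzp]
  have htl : Tendsto (fun ε => l * ε) (𝓝 (0 : ℝ)) (𝓝 0) := by
    have : Continuous fun ε : ℝ => l * ε := by fun_prop
    simpa using this.tendsto 0
  filter_upwards [hsupp, htl.eventually hsupp, (Filter.eventually_all_finite hP).2 hρc]
    with ε h1 h2 h3
  have h1' : ∀ z, u ε z ≠ 0 → ∃ p ∈ P, z ∈ Metric.ball p ρ := fun z hz => by
    obtain ⟨p, hp, hzp⟩ := h1 z hz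
    exact ⟨p, hp, Metric.ball_subset_ball hlρ.le hzp⟩
  rw [hdecomp ρ hρ le_rfl ε h1', hdecomp (l * ρ) (by positivity) hlρ.le (l * ε) h2, Finset.mul_sum]
  refine Finset.sum_congr rfl fun p hp => ?_
  rw [integral_comp_homothety hl p]
  congr 2
  ext z
  have hmem : p + l * (z - p) ∈ Metric.ball p (l * ρ) ↔ z ∈ Metric.ball p ρ := by
    have h4 := homothety_dist hl p z p
    rw [sub_self, mul_zero, add_zero] at h4
    rw [Metric.mem_ball, Metric.mem_ball, h4]
    exact ⟨fun h => lt_of_mul_lt_mul_left h hl.le, fun h => mul_lt_mul_of_pos_left h hl⟩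
  by_cases hz : z ∈ Metric.ball p ρ
  · rw [indicator_of_mem hz, indicator_of_mem (hmem.2 hz)]
    exact h3 p (hP.mem_toFinset.1 hp) z hz
  · rw [indicator_of_notMem hz, indicator_of_notMem (mt hmem.1 hz)]

/-- Multiplication by `a`, as a real linear map, has determinant `‖a‖ ^ 2`. -/
theorem volume_copy (a b : ℂ) (S : Set ℂ) :
    volume (copy a b S) = ENNReal.ofReal (‖a‖ ^ 2) * volume S := by
  have h1 : copy a b S = (fun z => z + b) '' ((LinearMap.mulLeft ℝ a) '' S) := by
    rw [image_image]; rfl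
  have h2 : LinearMap.det (LinearMap.mulLeft ℝ a) = ‖a‖ ^ 2 := by
    rw [← Complex.normSq_eq_norm_sq, ← Algebra.norm_complex_apply, Algebra.norm_apply]
    rfl
  rw [h1, image_add_right, measure_preimage_add_right, Measure.addHaar_image_linearMap, h2,
    abs_of_nonneg (by positivity)]

theorem thickening_copy {a b : ℂ} (ha : a ≠ 0) (X Ω : Set ℂ) (ε : ℝ) :
    Metric.thickening ε (copy a b X) ∩ copy a b Ω
      = copy a b (Metric.thickening (ε / ‖a‖) X ∩ Ω) := by
  have ha' : 0 < ‖a‖ := norm_pos_iff.2 ha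
  have hd : ∀ z w : ℂ, dist (a * z + b) (a * w + b) = ‖a‖ * dist z w := fun z w => by
    rw [dist_add_right, dist_eq_norm, ← mul_sub, norm_mul, dist_eq_norm]
  ext z
  constructor
  · rintro ⟨h1, w, hw, rfl⟩
    obtain ⟨_, ⟨y, hy, rfl⟩, hdy⟩ := Metric.mem_thickening_iff.1 h1
    rw [hd] at hdy
    exact ⟨w, ⟨Metric.mem_thickening_iff.2 ⟨y, hy, by rwa [lt_div_iff₀' ha']⟩, hw⟩, rfl⟩
  · rintro ⟨w, ⟨h1, hw⟩, rfl⟩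
    obtain ⟨y, hy, hdy⟩ := Metric.mem_thickening_iff.1 h1
    refine ⟨Metric.mem_thickening_iff.2 ⟨_, ⟨y, hy, rfl⟩, ?_⟩, w, hw, rfl⟩
    rw [hd]
    rwa [lt_div_iff₀' ha'] at hdy

theorem tubeFun_copy {a b : ℂ} (ha : a ≠ 0) (X Ω : Set ℂ) (ε : ℝ) :
    tubeFun (copy a b X) (copy a b Ω) ε = ‖a‖ ^ 2 * tubeFun X Ω (ε / ‖a‖) := by
  rw [tubeFun, thickening_copy ha, volume_copy, ENNReal.toReal_mul,
    ENNReal.toReal_ofReal (by positivity), tubeFun]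

/-! ### Comparison of the tube with the tubes of the pieces -/

section
variable {γ : ℝ → ℂ} {n : ℕ} {l : ℝ} {A B : ℕ → ℂ} {N : ℕ} {a b : ℕ → ℂ} {Γ : ℝ → ℂ}

/-- The tube of a loop of arcs differs from the sum of the similar copies of the tube of one arc by
a function `F` with `F (l ε) = l² F (ε)` for small `ε`. -/
theorem IsLoopOfArcs.tube_decomposition {N' : ℕ} {a' b' : ℕ → ℂ} {Γ' : ℝ → ℂ}
    (h : IsLoopOfArcs γ N a b Γ) (h' : IsLoopOfArcs γ N' a' b' Γ') (hγ : IsSelfSimilarArc γ n l A B)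
    (ha' : a' 0 = 1) (hb' : b' 0 = 0) (hK : Γ '' Icc 0 N = Γ' '' Icc 0 N')
    (hidx : ∀ z, z ∉ Γ' '' Icc 0 N' → index Γ N z = index Γ' N' z) {Ω : Set ℂ}
    (hΩ : IsBoundedComponent Ω (Γ' '' Icc 0 N'))
    (h01 : LocInv l 0 Ω ∧ LocInv l 1 Ω) :
    ∀ᶠ ε in 𝓝 (0 : ℝ),
      tubeFun (Γ '' Icc 0 N) Ω (l * ε) - ∑ i ∈ Finset.range N,
          ‖a i‖ ^ 2 * tubeFun (γ '' Icc 0 1) Ω (l * ε / ‖a i‖)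
        = l ^ 2 * (tubeFun (Γ '' Icc 0 N) Ω ε - ∑ i ∈ Finset.range N,
          ‖a i‖ ^ 2 * tubeFun (γ '' Icc 0 1) Ω (ε / ‖a i‖)) := by
  set K := Γ '' Icc 0 N
  set C := γ '' Icc (0 : ℝ) 1
  have hKc : IsCompact K := h.loop.isCompact
  have hCc : IsCompact C := hγ.isCompact
  have hΩK : IsBoundedComponent Ω K := by rwa [hK]
  have hΩo : IsOpen Ω := hΩK.isOpen hKc.isClosed
  have hXc : ∀ i, IsCompact (copy (a i) (b i) C) := fun i => isCompact_copy hCc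
  have hXK : ∀ i < N, copy (a i) (b i) C ⊆ K := fun i hi z hz => h.mem_iff.2 ⟨i, hi, hz⟩
  have hΩi : ∀ i < N, IsOpen (copy (a i) (b i) Ω) := fun i hi => by
    have : copy (a i) (b i) Ω = (fun z => (z - b i) / a i) ⁻¹' Ω := by
      ext z; exact mem_copy (h.ne_zero i hi)
    rw [this]
    exact hΩo.preimage (by fun_prop)
  -- Comparing indicators rather than areas makes the cancellation pointwise. Away from corners a
  -- point of the curve lies on one piece, near which `Ω` coincides with the copy of `Ω` belonging
  -- to that piece.
  set u : ℝ → ℂ → ℝ := fun ε z => tubeInd K Ω ε z -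
    ∑ i ∈ Finset.range N, tubeInd (copy (a i) (b i) C) (copy (a i) (b i) Ω) ε z with hu
  have hint : ∀ ε, ∀ i ∈ Finset.range N,
      Integrable (tubeInd (copy (a i) (b i) C) (copy (a i) (b i) Ω) ε) := fun ε i hi =>
    (tubeInd_integrable (hXc i) (hΩi i (Finset.mem_range.1 hi)) ε).1
  have hui : ∀ ε, Integrable (u ε) := fun ε =>
    (tubeInd_integrable hKc hΩo ε).1.sub (integrable_finsetSum _ (hint ε))
  have hval : ∀ ε, ∫ z, u ε z = tubeFun K Ω ε - ∑ i ∈ Finset.range N,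
      ‖a i‖ ^ 2 * tubeFun C Ω (ε / ‖a i‖) := by
    intro ε
    rw [hu, integral_sub (tubeInd_integrable hKc hΩo ε).1 (integrable_finsetSum _ (hint ε)),
      (tubeInd_integrable hKc hΩo ε).2, integral_finsetSum _ (hint ε)]
    congr 1
    refine Finset.sum_congr rfl fun i hi => ?_
    have hi := Finset.mem_range.1 hi
    rw [(tubeInd_integrable (hXc i) (hΩi i hi) ε).2, tubeFun_copy (h.ne_zero i hi)]
  obtain ⟨R, hRK⟩ := hKc.isBounded.subset_ball (0 : ℂ)
  have hu0 : ∀ ε z, z ∉ Metric.thickening ε K → u ε z = 0 := by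
    intro ε z hz
    simp only [hu]
    rw [tubeInd_eq_zero hz, Finset.sum_eq_zero, sub_zero]
    intro i hi
    exact tubeInd_eq_zero fun h' =>
      hz (Metric.thickening_subset_of_subset ε (hXK i (Finset.mem_range.1 hi)) h')
  have key := integral_scale_of_corners hui (R := R + 1) (fun ε hε z hz => by
      refine hu0 ε z fun hm => ?_
      obtain ⟨y, hy, hd⟩ := Metric.mem_thickening_iff.1 hm
      have h1 := mem_ball_zero_iff.1 (hRK hy)
      rw [dist_eq_norm] at hd
      have := norm_sub_norm_le z y
      linarith) (finite_corners (Γ := Γ) (N := N)) hγ.l_pos hγ.l_lt_one ?_ ?_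
  · simpa only [hval] using key
  · intro x hxc
    by_cases hxK : x ∈ K
    · obtain ⟨i, hi, hiΩ, hother⟩ :=
        h.inside_eq_copy_near h' hγ ha' hb' hK hidx hΩ hxK hxc
      have h1 : ∀ᶠ q : ℝ × ℂ in 𝓝 (0, x), ∀ j ∈ Finset.range N, j ≠ i →
          q.2 ∉ Metric.thickening q.1 (copy (a j) (b j) C) := by
        rw [Filter.eventually_all_finset]
        intro j hj
        rw [Filter.eventually_imp_distrib_left]
        exact fun hji => eventually_notMem_thickening (hXc j).isClosed
          (hother j (Finset.mem_range.1 hj) hji)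
      filter_upwards [h1, (continuous_snd.tendsto ((0 : ℝ), x)).eventually hiΩ] with q hq hqΩ
      simp only [hu]
      rw [Finset.sum_eq_single_of_mem i (Finset.mem_range.2 hi)
        fun j hj hji => tubeInd_eq_zero (hq j hj hji), sub_eq_zero]
      refine tubeInd_congr ?_ hqΩ
      constructor
      · intro hm
        obtain ⟨y, hy, hd⟩ := Metric.mem_thickening_iff.1 hm
        obtain ⟨j, hj, hyj⟩ := h.mem_iff.1 hy
        by_cases hji : j = i
        · subst hji
          exact Metric.mem_thickening_iff.2 ⟨y, hyj, hd⟩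
        · exact absurd (Metric.mem_thickening_iff.2 ⟨y, hyj, hd⟩)
            (hq j (Finset.mem_range.2 hj) hji)
      · exact fun hm => Metric.thickening_subset_of_subset _ (hXK i hi) hm
    · filter_upwards [eventually_notMem_thickening hKc.isClosed hxK] with q hq using hu0 _ _ hq
  · intro p hp
    have h1 : ∀ i ∈ Finset.range N, ∀ᶠ q : ℝ × ℂ in 𝓝 (0, p),
        tubeInd (copy (a i) (b i) C) (copy (a i) (b i) Ω) (l * q.1) (p + l * (q.2 - p))
          = tubeInd (copy (a i) (b i) C) (copy (a i) (b i) Ω) q.1 q.2 := by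
      intro i hi
      have hi := Finset.mem_range.1 hi
      by_cases hpi : p ∈ copy (a i) (b i) C
      · have h2 : LocInv l p (copy (a i) (b i) Ω) := by
          rcases h.eq_endpoint hγ hp hi hpi with rfl | rfl
          · exact h01.1.copy (h.ne_zero i hi)
          · exact h01.2.copy (h.ne_zero i hi)
        filter_upwards [(h.locInv_copy hγ hp hi).thickening hγ.l_pos,
          (continuous_snd.tendsto ((0 : ℝ), p)).eventually h2] with q hq hq'
        exact tubeInd_congr hq hq'
      · have h2 := eventually_notMem_thickening (hXc i).isClosed hpi
        filter_upwards [h2, (tendsto_scale_prod l p).eventually h2] with q hq hq'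
        rw [tubeInd_eq_zero hq, tubeInd_eq_zero hq']
    filter_upwards [(Filter.eventually_all_finset _).2 h1,
      (h.locInv_curve hγ hp).thickening hγ.l_pos,
      (continuous_snd.tendsto ((0 : ℝ), p)).eventually (h.locInv_inside hγ hΩK hp)] with q hq hqK hqΩ
    simp only [hu]
    rw [tubeInd_congr hqK hqΩ, Finset.sum_congr rfl hq]

end

/-! ### The coefficients of the von Koch system and of the polygon -/

theorem ell_pos {r : ℝ} (hr1 : r < 1) : 0 < ell r := by unfold ell; linarith

theorem ell_lt_one {r : ℝ} (hr0 : 0 < r) : ell r < 1 := by unfold ell; linarith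

/-- The linear part of `vkMap n r k`. -/
def vkCoeff (n : ℕ) (r : ℝ) (k : ℕ) : ℂ := vkMap n r k 1 - vkMap n r k 0

theorem norm_exp_I_mul (x : ℝ) : ‖Complex.exp (Complex.I * x)‖ = 1 := by
  rw [mul_comm, Complex.norm_exp_ofReal_mul_I]

theorem psi_affine (n : ℕ) {r : ℝ} (hr0 : 0 < r) (k : ℕ) :
    ∃ c d : ℂ, ‖c‖ = r ∧ ∀ z, psi n r k z = c * z + d := by
  cases k with
  | zero =>
    refine ⟨r * Complex.exp (Complex.I * (alpha n : ℝ)), ell r, ?_, fun z => ?_⟩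
    · rw [norm_mul, norm_exp_I_mul, mul_one, Complex.norm_real, Real.norm_of_nonneg hr0.le]
    · rw [psi]; ring
  | succ j =>
    refine ⟨r * Complex.exp (Complex.I * ((alpha n - (j + 1) * theta n : ℝ) : ℂ)), psi n r j 1,
      ?_, fun z => ?_⟩
    · rw [norm_mul, norm_exp_I_mul, mul_one, Complex.norm_real, Real.norm_of_nonneg hr0.le]
    · rw [psi]; ring

theorem vkMap_affine (n : ℕ) {r : ℝ} (hr0 : 0 < r) (k : ℕ) :
    ∃ c d : ℂ, (‖c‖ = if k = 0 ∨ k = n then |ell r| else r) ∧ ∀ z, vkMap n r k z = c * z + d := by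
  cases k with
  | zero => exact ⟨ell r, 0, by simp, fun z => by simp [vkMap]⟩
  | succ j =>
    by_cases hj : j + 1 = n
    · exact ⟨ell r, ((ell r + r : ℝ) : ℂ), by simp [hj], fun z => by rw [vkMap, if_pos hj]⟩
    · obtain ⟨c, d, hc, hcd⟩ := psi_affine n hr0 j
      exact ⟨c, d, by simp [hj, hc], fun z => by rw [vkMap, if_neg hj, hcd]⟩

theorem vkMap_eq (n : ℕ) {r : ℝ} (hr0 : 0 < r) (k : ℕ) (z : ℂ) :
    vkMap n r k z = vkCoeff n r k * z + vkMap n r k 0 := by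
  obtain ⟨c, d, _, hcd⟩ := vkMap_affine n hr0 k
  simp only [vkCoeff, hcd]
  ring

theorem norm_vkCoeff (n : ℕ) {r : ℝ} (hr0 : 0 < r) (hr1 : r < 1) (k : ℕ) :
    ‖vkCoeff n r k‖ = if k = 0 ∨ k = n then ell r else r := by
  obtain ⟨c, d, hc, hcd⟩ := vkMap_affine n hr0 k
  rw [abs_of_pos (ell_pos hr1)] at hc
  rw [← hc, vkCoeff, hcd, hcd]
  congr 1
  ring

theorem vkCoeff_ne_zero (n : ℕ) {r : ℝ} (hr0 : 0 < r) (hr1 : r < 1) (k : ℕ) :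
    vkCoeff n r k ≠ 0 := by
  rw [← norm_pos_iff, norm_vkCoeff n hr0 hr1]
  split_ifs
  · exact ell_pos hr1
  · exact hr0

theorem vkMap_last {n : ℕ} (hn : n ≠ 0) {r : ℝ} (z : ℂ) :
    vkMap n r n z = ell r * z + (1 - ell r) := by
  obtain ⟨j, rfl⟩ := Nat.exists_eq_succ_of_ne_zero hn
  rw [vkMap, if_pos rfl]
  congr 1
  simp only [ell]
  push_cast
  ring

/-- The linear part of `edge n k`. -/
def edgeCoeff (n k : ℕ) : ℂ := Complex.exp (-Complex.I * (((k : ℝ) * theta n : ℝ) : ℂ))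

theorem norm_edgeCoeff (n k : ℕ) : ‖edgeCoeff n k‖ = 1 := by
  rw [edgeCoeff, neg_mul, ← mul_neg, ← Complex.ofReal_neg, norm_exp_I_mul]

theorem edgeCoeff_ne_zero (n k : ℕ) : edgeCoeff n k ≠ 0 := Complex.exp_ne_zero _

theorem edge_eq (n k : ℕ) (z : ℂ) : edge n k z = edgeCoeff n k * z + edge n k 0 := by
  cases k with
  | zero => simp [edge, edgeCoeff]
  | succ k => simp only [edge, edgeCoeff]; ring

theorem edge_zero_eq_sum (n k : ℕ) : edge n k 0 = ∑ j ∈ Finset.range k, edgeCoeff n j := by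
  induction k with
  | zero => simp [edge]
  | succ k ih =>
    rw [Finset.sum_range_succ, ← ih, edge, mul_zero, add_zero, edge_eq, mul_one, add_comm]

/-- The edge vectors are the powers of a primitive `n`-th root of unity, and these sum to `0`. -/
theorem edge_closed {n : ℕ} (hn : 2 ≤ n) : edge n n 0 = 0 := by
  have hn0 : (n : ℂ) ≠ 0 := by exact_mod_cast (by omega : n ≠ 0)
  have hpow : ∀ j, edgeCoeff n j = (edgeCoeff n 1) ^ j := fun j => by
    rw [edgeCoeff, edgeCoeff, ← Complex.exp_nat_mul]
    congr 1
    push_cast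
    ring
  have hprim : IsPrimitiveRoot (edgeCoeff n 1)⁻¹ n := by
    have := Complex.isPrimitiveRoot_exp n (by omega)
    convert this using 1
    rw [edgeCoeff, ← Complex.exp_neg, theta]
    congr 1
    push_cast
    field_simp
  rw [edge_zero_eq_sum]
  rw [Finset.sum_congr rfl fun j _ => hpow j]
  have h2 := hprim.inv
  rw [inv_inv] at h2
  exact h2.geom_sum_eq_zero (by omega)

/-! ### The parametrized von Koch curve and snowflake -/

section
variable {n : ℕ} {r : ℝ} {γ : ℝ → ℂ}

theorem IsVonKochParam.zero (hr0 : 0 < r) (h : IsVonKochParam n r γ) : γ 0 = 0 := by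
  have h1 := h.2 0 (by simp) 0 ⟨le_rfl, zero_le_one⟩
  simp only [Nat.cast_zero, add_zero, zero_div, vkMap] at h1
  have h2 : (1 - (ell r : ℂ)) * γ 0 = 0 := by linear_combination h1
  refine (mul_eq_zero.1 h2).resolve_left fun h3 => ?_
  have : ell r = 1 := by exact_mod_cast (sub_eq_zero.1 h3).symm
  exact (ell_lt_one hr0).ne this

theorem IsVonKochParam.one (hn : n ≠ 0) (hr0 : 0 < r) (h : IsVonKochParam n r γ) : γ 1 = 1 := by
  have h1 := h.2 n (by simp) 1 ⟨zero_le_one, le_rfl⟩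
  rw [div_self (by positivity), vkMap_last hn] at h1
  have h2 : (1 - (ell r : ℂ)) * (γ 1 - 1) = 0 := by linear_combination h1
  refine sub_eq_zero.1 ((mul_eq_zero.1 h2).resolve_left fun h3 => ?_)
  have : ell r = 1 := by exact_mod_cast (sub_eq_zero.1 h3).symm
  exact (ell_lt_one hr0).ne this

theorem IsVonKochParam.isSelfSimilarArc (hn : 3 ≤ n) (hr0 : 0 < r) (hr1 : r < 1)
    (h : IsVonKochParam n r γ)
    (hinj : InjOn (fun p : ℕ × ℝ => edge n p.1 (γ p.2)) ((Finset.range n : Set ℕ) ×ˢ Ico (0 : ℝ) 1)) :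
    IsSelfSimilarArc γ n (ell r) (vkCoeff n r) (fun k => vkMap n r k 0) where
  l_pos := ell_pos hr1
  l_lt_one := ell_lt_one hr0
  continuousOn := h.1
  injOn := by
    have h0 := h.zero hr0
    have h1 := h.one (by omega) hr0
    -- Simplicity is assumed for half-open arcs only; the endpoint `1` is recovered as the start of
    -- the second edge.
    have hne1 : ∀ s ∈ Ico (0 : ℝ) 1, γ s ≠ 1 := by
      intro s hs hs1
      have := hinj (x₁ := (0, s)) (x₂ := (1, 0)) ⟨by simp; omega, hs⟩
        ⟨by simp; omega, le_rfl, zero_lt_one⟩ (by simp [edge, h0, hs1])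
      simp at this
    intro s hs t ht hst
    rcases hs.2.lt_or_eq with hs1 | rfl <;> rcases ht.2.lt_or_eq with ht1 | rfl
    · have := hinj (x₁ := (0, s)) (x₂ := (0, t)) ⟨by simp; omega, hs.1, hs1⟩
        ⟨by simp; omega, ht.1, ht1⟩ (by simp [edge, hst])
      exact (Prod.ext_iff.1 this).2
    · exact absurd (hst.trans h1) (hne1 s ⟨hs.1, hs1⟩)
    · exact absurd (hst.symm.trans h1) (hne1 t ⟨ht.1, ht1⟩)
    · rfl
  piece k hk t ht := by rw [h.2 k (Finset.mem_range.2 hk) t ht, vkMap_eq n hr0]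
  A_ne k _ := vkCoeff_ne_zero n hr0 hr1 k
  A_zero := by simp [vkCoeff, vkMap]
  B_zero := by simp [vkMap]
  A_last := by simp only [vkCoeff, vkMap_last (show n ≠ 0 by omega)]; ring
  B_last := by simp only [vkMap_last (show n ≠ 0 by omega)]; ring
  zero := h.zero hr0
  one := h.one (by omega) hr0

/-- At a point of `C` farthest from `C'`, pulling back by one of the maps shows that the distance is
at most `q` times itself, with `q < 1`. -/
theorem vonKochCurve_unique (hr0 : 0 < r) (hr1 : r < 1) {C C' : Set ℂ}
    (hC : IsVonKochCurve n r C) (hC' : IsVonKochCurve n r C') : C ⊆ C' := by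
  obtain ⟨hne, hc, hfix⟩ := hC
  obtain ⟨hne', hc', hfix'⟩ := hC'
  set q := max (ell r) r
  have hq1 : q < 1 := max_lt (ell_lt_one hr0) hr1
  have hq : ∀ k, ‖vkCoeff n r k‖ ≤ q := fun k => by
    rw [norm_vkCoeff n hr0 hr1]
    split_ifs
    · exact le_max_left _ _
    · exact le_max_right _ _
  obtain ⟨x, hx, hmax⟩ := hc.exists_isMaxOn hne
    (Metric.continuous_infDist_pt C').continuousOn
  have hx0 : Metric.infDist x C' = 0 := by
    have h1 := hx
    rw [hfix] at h1
    obtain ⟨k, hk, y, hy, rfl⟩ := mem_iUnion₂.1 h1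
    obtain ⟨w, hw, hyw⟩ := hc'.exists_infDist_eq_dist hne' y
    have h2 : vkMap n r k w ∈ C' := by
      rw [hfix']
      exact mem_iUnion₂.2 ⟨k, hk, w, hw, rfl⟩
    have h3 : Metric.infDist (vkMap n r k y) C' ≤ q * Metric.infDist (vkMap n r k y) C' := by
      calc _ ≤ dist (vkMap n r k y) (vkMap n r k w) := Metric.infDist_le_dist_of_mem h2
        _ = ‖vkCoeff n r k‖ * dist y w := by
          rw [vkMap_eq n hr0 k y, vkMap_eq n hr0 k w, dist_add_right, dist_eq_norm, ← mul_sub,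
            norm_mul, dist_eq_norm]
        _ ≤ q * dist y w := by gcongr; exact hq k
        _ ≤ _ := by
          rw [← hyw]
          exact mul_le_mul_of_nonneg_left (hmax hy) ((norm_nonneg _).trans (hq 0))
    have h4 := Metric.infDist_nonneg (x := vkMap n r k y) (s := C')
    nlinarith
  intro y hy
  rw [← hc'.isClosed.closure_eq, Metric.mem_closure_iff_infDist_zero hne']
  exact le_antisymm (hx0 ▸ hmax hy) Metric.infDist_nonneg

theorem IsSelfSimilarArc.isVonKochCurve (hr0 : 0 < r)
    (h : IsSelfSimilarArc γ n (ell r) (vkCoeff n r) (fun k => vkMap n r k 0)) :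
    IsVonKochCurve n r (γ '' Icc 0 1) := by
  have hcopy : ∀ k, vkMap n r k '' (γ '' Icc 0 1)
      = copy (vkCoeff n r k) (vkMap n r k 0) (γ '' Icc 0 1) := fun k => by
    rw [copy]
    exact image_congr fun z _ => vkMap_eq n hr0 k z
  refine ⟨⟨γ 0, 0, ⟨le_rfl, zero_le_one⟩, rfl⟩, h.isCompact, ?_⟩
  ext z
  constructor
  · intro hz
    obtain ⟨k, hk, hm⟩ := h.exists_mem_copy hz
    exact mem_iUnion₂.2 ⟨k, Finset.mem_range.2 hk, by rwa [hcopy]⟩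
  · intro hz
    obtain ⟨k, hk, hm⟩ := mem_iUnion₂.1 hz
    rw [hcopy] at hm
    exact h.copy_subset (Finset.mem_range.1 hk) hm

/-- The closed curve `[0, n] → ℂ` that runs through the `n` von Koch curves. -/
def snowflakeCurve (n : ℕ) (γ : ℝ → ℂ) (x : ℝ) : ℂ :=
  ∑ j ∈ Finset.range n, edgeCoeff n j * γ (projIcc 0 1 zero_le_one (x - j))

/-- Edges already passed contribute their full vector, later ones contribute `0`; so the sum places
the current arc at the end of its predecessors. -/
theorem snowflakeCurve_add (h0 : γ 0 = 0) (h1 : γ 1 = 1) {i : ℕ} (hi : i < n) {t : ℝ}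
    (ht : t ∈ Icc (0 : ℝ) 1) :
    snowflakeCurve n γ (i + t) = edgeCoeff n i * γ t + edge n i 0 := by
  have hlow : ∀ j ∈ Finset.range i, edgeCoeff n j * γ (projIcc 0 1 zero_le_one ((i + t : ℝ) - j))
      = edgeCoeff n j := by
    intro j hj
    have : (j : ℝ) + 1 ≤ i := by exact_mod_cast Finset.mem_range.1 hj
    rw [projIcc_of_right_le _ (by linarith [ht.1]), h1, mul_one]
  have hhigh : ∀ j ∈ Finset.range n, j ∉ Finset.range (i + 1) →
      edgeCoeff n j * γ (projIcc 0 1 zero_le_one ((i + t : ℝ) - j)) = 0 := by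
    intro j _ hj
    have : (i : ℝ) + 1 ≤ j := by
      exact_mod_cast not_lt.1 (mt Finset.mem_range.2 hj)
    rw [projIcc_of_le_left _ (by linarith [ht.2]), h0, mul_zero]
  rw [snowflakeCurve, ← Finset.sum_subset (Finset.range_mono hi) hhigh, Finset.sum_range_succ,
    Finset.sum_congr rfl hlow, ← edge_zero_eq_sum, add_sub_cancel_left,
    projIcc_of_mem _ ht, add_comm]

theorem continuous_snowflakeCurve (hγ : ContinuousOn γ (Icc 0 1)) :
    Continuous (snowflakeCurve n γ) := by
  refine continuous_finsetSum _ fun j _ => continuous_const.mul ?_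
  have h1 : Continuous (IccExtend (zero_le_one (α := ℝ)) ((Icc (0 : ℝ) 1).domRestrict γ)) :=
    continuous_IccExtend_iff.2 (continuousOn_iff_continuous_domRestrict.1 hγ)
  exact h1.comp (continuous_id.sub continuous_const)

theorem isLoopOfArcs_snowflakeCurve (hn : 3 ≤ n) {A B : ℕ → ℂ}
    (hγ : IsSelfSimilarArc γ n (ell r) A B)
    (hinj : InjOn (fun p : ℕ × ℝ => edge n p.1 (γ p.2)) ((Finset.range n : Set ℕ) ×ˢ Ico (0 : ℝ) 1)) :
    IsLoopOfArcs γ n (edgeCoeff n) (fun k => edge n k 0) (snowflakeCurve n γ) where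
  ne_zero i _ := edgeCoeff_ne_zero n i
  piece i hi t ht := snowflakeCurve_add hγ.zero hγ.one hi ht
  loop := by
    have hpiece : ∀ i < n, ∀ t ∈ Icc (0 : ℝ) 1, snowflakeCurve n γ (i + t) = edge n i (γ t) :=
      fun i hi t ht => by rw [snowflakeCurve_add hγ.zero hγ.one hi ht, edge_eq n i (γ t)]
    refine ⟨by exact_mod_cast (by omega : 0 < n),
      (continuous_snowflakeCurve hγ.continuousOn).continuousOn, fun x hx y hy hxy => ?_, ?_⟩
    · have hdec : ∀ x ∈ Ico (0 : ℝ) n, ⌊x⌋₊ < n ∧ x - ⌊x⌋₊ ∈ Ico (0 : ℝ) 1 := fun x hx =>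
        ⟨(Nat.floor_lt hx.1).2 hx.2, by linarith [Nat.floor_le hx.1],
          by linarith [Nat.lt_floor_add_one x]⟩
      obtain ⟨hx1, hx2⟩ := hdec x hx
      obtain ⟨hy1, hy2⟩ := hdec y hy
      have e1 := hpiece _ hx1 _ (Ico_subset_Icc_self hx2)
      have e2 := hpiece _ hy1 _ (Ico_subset_Icc_self hy2)
      rw [add_sub_cancel] at e1 e2
      have := hinj (x₁ := (⌊x⌋₊, x - ⌊x⌋₊)) (x₂ := (⌊y⌋₊, y - ⌊y⌋₊)) ⟨by simpa using hx1, hx2⟩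
        ⟨by simpa using hy1, hy2⟩ (by simp only; rw [← e1, ← e2, hxy])
      obtain ⟨h1, h2⟩ := Prod.ext_iff.1 this
      simp only at h1 h2
      rw [h1] at h2
      linarith
    · have h1 := hpiece (n - 1) (by omega) 1 ⟨zero_le_one, le_rfl⟩
      rw [Nat.cast_pred (by omega), sub_add_cancel, hγ.one] at h1
      have h2 := hpiece 0 (by omega) 0 ⟨le_rfl, zero_le_one⟩
      rw [Nat.cast_zero, add_zero, hγ.zero] at h2
      rw [h1, h2, ← edge_closed (n := n) (by omega)]
      obtain ⟨m, rfl⟩ : ∃ m, n = m + 1 := ⟨n - 1, by omega⟩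
      simp [edge]

/-- A loop of arcs, cut into the copies of the pieces of its arcs, is a loop of arcs. -/
theorem IsLoopOfArcs.refine {l : ℝ} {A B : ℕ → ℂ} (hγ : IsSelfSimilarArc γ n l A B) {N : ℕ}
    {a b : ℕ → ℂ} {Γ : ℝ → ℂ} (h : IsLoopOfArcs γ N a b Γ) :
    IsLoopOfArcs γ (N * (n + 1)) (fun i => a (i / (n + 1)) * A (i % (n + 1)))
      (fun i => a (i / (n + 1)) * B (i % (n + 1)) + b (i / (n + 1))) (fun x => Γ (x / (n + 1))) where
  ne_zero i hi := mul_ne_zero (h.ne_zero _ (Nat.div_lt_of_lt_mul (by rwa [mul_comm])))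
    (hγ.A_ne _ (Nat.mod_lt _ (by omega)))
  loop := by
    have hn : (0 : ℝ) < n + 1 := by positivity
    have hN : ((N * (n + 1) : ℕ) : ℝ) = N * (n + 1) := by push_cast; ring
    rw [hN]
    refine ⟨mul_pos h.loop.pos hn, ?_, ?_, ?_⟩
    · refine h.loop.continuousOn.comp (by fun_prop) fun x hx => ?_
      exact ⟨div_nonneg hx.1 hn.le, (div_le_iff₀ hn).2 hx.2⟩
    · intro x hx y hy hxy
      have := h.loop.injOn (x₁ := x / (n + 1)) (x₂ := y / (n + 1))
        ⟨div_nonneg hx.1 hn.le, (div_lt_iff₀ hn).2 hx.2⟩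
        ⟨div_nonneg hy.1 hn.le, (div_lt_iff₀ hn).2 hy.2⟩ hxy
      exact (div_left_inj' hn.ne').1 this
    · rw [mul_div_cancel_right₀ _ hn.ne', zero_div, h.loop.closed]
  piece i hi t ht := by
    have hq : i / (n + 1) < N := Nat.div_lt_of_lt_mul (by rwa [mul_comm])
    have hk : i % (n + 1) < n + 1 := Nat.mod_lt _ (by omega)
    have hi' : (i : ℝ) = (i / (n + 1) : ℕ) * (n + 1) + (i % (n + 1) : ℕ) := by
      have := Nat.div_add_mod' i (n + 1)
      exact_mod_cast this.symm
    have e : ((i : ℝ) + t) / (n + 1)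
        = (i / (n + 1) : ℕ) + ((i % (n + 1) : ℕ) + t) / ((n : ℝ) + 1) := by
      have hn : (n : ℝ) + 1 ≠ 0 := by positivity
      rw [hi']
      field_simp
      ring
    rw [e, h.piece _ hq _ (mem_Icc_div hk ht), hγ.piece _ hk t ht]
    ring

theorem image_comp_div (Γ : ℝ → ℂ) (N n : ℕ) :
    (fun x : ℝ => Γ (x / (n + 1))) '' Icc 0 ((N * (n + 1) : ℕ) : ℝ) = Γ '' Icc 0 N := by
  have hn : (0 : ℝ) < n + 1 := by positivity
  push_cast
  ext z
  constructor
  · rintro ⟨x, hx, rfl⟩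
    exact ⟨_, ⟨div_nonneg hx.1 hn.le, (div_le_iff₀ hn).2 hx.2⟩, rfl⟩
  · rintro ⟨x, hx, rfl⟩
    refine ⟨x * (n + 1), ⟨mul_nonneg hx.1 hn.le, mul_le_mul_of_nonneg_right hx.2 hn.le⟩, ?_⟩
    beta_reduce
    rw [mul_div_cancel_right₀ _ hn.ne']

theorem index_comp_div {Γ : ℝ → ℂ} {N : ℕ} (h : IsSimpleLoop Γ N) (n : ℕ) {z : ℂ}
    (hz : z ∉ Γ '' Icc 0 N) :
    index (fun x : ℝ => Γ (x / (n + 1))) ((N * (n + 1) : ℕ) : ℝ) z = index Γ N z := by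
  have hn : (0 : ℝ) < n + 1 := by positivity
  have e1 : ((n : ℝ) + 1)⁻¹ * ((N * (n + 1) : ℕ) : ℝ) + 0 = N := by push_cast; field_simp; ring
  have e0 : ((n : ℝ) + 1)⁻¹ * 0 + 0 = 0 := by ring
  have h2 := logVar_comp_affine (f := fun t => Γ t - z) (a := 0) (b := ((N * (n + 1) : ℕ) : ℝ))
    (m := ((n : ℝ) + 1)⁻¹) (k := 0) (by positivity) (by positivity)
    (by rw [e0, e1]; exact h.continuousOn.sub continuousOn_const)
    (by rw [e0, e1]; exact fun t ht h0 => hz ⟨t, ht, sub_eq_zero.1 h0⟩)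
  rw [e0, e1] at h2
  rw [index, index, ← h2]
  refine logVar_congr fun t _ => ?_
  rw [add_zero, inv_mul_eq_div]

theorem sum_range_mul_mod (g : ℕ → ℝ) (N m : ℕ) :
    ∑ i ∈ Finset.range (N * m), g (i % m) = N * ∑ k ∈ Finset.range m, g k := by
  induction N with
  | zero => simp
  | succ N ih =>
    rw [Nat.succ_mul, Finset.sum_range_add, ih, Nat.cast_succ, add_mul, one_mul]
    congr 1
    refine Finset.sum_congr rfl fun k hk => ?_
    rw [Nat.mul_add_mod_self_right, Nat.mod_eq_of_lt (Finset.mem_range.1 hk)]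

theorem sum_vkCoeff (hn : n ≠ 0) (hr0 : 0 < r) (hr1 : r < 1) (f : ℝ → ℝ) :
    ∑ k ∈ Finset.range (n + 1), f ‖vkCoeff n r k‖ = 2 * f (ell r) + ((n : ℝ) - 1) * f r := by
  obtain ⟨m, rfl⟩ := Nat.exists_eq_succ_of_ne_zero hn
  rw [Finset.sum_range_succ, Finset.sum_range_succ', norm_vkCoeff _ hr0 hr1 0,
    norm_vkCoeff _ hr0 hr1 (m + 1)]
  have : ∀ k ∈ Finset.range m, f ‖vkCoeff (m + 1) r (k + 1)‖ = f r := fun k hk => by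
    have := Finset.mem_range.1 hk
    rw [norm_vkCoeff _ hr0 hr1, if_neg (by omega)]
  rw [Finset.sum_congr rfl this]
  simp
  ring

/-- The remainder of the scaling functional equation of the snowflake is self-similar near zero. -/
theorem snowflake_remainder (hn : 3 ≤ n) (hr0 : 0 < r) (hr1 : r < 1) (h : IsVonKochParam n r γ)
    (hinj : InjOn (fun p : ℕ × ℝ => edge n p.1 (γ p.2)) ((Finset.range n : Set ℕ) ×ˢ Ico (0 : ℝ) 1))
    {Ω : Set ℂ} (hΩ : IsBoundedComponent Ω (snowflakeCurve n γ '' Icc 0 n)) {V : ℝ → ℝ}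
    (hV : V = tubeFun (snowflakeCurve n γ '' Icc 0 n) Ω) :
    ∀ᶠ t in 𝓝 (0 : ℝ),
      V (ell r * t) - 2 * ell r ^ 2 * V (ell r * t / ell r) - ((n : ℝ) - 1) * r ^ 2 * V (ell r * t / r)
        = ell r ^ 2 * (V t - 2 * ell r ^ 2 * V (t / ell r) - ((n : ℝ) - 1) * r ^ 2 * V (t / r)) := by
  have hγ := h.isSelfSimilarArc hn hr0 hr1 hinj
  have h0 := isLoopOfArcs_snowflakeCurve hn hγ hinj
  have h1 := h0.refine hγ
  have ha0 : edgeCoeff n 0 = 1 := by simp [edgeCoeff]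
  have hb0 : edge n 0 0 = 0 := rfl
  have hc0 : (0 : ℂ) ∈ corners (snowflakeCurve n γ) n := by
    refine ⟨0, by simp; omega, ?_⟩
    have := snowflakeCurve_add hγ.zero hγ.one (n := n) (i := 0) (by omega) (t := 0)
      ⟨le_rfl, zero_le_one⟩
    rw [add_zero, hγ.zero, hb0] at this
    simpa using this
  have hc1 : (1 : ℂ) ∈ corners (snowflakeCurve n γ) n := by
    refine ⟨1, by simp; omega, ?_⟩
    have := snowflakeCurve_add hγ.zero hγ.one (n := n) (i := 0) (by omega) (t := 1)
      ⟨zero_le_one, le_rfl⟩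
    rw [hγ.one, hb0, ha0] at this
    simpa using this
  have h01 := And.intro (h0.locInv_inside hγ hΩ hc0) (h0.locInv_inside hγ hΩ hc1)
  -- The same tube is compared with `n` copies of the arc tube `W`, then with its `n(n+1)` smaller
  -- copies.
  have D0 := h0.tube_decomposition h0 hγ ha0 hb0 rfl (fun _ _ => rfl) hΩ h01
  have D1 := h1.tube_decomposition h0 hγ ha0 hb0 (image_comp_div _ n n)
    (fun z hz => index_comp_div h0.loop n hz) hΩ h01
  rw [image_comp_div _ n n, ← hV] at D1
  rw [← hV] at D0
  set W := tubeFun (γ '' Icc 0 1) Ω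
  have s0 : ∀ ε, ∑ i ∈ Finset.range n, ‖edgeCoeff n i‖ ^ 2 * W (ε / ‖edgeCoeff n i‖) = n * W ε := by
    intro ε
    simp [norm_edgeCoeff]
  have s1 : ∀ ε, ∑ i ∈ Finset.range (n * (n + 1)),
      ‖edgeCoeff n (i / (n + 1)) * vkCoeff n r (i % (n + 1))‖ ^ 2 *
        W (ε / ‖edgeCoeff n (i / (n + 1)) * vkCoeff n r (i % (n + 1))‖)
      = n * (2 * (ell r ^ 2 * W (ε / ell r)) + ((n : ℝ) - 1) * (r ^ 2 * W (ε / r))) := by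
    intro ε
    simp only [norm_mul, norm_edgeCoeff, one_mul]
    rw [sum_range_mul_mod (fun k => ‖vkCoeff n r k‖ ^ 2 * W (ε / ‖vkCoeff n r k‖)),
      sum_vkCoeff (by omega) hr0 hr1 (fun x => x ^ 2 * W (ε / x))]
  simp only [s0] at D0
  simp only [s1] at D1
  have ht : ∀ x : ℝ, Tendsto (fun ε : ℝ => ε / x) (𝓝 0) (𝓝 0) := fun x => by
    have : Continuous fun ε : ℝ => ε / x := by fun_prop
    simpa using this.tendsto 0
  filter_upwards [D1, (ht (ell r)).eventually D0, (ht r).eventually D0] with ε e1 e2 e3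
  rw [← mul_div_assoc] at e2 e3
  -- The relation for the fine cut, minus the coarse one at `ε / ℓ` and `ε / r` with the weights of
  -- the functional equation, eliminates `W`.
  linear_combination e1 - 2 * ell r ^ 2 * e2 - ((n : ℝ) - 1) * r ^ 2 * e3

end

/-! ### Invariance under isometries -/

/-- An isometry of the plane is a real linear isometry followed by a translation. -/
theorem measurePreserving_isometryEquiv (F : ℂ ≃ᵢ ℂ) : MeasurePreserving F volume volume := by
  have h1 := (F.toRealLinearIsometryEquiv).measurePreserving
  have h2 := measurePreserving_add_right (volume : Measure ℂ) (F 0)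
  have h3 := h2.comp h1
  have e : (fun x => x + F 0) ∘ ⇑F.toRealLinearIsometryEquiv = F := by
    funext z
    rw [Function.comp_apply, IsometryEquiv.toRealLinearIsometryEquiv_apply, sub_add_cancel]
  exact (congrArg (fun f : ℂ → ℂ => MeasurePreserving f volume volume) e).mp h3

theorem tubeFun_image (F : ℂ ≃ᵢ ℂ) (X Ω : Set ℂ) (ε : ℝ) :
    tubeFun (F '' X) (F '' Ω) ε = tubeFun X Ω ε := by
  have h1 : Metric.thickening ε (F '' X) ∩ F '' Ω = F '' (Metric.thickening ε X ∩ Ω) := by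
    rw [image_inter F.injective]
    congr 1
    ext z
    constructor
    · intro hz
      obtain ⟨_, ⟨y, hy, rfl⟩, hd⟩ := Metric.mem_thickening_iff.1 hz
      refine ⟨F.symm z, Metric.mem_thickening_iff.2 ⟨y, hy, ?_⟩, F.apply_symm_apply z⟩
      rwa [← F.dist_eq, F.apply_symm_apply]
    · rintro ⟨w, hw, rfl⟩
      obtain ⟨y, hy, hd⟩ := Metric.mem_thickening_iff.1 hw
      exact Metric.mem_thickening_iff.2 ⟨F y, ⟨y, hy, rfl⟩, by rwa [F.dist_eq]⟩
  have h2 : F '' (Metric.thickening ε X ∩ Ω) = F.symm ⁻¹' (Metric.thickening ε X ∩ Ω) := by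
    ext z
    constructor
    · rintro ⟨w, hw, rfl⟩
      simpa using hw
    · intro hz
      exact ⟨F.symm z, hz, F.apply_symm_apply z⟩
  rw [tubeFun, tubeFun, h1, h2, (measurePreserving_isometryEquiv F.symm).measure_preimage_emb
    F.symm.toHomeomorph.measurableEmbedding]

theorem IsBoundedComponent.image {Ω K : Set ℂ} (h : IsBoundedComponent Ω K) (F : ℂ ≃ᵢ ℂ) :
    IsBoundedComponent (F '' Ω) (F '' K) := by
  obtain ⟨⟨x, hx, rfl⟩, hb⟩ := h
  refine ⟨⟨F x, ?_, ?_⟩, F.isometry.lipschitz.isBounded_image hb⟩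
  · rintro ⟨y, hy, hxy⟩
    exact hx (F.injective hxy ▸ hy)
  · rw [← image_compl_eq F.bijective]
    exact F.toHomeomorph.image_connectedComponentIn hx

/-! ### The tube zeta function of the snowflake -/

theorem tubeFun_nonneg (X Ω : Set ℂ) (t : ℝ) : 0 ≤ tubeFun X Ω t := ENNReal.toReal_nonneg

theorem tubeFun_mono (X : Set ℂ) {Ω : Set ℂ} (hΩ : Bornology.IsBounded Ω) :
    Monotone (tubeFun X Ω) := fun _ _ hst =>
  ENNReal.toReal_mono ((measure_mono inter_subset_right).trans_lt hΩ.measure_lt_top).ne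
    (measure_mono (inter_subset_inter_left _ (Metric.thickening_mono hst X)))

theorem tubeFun_le (X : Set ℂ) {Ω : Set ℂ} (hΩ : Bornology.IsBounded Ω) (t : ℝ) :
    tubeFun X Ω t ≤ (volume Ω).toReal :=
  ENNReal.toReal_mono hΩ.measure_lt_top.ne (measure_mono inter_subset_right)

theorem exists_isBigO_of_upperMinkowskiDim_lt (X : Set ℂ) {Ω : Set ℂ} (hΩ : Bornology.IsBounded Ω)
    {x : ℝ} (hx : upperMinkowskiDim X Ω < x) :
    ∃ d < x, (fun t => tubeFun X Ω t / t ^ (2 - d)) =O[𝓝[>] 0] (fun _ => (1 : ℝ)) := by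
  have hne : {d : ℝ | Tendsto (fun t : ℝ => tubeFun X Ω t / t ^ (2 - d)) (𝓝[>] 0) (𝓝 0)}.Nonempty := by
    -- Any `d > 2` would do, because the tube function is bounded by the area of `Ω`. Nonemptiness
    -- is needed since the infimum of the empty set has the default value `0`.
    refine ⟨3, ?_⟩
    have h1 : Tendsto (fun t : ℝ => (volume Ω).toReal * t) (𝓝[>] 0) (𝓝 0) := by
      have : Continuous fun t : ℝ => (volume Ω).toReal * t := by fun_prop
      simpa using (this.tendsto 0).mono_left nhdsWithin_le_nhds
    have hpos : ∀ᶠ t : ℝ in 𝓝[>] 0, 0 < t := self_mem_nhdsWithin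
    refine tendsto_of_tendsto_of_tendsto_of_le_of_le' tendsto_const_nhds h1 ?_ ?_
    · filter_upwards [hpos] with t ht
      exact div_nonneg (tubeFun_nonneg X Ω t) (Real.rpow_nonneg ht.le _)
    · filter_upwards [hpos] with t ht
      rw [show (2 - 3 : ℝ) = -1 by norm_num, Real.rpow_neg_one, div_inv_eq_mul]
      exact mul_le_mul_of_nonneg_right (tubeFun_le X hΩ t) ht.le
  obtain ⟨d, hd, hdx⟩ := exists_lt_of_csInf_lt hne hx
  exact ⟨d, hdx, Tendsto.isBigO_one ℝ hd⟩

/-- The tube function of a snowflake agrees with the one of a snowflake curve. -/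
theorem IsVonKochSnowflake.exists_curve {n : ℕ} (hn : 3 ≤ n) {r : ℝ} (hr0 : 0 < r) (hr1 : r < 1)
    {γ : ℝ → ℂ} (h : IsVonKochParam n r γ)
    (hinj : InjOn (fun p : ℕ × ℝ => edge n p.1 (γ p.2)) ((Finset.range n : Set ℕ) ×ˢ Ico (0 : ℝ) 1))
    {K Ω : Set ℂ} (hK : IsVonKochSnowflake n r K) (hΩ : IsBoundedComponent Ω K) :
    ∃ Ω₀, IsBoundedComponent Ω₀ (snowflakeCurve n γ '' Icc 0 n) ∧
      tubeFun K Ω = tubeFun (snowflakeCurve n γ '' Icc 0 n) Ω₀ := by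
  obtain ⟨C, hC, F, hF⟩ := hK
  have hγ := h.isSelfSimilarArc hn hr0 hr1 hinj
  have hγC := hγ.isVonKochCurve hr0
  have hCe : C = γ '' Icc 0 1 :=
    (vonKochCurve_unique hr0 hr1 hC hγC).antisymm (vonKochCurve_unique hr0 hr1 hγC hC)
  have hloop := isLoopOfArcs_snowflakeCurve hn hγ hinj
  have hK0 : ⋃ k ∈ Finset.range n, edge n k '' C = snowflakeCurve n γ '' Icc 0 n := by
    ext z
    rw [hloop.mem_iff, hCe]
    have : ∀ k, edge n k '' (γ '' Icc 0 1) = copy (edgeCoeff n k) (edge n k 0) (γ '' Icc 0 1) :=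
      fun k => image_congr fun z _ => edge_eq n k z
    simp only [mem_iUnion, Finset.mem_range, this, exists_prop]
  have hinv : ∀ X : Set ℂ, F.symm '' (F '' X) = X := fun X => by
    rw [← image_comp, F.symm_comp_self, image_id]
  have hinv' : F '' (F.symm '' Ω) = Ω := by
    rw [← image_comp, F.self_comp_symm, image_id]
  rw [hK0] at hF
  refine ⟨F.symm '' Ω, ?_, ?_⟩
  · have := hΩ.image F.symm
    rwa [hF, hinv] at this
  · funext ε
    rw [← tubeFun_image F (snowflakeCurve n γ '' Icc 0 n), ← hF, hinv']

/-- The self-similar remainder feeds `exists_entire_numerator`. Every `s` to the right of the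
Minkowski dimension admits an exponent `d < Re s` with the required bound. -/
theorem isDenQuotient_tubeZeta {n : ℕ} (hn : 3 ≤ n) {r : ℝ} (hr0 : 0 < r) (hr1 : r < 1)
    (hsimple : IsSimpleClosed n r) {K Ω : Set ℂ} (hK : IsVonKochSnowflake n r K)
    (hΩ : IsBoundedComponent Ω K) {δ : ℝ} (hδ : 0 < δ) :
    IsDenQuotient (tubeZeta K Ω δ) (upperMinkowskiDim K Ω) (ell r) r ((n : ℝ) - 1) := by
  obtain ⟨γ, h, hinj⟩ := hsimple
  obtain ⟨Ω₀, hΩ₀, hV⟩ := hK.exists_curve hn hr0 hr1 h hinj hΩ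
  obtain ⟨ε₀, hε₀, hom⟩ :=
    Metric.eventually_nhds_iff.1 (snowflake_remainder hn hr0 hr1 h hinj hΩ₀ hV)
  obtain ⟨G, hG, hGb, hfG⟩ := exists_entire_numerator (tubeFun_mono K hΩ.2) (tubeFun_nonneg K Ω)
    (tubeFun_le K hΩ.2) (ell_pos hr1) (ell_lt_one hr0) hr0 hr1 hδ hε₀ fun t ht hte =>
      hom (by rwa [Real.dist_eq, sub_zero, abs_of_pos ht])
  refine ⟨ell_pos hr1, ell_lt_one hr0, hr0, hr1, ?_, fun s hs => ?_, G, hG, hGb, fun s hs => ?_⟩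
  · have : (3 : ℝ) ≤ n := by exact_mod_cast hn
    linarith
  · obtain ⟨d, hd, hO⟩ := exists_isBigO_of_upperMinkowskiDim_lt K hΩ.2 hs
    exact (hfG d s hO hd).1.differentiableWithinAt
  · obtain ⟨d, hd, hO⟩ := exists_isBigO_of_upperMinkowskiDim_lt K hΩ.2 hs
    exact (hfG d s hO hd).2

end GKF

end

/-! ### The four languidity assertions -/

theorem mainTheorem8 (n : ℕ) (hn : 3 ≤ n) (r : ℝ) (hr0 : 0 < r) (hr1 : r < 1)
    (hsimple : GKF.IsSimpleClosed n r) (K Ω : Set ℂ) (hK : GKF.IsVonKochSnowflake n r K)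
    (hΩ : GKF.IsBoundedComponent Ω K) (δ : ℝ) (hδ : 0 < δ) :
    (∀ α : ℝ, 0 < α →
      GKF.SatisfiesL1 (GKF.tubeZeta K Ω δ) (GKF.upperMinkowskiDim K Ω) 0 (fun _ => α)) ∧
    (∀ α : ℝ, 0 < α → (∃ η > (0 : ℝ), ∀ ω ∈ GKF.scalingPoles n r, η ≤ |ω.re - α|) →
      GKF.Languid (GKF.tubeZeta K Ω δ) (GKF.upperMinkowskiDim K Ω) 0 (fun _ => α)) ∧
    (∀ a b : ℝ, 0 < a → a < b → ∃ S : ℝ → ℝ, (∀ τ, S τ ∈ Set.Icc a b) ∧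
      GKF.Languid (GKF.tubeZeta K Ω δ) (GKF.upperMinkowskiDim K Ω) 0 S) ∧
    (∀ κ : ℝ, 0 ≤ κ → GKF.StronglyLanguid (GKF.remainderZeta n r K Ω δ) 0 κ →
      GKF.StronglyLanguid (GKF.tubeZeta K Ω δ) (GKF.upperMinkowskiDim K Ω) κ ∧
      GKF.StronglyLanguidRFD K Ω κ) := by
  have h := GKF.isDenQuotient_tubeZeta hn hr0 hr1 hsimple hK hΩ hδ
  refine ⟨fun α _ => h.satisfiesL1 le_rfl ⟨0, LipschitzWith.const α⟩ (fun _ => le_rfl),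
    fun α hα ⟨η, hη, hpole⟩ => h.languid_line hα hη fun s hs => hpole s ?_,
    fun a b _ hab => h.exists_languid_screen hab,
    fun κ hκ _ => ⟨h.stronglyLanguid hκ, δ, hδ, h.stronglyLanguid hκ⟩⟩
  simpa [GKF.scalingPoles] using hs
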